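/- **Setting.** Let $N\ge 1$, let $\mathcal S^N$ be the symmetric $N\times N$ matrices with the operator norm, and let $\Omega\subset\mathbb R^N$ be a $C^2$-domain (nonempty, open, connected, possibly unbounded) satisfying the uniform interior ball condition (there is $\varrho>0$ such that every $x\in\partial\Omega$ lies on the boundary of an open ball $B\subset\Omega$ of radius $\varrho$) and the uniform exterior ball condition (the same for $\mathbb R^N\setminus\overline\Omega$). Let $n$ be the outward unit normal on $\partial\Omega$, $T\in\mathbb R$, and let $g:\overline\Omega\to\mathbb R$ and $h:\partial\Omega\to\mathbb R$ be continuous and bounded. Let $f=f(t,x,z,p,\Gamma)$ be a continuous real function on $\mathbb R\times\overline\Omega\times\mathbb R\times\mathbb R^N\times\mathcal S^N$ such that, for some $q,r\ge1$, $C>0$ and, for every $K$, some $C_K\ge0$, for all $t,x,z,p,p',\Gamma,\Gamma'$: - $f(t,x,z,p,\Gamma_1+\Gamma_2)\le f(t,x,z,p,\Gamma_1)$ whenever $\Gamma_2\ge0$; - $|f(t,x,z,p,\Gamma)|\le C_K(1+|z|)$ if $\|(p,\Gamma)\|\le K$; - $|f(t,x,z,p,\Gamma)-f(t,x,z,p',\Gamma')|\le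 C_K(1+|z|)\,\|(p,\Gamma)-(p',\Gamma')\|$ if $\|(p,\Gamma)\|+\|(p',\Gamma')\|\le K$; - $|f(t,x,z,p,\Gamma)|\le C(1+|z|+\|p\|^q+\|\Gamma\|^r)$. Let $\alpha,\beta,\gamma>0$ satisfy $\alpha<\tfrac13$, $\alpha+\beta<1$, $2\alpha+\gamma<2$, $\max(\beta q,\beta r)<2$, $\gamma<1-\alpha$, $\beta(q-1)<\alpha+1$, $\gamma(r-1)<2\alpha$, $\gamma r<1+\alpha$. Consider the final-value problem $$\partial_tu-f(t,x,u,Du,D^2u)=0\ (x\in\Omega,\ t<T),\qquad \langle Du,n\rangle=h\ (x\in\partial\Omega,\ t<T),\qquad u(\cdot,T)=g\ \text{on }\overline\Omega. \tag{1}$$ **Game.** For small $\varepsilon>0$ define $U^\varepsilon(x,z,t)$ for $x\in\overline\Omega$, $z\in\mathbb R$, $t\in\{T-j\varepsilon^2: j=0,1,2,\dots\}$ by $U^\varepsilon(x,z,T)=g(x)-z$ and $$U^\varepsilon(x,z,t)=\sup_{p,\Gamma}\ \inf_{\Delta\hat x}\ U^\varepsilon(x+\Delta x,\,z+\Delta z,\,t+\varepsilon^2)\qquad(t<T),$$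 with $p\in\mathbb R^N$, $\|p\|\le\varepsilon^{-\beta}$, $\Gamma\in\mathcal S^N$, $\|\Gamma\|\le\varepsilon^{-\gamma}$, $\Delta\hat x\in\mathbb R^N$, $\|\Delta\hat x\|\le\varepsilon^{1-\alpha}$, $x+\Delta x=\operatorname{proj}_{\overline\Omega}(x+\Delta\hat x)$ the nearest point of $\overline\Omega$ (unique for small $\varepsilon$), and $$\Delta z=p\cdot\Delta\hat x+\tfrac12\langle\Gamma\Delta\hat x,\Delta\hat x\rangle+\varepsilon^2f(t,x,z,p,\Gamma)-\|\Delta\hat x-\Delta x\|\,h(x+\Delta x)$$ (the last term is $0$ if $x+\Delta\hat x\in\overline\Omega$). Put $$u^\varepsilon(x,t)=\sup\{z:U^\varepsilon(x,z,t)\ge0\},\qquad v^\varepsilon(x,t)=\inf\{z:U^\varepsilon(x,z,t)\le0\}$$ ($\sup\emptyset=-\infty$, $\inf\emptyset=+\infty$) and, for $x\in\overline\Omega$, $t\le T$, $$\overline u(x,t)=\limsup_{\substack{\varepsilon\to0^+,\ \overline\Omega\ni y\to x\\ T-j\varepsilon^2\to t}}u^\varepsilon(y,T-j\varepsilon^2),\qquad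 \underline v(x,t)=\liminf_{\substack{\varepsilon\to0^+,\ \overline\Omega\ni y\to x\\ T-j\varepsilon^2\to t}}v^\varepsilon(y,T-j\varepsilon^2).$$ **Viscosity solutions.** Let $t_*<T$ and $Q=\overline\Omega\times[t_*,T]$. A viscosity subsolution of (1) on $Q$ is an upper semicontinuous $u:Q\to\mathbb R$ with $u(\cdot,T)\le g$ such that, whenever $\phi$ is $C^\infty$ and $u-\phi$ has a local maximum relative to $Q$ at $(x_0,t_0)$, $t_*\le t_0<T$, then with $E=\partial_t\phi(x_0,t_0)-f(t_0,x_0,u(x_0,t_0),D\phi(x_0,t_0),D^2\phi(x_0,t_0))$ one has $E\ge0$ if $x_0\in\Omega$, and $\min\{-E,\langle D\phi(x_0,t_0),n(x_0)\rangle-h(x_0)\}\le0$ if $x_0\in\partial\Omega$. A viscosity supersolution is a lower semicontinuous $u:Q\to\mathbb R$ with $u(\cdot,T)\ge g$ such that at local minima of $u-\phi$ one has $E\le0$ if $x_0\in\Omega$, and $\max\{-E,\langle D\phi(x_0,t_0),n(x_0)\rangle-h(x_0)\}\ge0$ if $x_0\in\partial\Omega$. A viscosity solution is a continuous function that is both.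 The comparison principle on $Q$ says that every bounded subsolution $u$ and every bounded supersolution $v$ on $Q$ satisfy $u\le v$ on $Q$. **Theorem.** For every $t_*<T$: 1. $\overline u$ and $\underline v$ are uniformly bounded on $\overline\Omega\times[t_*,T]$, and they are respectively a viscosity subsolution and a viscosity supersolution of (1) on $\overline\Omega\times[t_*,T]$. 2. If the comparison principle holds on $\overline\Omega\times[t_*,T]$, then (1) has exactly one bounded viscosity solution $w$ on $\overline\Omega\times[t_*,T]$, and $u^\varepsilon$ and $v^\varepsilon$ converge to $w$ locally uniformly as $\varepsilon\to0^+$: for every compact $K\subset\overline\Omega\times[t_*,T]$, $\sup\{|u^\varepsilon(x,t)-w(x,t)|+|v^\varepsilon(x,t)-w(x,t)| : (x,t)\in K,\ t\in T-\varepsilon^2\mathbb N\}\to0$. -/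

import Mathlib

open Filter Topology Set Metric

open scoped ContDiff InnerProductSpace

noncomputable section

namespace NeumannGame

/-- Euclidean space `ℝ^N`. -/
abbrev Sp (N : ℕ) : Type := EuclideanSpace ℝ (Fin N)

/-- Linear maps of `ℝ^N`, that is `N × N` matrices, with the operator norm. The symmetric matrices
are the self-adjoint elements. -/
abbrev Mat (N : ℕ) : Type := Sp N →L[ℝ] Sp N

/-! ### Domains -/

/-- A `C²`-domain: a nonempty connected open set which, near each of its boundary points, is
the sublevel set `{ρ < 0}` of a `C²` function `ρ` with non-vanishing differential. -/
structure IsC2Domain {N : ℕ} (Ω : Set (Sp N)) : Prop where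
  isOpen : IsOpen Ω
  isConnected : IsConnected Ω
  boundary : ∀ x ∈ frontier Ω, ∃ ρ : Sp N → ℝ,
    ContDiffAt ℝ 2 ρ x ∧ fderiv ℝ ρ x ≠ 0 ∧ ∀ᶠ y in 𝓝 x, (y ∈ Ω ↔ ρ y < 0)

/-- Uniform interior ball condition. -/
def UniformInteriorBall {N : ℕ} (Ω : Set (Sp N)) : Prop :=
  ∃ r : ℝ, 0 < r ∧ ∀ x ∈ frontier Ω, ∃ c : Sp N, x ∈ sphere c r ∧ ball c r ⊆ Ω

/-- Uniform exterior ball condition. -/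
def UniformExteriorBall {N : ℕ} (Ω : Set (Sp N)) : Prop :=
  UniformInteriorBall (closure Ω)ᶜ

/-- The outward unit normal `n = - D d`, where `d` is the distance to the boundary, counted
negatively outside of `Ω`. -/
def outwardNormal {N : ℕ} (Ω : Set (Sp N)) (x : Sp N) : Sp N :=
  -gradient (fun y => infDist y Ωᶜ - infDist y Ω) x

open Classical in
/-- The projection onto `closure Ω`: the nearest point of `closure Ω`. Under the uniform exterior
ball condition it is unique for all points close enough to `closure Ω`. -/
def projClosure {N : ℕ} (Ω : Set (Sp N)) (y : Sp N) : Sp N :=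
  if hy : ∃ w ∈ closure Ω, dist y w = infDist y (closure Ω) then hy.choose else y

/-! ### The final-value problem -/

/-- The data of the problem `∂ₜu - f(t,x,u,Du,D²u) = 0` in `Ω` for `t < T`, `⟨Du,n⟩ = h` on the
boundary for `t < T`, `u(·,T) = g` on `closure Ω`. Only the values of `g` on `closure Ω`, of `h` on
`frontier Ω`, and of `f` for `x ∈ closure Ω` and symmetric `Γ` matter. -/
structure FinalValueProblem (N : ℕ) where
  Ω : Set (Sp N)
  T : ℝ
  f : ℝ → Sp N → ℝ → Sp N → Mat N → ℝ
  g : Sp N → ℝ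
  h : Sp N → ℝ

variable {N : ℕ}

/-- Hypotheses on `f`: continuity, monotonicity in `Γ`, at most linear growth in `z` near `p = 0`,
`Γ = 0`, local Lipschitz continuity in `(p, Γ)`, and growth of order `q` in `p` and `r` in `Γ`. -/
structure FHypotheses (P : FinalValueProblem N) (q r : ℝ) : Prop where
  continuous : ContinuousOn
    (fun a : ℝ × Sp N × ℝ × Sp N × Mat N => P.f a.1 a.2.1 a.2.2.1 a.2.2.2.1 a.2.2.2.2)
    {a | a.2.1 ∈ closure P.Ω ∧ IsSelfAdjoint a.2.2.2.2}
  monotone : ∀ t : ℝ, ∀ x ∈ closure P.Ω, ∀ (z : ℝ) (p : Sp N) (Γ₁ Γ₂ : Mat N),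
    IsSelfAdjoint Γ₁ → Γ₂.IsPositive → P.f t x z p (Γ₁ + Γ₂) ≤ P.f t x z p Γ₁
  linear_growth : ∀ K : ℝ, ∃ C : ℝ, 0 ≤ C ∧
    ∀ t : ℝ, ∀ x ∈ closure P.Ω, ∀ (z : ℝ) (p : Sp N) (Γ : Mat N), IsSelfAdjoint Γ →
      ‖(p, Γ)‖ ≤ K → |P.f t x z p Γ| ≤ C * (1 + |z|)
  locally_lipschitz : ∀ K : ℝ, ∃ C : ℝ, 0 ≤ C ∧
    ∀ t : ℝ, ∀ x ∈ closure P.Ω, ∀ (z : ℝ) (p p' : Sp N) (Γ Γ' : Mat N),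
      IsSelfAdjoint Γ → IsSelfAdjoint Γ' → ‖(p, Γ)‖ + ‖(p', Γ')‖ ≤ K →
      |P.f t x z p Γ - P.f t x z p' Γ'| ≤ C * (1 + |z|) * ‖(p, Γ) - (p', Γ')‖
  one_le_q : 1 ≤ q
  one_le_r : 1 ≤ r
  controlled_growth : ∃ C : ℝ, 0 < C ∧
    ∀ t : ℝ, ∀ x ∈ closure P.Ω, ∀ (z : ℝ) (p : Sp N) (Γ : Mat N), IsSelfAdjoint Γ →
      |P.f t x z p Γ| ≤ C * (1 + |z| + ‖p‖ ^ q + ‖Γ‖ ^ r)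

/-- The constraints on the exponents of the game. -/
structure ExponentHypotheses (α β γ q r : ℝ) : Prop where
  α_pos : 0 < α
  β_pos : 0 < β
  γ_pos : 0 < γ
  α_lt : α < 1 / 3
  α_add_β : α + β < 1
  two_α_add_γ : 2 * α + γ < 2
  max_lt : max (β * q) (β * r) < 2
  γ_lt : γ < 1 - α
  β_q : β * (q - 1) < α + 1
  γ_r_sub : γ * (r - 1) < 2 * α
  γ_r : γ * r < 1 + α

/-! ### The game -/

/-- Helen's debt after one round that starts at time `t`, position `x` and debt `z`, when Helen
plays `(p, Γ)` and Mark plays the move `d` to the intermediate point `x + d`, which is then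
projected onto `closure Ω`. -/
def nextDebt (P : FinalValueProblem N) (ε t : ℝ) (x : Sp N) (z : ℝ) (p : Sp N) (Γ : Mat N)
    (d : Sp N) : ℝ :=
  z + ⟪p, d⟫_ℝ + 1 / 2 * ⟪Γ d, d⟫_ℝ + ε ^ 2 * P.f t x z p Γ
    - ‖d - (projClosure P.Ω (x + d) - x)‖ * P.h (projClosure P.Ω (x + d))

/-- Helen's value function `U^ε(x, z, T - j ε²)`, by backward induction on the number `j` of rounds
left. It takes extended real values, so that the suprema and infima are genuine. -/
def valueU (P : FinalValueProblem N) (α β γ ε : ℝ) : ℕ → Sp N → ℝ → EReal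
  | 0, x, z => ((P.g x - z : ℝ) : EReal)
  | j + 1, x, z =>
      ⨆ (p : Sp N) (Γ : Mat N) (_ : IsSelfAdjoint Γ) (_ : ‖p‖ ≤ ε ^ (-β)) (_ : ‖Γ‖ ≤ ε ^ (-γ)),
        ⨅ (d : Sp N) (_ : ‖d‖ ≤ ε ^ (1 - α)),
          valueU P α β γ ε j (projClosure P.Ω (x + d))
            (nextDebt P ε (P.T - (j + 1) * ε ^ 2) x z p Γ d)

/-- `u^ε(x, T - j ε²) = sup {z : U^ε(x, z, T - j ε²) ≥ 0}`. -/
def uEps (P : FinalValueProblem N) (α β γ ε : ℝ) (j : ℕ) (x : Sp N) : EReal :=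
  ⨆ (z : ℝ) (_ : 0 ≤ valueU P α β γ ε j x z), (z : EReal)

/-- `v^ε(x, T - j ε²) = inf {z : U^ε(x, z, T - j ε²) ≤ 0}`. -/
def vEps (P : FinalValueProblem N) (α β γ ε : ℝ) (j : ℕ) (x : Sp N) : EReal :=
  ⨅ (z : ℝ) (_ : valueU P α β γ ε j x z ≤ 0), (z : EReal)

/-- The regime `ε → 0⁺`, `y → x` in `closure Ω`, `T - j ε² → t`, for triples `(ε, y, j)`. -/
def approach (P : FinalValueProblem N) (x : Sp N) (t : ℝ) : Filter (ℝ × Sp N × ℕ) :=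
  (𝓝[>] (0 : ℝ) ×ˢ 𝓝[closure P.Ω] x ×ˢ (⊤ : Filter ℕ)) ⊓
    comap (fun a : ℝ × Sp N × ℕ => P.T - a.2.2 * a.1 ^ 2) (𝓝 t)

/-- The upper relaxed semi-limit of `u^ε`. -/
def uBar (P : FinalValueProblem N) (α β γ : ℝ) (x : Sp N) (t : ℝ) : EReal :=
  limsup (fun a : ℝ × Sp N × ℕ => uEps P α β γ a.1 a.2.2 a.2.1) (approach P x t)

/-- The lower relaxed semi-limit of `v^ε`. -/
def vBar (P : FinalValueProblem N) (α β γ : ℝ) (x : Sp N) (t : ℝ) : EReal :=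
  liminf (fun a : ℝ × Sp N × ℕ => vEps P α β γ a.1 a.2.2 a.2.1) (approach P x t)

/-! ### Viscosity solutions -/

/-- The spatial gradient of a test function. -/
def spaceGrad (φ : Sp N × ℝ → ℝ) (x : Sp N) (t : ℝ) : Sp N :=
  gradient (fun y => φ (y, t)) x

/-- The spatial Hessian of a test function. -/
def spaceHess (φ : Sp N × ℝ → ℝ) (x : Sp N) (t : ℝ) : Mat N :=
  fderiv ℝ (fun y => spaceGrad φ y t) x

/-- `∂ₜφ - f(t, x, z, Dφ, D²φ)` at `(x, t)`. -/
def pdeExpr (P : FinalValueProblem N) (φ : Sp N × ℝ → ℝ) (x : Sp N) (t z : ℝ) : ℝ :=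
  deriv (fun s => φ (x, s)) t - P.f t x z (spaceGrad φ x t) (spaceHess φ x t)

/-- `⟨Dφ, n⟩ - h` at `(x, t)`. -/
def neumannExpr (P : FinalValueProblem N) (φ : Sp N × ℝ → ℝ) (x : Sp N) (t : ℝ) : ℝ :=
  ⟪spaceGrad φ x t, outwardNormal P.Ω x⟫_ℝ - P.h x

/-- The set `closure Ω × [tₛ, T]`. -/
def cylinder (P : FinalValueProblem N) (tₛ : ℝ) : Set (Sp N × ℝ) :=
  closure P.Ω ×ˢ Icc tₛ P.T

/-- Viscosity subsolution on `closure Ω × [tₛ, T]`. -/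
structure IsViscositySubsolution (P : FinalValueProblem N) (tₛ : ℝ) (u : Sp N × ℝ → ℝ) :
    Prop where
  usc : UpperSemicontinuousOn u (cylinder P tₛ)
  interior : ∀ x₀ ∈ P.Ω, ∀ t₀ ∈ Ico tₛ P.T, ∀ φ : Sp N × ℝ → ℝ, ContDiff ℝ ∞ φ →
    IsLocalMaxOn (fun a => u a - φ a) (cylinder P tₛ) (x₀, t₀) →
    0 ≤ pdeExpr P φ x₀ t₀ (u (x₀, t₀))
  boundary : ∀ x₀ ∈ frontier P.Ω, ∀ t₀ ∈ Ico tₛ P.T, ∀ φ : Sp N × ℝ → ℝ, ContDiff ℝ ∞ φ →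
    IsLocalMaxOn (fun a => u a - φ a) (cylinder P tₛ) (x₀, t₀) →
    min (-pdeExpr P φ x₀ t₀ (u (x₀, t₀))) (neumannExpr P φ x₀ t₀) ≤ 0
  final : ∀ x ∈ closure P.Ω, u (x, P.T) ≤ P.g x

/-- Viscosity supersolution on `closure Ω × [tₛ, T]`. -/
structure IsViscositySupersolution (P : FinalValueProblem N) (tₛ : ℝ) (u : Sp N × ℝ → ℝ) :
    Prop where
  lsc : LowerSemicontinuousOn u (cylinder P tₛ)
  interior : ∀ x₀ ∈ P.Ω, ∀ t₀ ∈ Ico tₛ P.T, ∀ φ : Sp N × ℝ → ℝ, ContDiff ℝ ∞ φ →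
    IsLocalMinOn (fun a => u a - φ a) (cylinder P tₛ) (x₀, t₀) →
    pdeExpr P φ x₀ t₀ (u (x₀, t₀)) ≤ 0
  boundary : ∀ x₀ ∈ frontier P.Ω, ∀ t₀ ∈ Ico tₛ P.T, ∀ φ : Sp N × ℝ → ℝ, ContDiff ℝ ∞ φ →
    IsLocalMinOn (fun a => u a - φ a) (cylinder P tₛ) (x₀, t₀) →
    0 ≤ max (-pdeExpr P φ x₀ t₀ (u (x₀, t₀))) (neumannExpr P φ x₀ t₀)
  final : ∀ x ∈ closure P.Ω, P.g x ≤ u (x, P.T)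

/-- Viscosity solution on `closure Ω × [tₛ, T]`. -/
structure IsViscositySolution (P : FinalValueProblem N) (tₛ : ℝ) (u : Sp N × ℝ → ℝ) :
    Prop where
  continuousOn : ContinuousOn u (cylinder P tₛ)
  sub : IsViscositySubsolution P tₛ u
  super : IsViscositySupersolution P tₛ u

/-- `u` is uniformly bounded on the set `S`. -/
def BoundedOn {X : Type*} (u : X → ℝ) (S : Set X) : Prop :=
  ∃ C : ℝ, ∀ a ∈ S, |u a| ≤ C

/-- The comparison principle, for uniformly bounded functions, on `closure Ω × [tₛ, T]`. -/
def ComparisonPrinciple (P : FinalValueProblem N) (tₛ : ℝ) : Prop :=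
  ∀ u v : Sp N × ℝ → ℝ, IsViscositySubsolution P tₛ u → IsViscositySupersolution P tₛ v →
    BoundedOn u (cylinder P tₛ) → BoundedOn v (cylinder P tₛ) → ∀ a ∈ cylinder P tₛ, u a ≤ v a

/-- As `ε → 0⁺`, the functions `w ε`, defined at the points `(x, T - j ε²)` by `w ε j x`, converge
to the real-valued function `u` uniformly on each compact subset of `closure Ω × [tₛ, T]`. -/
def ConvergesLocallyUniformly (P : FinalValueProblem N) (tₛ : ℝ)
    (w : ℝ → ℕ → Sp N → EReal) (u : Sp N × ℝ → ℝ) : Prop :=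
  ∀ K : Set (Sp N × ℝ), IsCompact K → K ⊆ cylinder P tₛ → ∀ δ : ℝ, 0 < δ →
    ∀ᶠ ε in 𝓝[>] (0 : ℝ), ∀ (j : ℕ) (x : Sp N), (x, P.T - j * ε ^ 2) ∈ K →
      ((u (x, P.T - j * ε ^ 2) - δ : ℝ) : EReal) < w ε j x ∧
        w ε j x < ((u (x, P.T - j * ε ^ 2) + δ : ℝ) : EReal)

end NeumannGame

end

noncomputable section

namespace NeumannGame

variable {N : ℕ}

/-! ### Geometry of domains with interior and exterior balls -/

/-! The proof is the method of half-relaxed limits, run on the level sets of `valueU` in `z`. Since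
`f` depends on `z`, `valueU` need not be monotone in `z`, and no dynamic programming relation is
written for `uEps` or `vEps`. What is used is one round of the game: Helen has an optimal move
(`exists_move_of_nonneg_valueU`) and Mark an optimal answer (`exists_move_of_valueU_nonpos`), by
semicontinuity and compactness.

Suppose `z` lies in the superlevel set at `x`, while the next sets lie below a paraboloid with
gradient `p` and Hessian `X`. If Helen's move is far from `(p, X)` in slope, or exceeds `X` in some
direction, Mark exploits the difference and gains far more than `ε ^ 2`; otherwise he stands still,
and ellipticity yields the PDE inequality (`exists_move`, where the exponent conditions enter).
Reflection at the boundary only helps if the paraboloid is strictly above the Neumann condition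
(`paraboloid_reflection_le`). The outcome is recorded in `Consistent`. For sublevel sets Helen
simply plays the gradient and Hessian of the paraboloid; after `u ↦ -u` they satisfy the same
`Consistent` for `P.neg`, so a single analysis serves both halves.

From consistency alone, backward induction on the number of rounds gives an upper bound
(`exists_upper_bound`, a barrier plus discrete Gronwall), the final value (`upperLimit_final_le`)
and the impossibility of touching the relaxed limit from above by a strict supersolution
(`not_touched_above`). So `uBar` is a subsolution and, by reflection, `vBar` a supersolution. As
`vEps ≤ uEps`, also `vBar ≤ uBar`; comparison gives the converse, hence continuity of the common
limit and, by compactness, locally uniform convergence. -/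

/-- Equality case of the triangle inequality. The hypothesis always comes from two disjoint balls,
whose centres are at least the sum of the radii apart; the conclusion puts a point on a normal line.
-/
theorem eq_norm_smul_of_add_le_norm_add {E : Type*} [NormedAddCommGroup E] [InnerProductSpace ℝ E]
    {n v : E} {r : ℝ} (hr : 0 < r) (hn : ‖n‖ = 1) (h : ‖v‖ + r ≤ ‖v + r • n‖) :
    v = ‖v‖ • n := by
  have h1 : ‖v + r • n‖ ^ 2 = ‖v‖ ^ 2 + 2 * (r * ⟪v, n⟫_ℝ) + r ^ 2 := by
    rw [norm_add_sq_real, inner_smul_right, norm_smul, hn, Real.norm_of_nonneg hr.le, mul_one]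
  have h2 : (‖v‖ + r) ^ 2 ≤ ‖v + r • n‖ ^ 2 := by gcongr
  have h3 : ‖v‖ ≤ ⟪v, n⟫_ℝ := by
    have : r * ‖v‖ ≤ r * ⟪v, n⟫_ℝ := by nlinarith
    exact le_of_mul_le_mul_left this hr
  have h4 : ‖v - ‖v‖ • n‖ ^ 2 ≤ 0 := by
    rw [norm_sub_sq_real, inner_smul_right, norm_smul, hn, norm_norm, mul_one]
    nlinarith [norm_nonneg v]
  have h5 : ‖v - ‖v‖ • n‖ = 0 := by
    have := sq_nonneg ‖v - ‖v‖ • n‖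
    exact pow_eq_zero_iff (two_ne_zero) |>.1 (le_antisymm h4 this)
  exact sub_eq_zero.1 (norm_eq_zero.1 h5)

/-- From `2 * a * s ≤ a ^ 2 + s ^ 2` with `s = ‖a • n + v‖`: the distance to a centre is linear up
to a quadratic error. -/
theorem norm_smul_add_le {E : Type*} [NormedAddCommGroup E] [InnerProductSpace ℝ E]
    {n v : E} {a : ℝ} (ha : 0 < a) (hn : ‖n‖ = 1) :
    ‖a • n + v‖ ≤ a + ⟪n, v⟫_ℝ + ‖v‖ ^ 2 / (2 * a) := by
  have h1 : ‖a • n + v‖ ^ 2 = a ^ 2 + 2 * (a * ⟪n, v⟫_ℝ) + ‖v‖ ^ 2 := by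
    rw [norm_add_sq_real, inner_smul_left, norm_smul, hn, Real.norm_of_nonneg ha.le, mul_one]
    simp
  have h2 : 2 * a * ‖a • n + v‖ ≤ 2 * a * (a + ⟪n, v⟫_ℝ + ‖v‖ ^ 2 / (2 * a)) := by
    have : 2 * a * (a + ⟪n, v⟫_ℝ + ‖v‖ ^ 2 / (2 * a)) =
        2 * a ^ 2 + 2 * a * ⟪n, v⟫_ℝ + ‖v‖ ^ 2 := by field_simp
    rw [this]
    nlinarith [sq_nonneg (‖a • n + v‖ - a)]
  exact le_of_mul_le_mul_left h2 (by positivity)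

/-- Every boundary point is touched by an interior and an exterior ball of radius `r`, whose
centres lie on the normal line. -/
structure BallDomain (Ω : Set (Sp N)) (r : ℝ) : Prop where
  pos : 0 < r
  isOpen : IsOpen Ω
  nonempty : Ω.Nonempty
  norm_normal : ∀ y ∈ frontier Ω, ‖outwardNormal Ω y‖ = 1
  interior_ball : ∀ y ∈ frontier Ω, ball (y - r • outwardNormal Ω y) r ⊆ Ω
  exterior_ball : ∀ y ∈ frontier Ω, ball (y + r • outwardNormal Ω y) r ⊆ (closure Ω)ᶜ

/-- The exterior ball condition speaks only of the frontier of `(closure Ω)ᶜ`, so slits must be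
excluded. If `closure Ω` were a neighbourhood of `x`, then `ρ ≤ 0 ≤ ρ x` near `x`, and `x` would be
a critical point of `ρ`. -/
theorem IsC2Domain.frontier_subset {Ω : Set (Sp N)} (hΩ : IsC2Domain Ω) :
    frontier Ω ⊆ frontier (closure Ω)ᶜ := by
  intro x hx
  rw [frontier_compl]
  refine ⟨subset_closure (frontier_subset_closure hx), fun hint => ?_⟩
  obtain ⟨ρ, hρ, hne, hiff⟩ := hΩ.boundary x hx
  have hxΩ : x ∉ Ω := by
    rw [hΩ.isOpen.frontier_eq] at hx
    exact hx.2
  have hx0 : 0 ≤ ρ x := by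
    by_contra h
    exact hxΩ (hiff.self_of_nhds.2 (not_le.1 h))
  have hcont : ∀ᶠ y in 𝓝 x, ContinuousAt ρ y :=
    (hρ.eventually (by simp)).mono fun y hy => hy.continuousAt
  have hmax : IsLocalMax ρ x := by
    filter_upwards [hcont, hiff.eventually_nhds, mem_interior_iff_mem_nhds.1 hint] with y hy hy' hyc
    refine le_trans ?_ hx0
    have hf : ∃ᶠ w in 𝓝 y, w ∈ Ω := mem_closure_iff_frequently.1 hyc
    have hf' : ∃ᶠ w in 𝓝 y, ρ w ≤ 0 :=
      (hf.and_eventually hy').mono fun w hw => (hw.2.1 hw.1).le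
    by_contra hpos
    exact hf' ((hy.eventually (lt_mem_nhds (not_le.1 hpos))).mono fun w hw => not_le.2 hw)
  exact hne hmax.fderiv_eq_zero

theorem exists_touching_ball_of_le {U : Set (Sp N)} {x c : Sp N} {r s : ℝ} (hs : 0 < s)
    (hsr : s ≤ r) (hx : x ∈ sphere c r) (hc : ball c r ⊆ U) :
    ∃ c', x ∈ sphere c' s ∧ ball c' s ⊆ U := by
  have hr : 0 < r := hs.trans_le hsr
  refine ⟨x + (s / r) • (c - x), ?_, ?_⟩
  · rw [mem_sphere, dist_eq_norm] at hx ⊢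
    rw [show x - (x + (s / r) • (c - x)) = (s / r) • (x - c) by rw [smul_sub, smul_sub]; abel,
      norm_smul, hx, Real.norm_of_nonneg (by positivity)]
    field_simp
  · refine subset_trans (ball_subset_ball' ?_) hc
    rw [mem_sphere, dist_comm, dist_eq_norm] at hx
    rw [dist_eq_norm,
      show x + (s / r) • (c - x) - c = (s / r - 1) • (c - x) by rw [sub_smul, one_smul]; abel,
      norm_smul, hx, Real.norm_eq_abs, abs_of_nonpos]
    · field_simp; linarith
    · have : s / r ≤ 1 := (div_le_one hr).2 hsr
      linarith

/-- Signed distance is monotone in the set, and the left side is that of the ball. Outside `Ω`,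
points of the open ball on the segment towards `c` are used, whence the slack `δ`. -/
theorem signedDist_lower {Ω : Set (Sp N)} (hΩ : Ωᶜ.Nonempty) {c : Sp N} {r : ℝ} (hr : 0 < r)
    (hc : ball c r ⊆ Ω) (x : Sp N) : r - ‖x - c‖ ≤ infDist x Ωᶜ - infDist x Ω := by
  by_cases hx : x ∈ Ω
  · have h1 : infDist x Ω = 0 := infDist_zero_of_mem hx
    have h2 : r - ‖x - c‖ ≤ infDist x Ωᶜ := by
      rw [le_infDist hΩ]
      intro v hv
      have h3 : r ≤ dist v c := not_lt.1 fun h => hv (hc h)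
      have h4 := dist_triangle v x c
      rw [dist_comm v x, dist_eq_norm x c] at h4
      linarith
    linarith
  · have h1 : infDist x Ωᶜ = 0 := infDist_zero_of_mem hx
    have h2 : infDist x Ω ≤ ‖x - c‖ - r := by
      have hxc : r ≤ ‖x - c‖ := by
        rw [← dist_eq_norm]
        exact not_lt.1 fun h => hx (hc h)
      have hpos : 0 < ‖x - c‖ := hr.trans_le hxc
      refine le_of_forall_pos_le_add fun δ hδ => ?_
      obtain ⟨s, hs0, hs1⟩ : ∃ s, max 0 (r - δ) < s ∧ s < r :=
        exists_between (max_lt hr (by linarith))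
      have hs2 : 0 < s := (le_max_left _ _).trans_lt hs0
      have hs3 : r - δ < s := (le_max_right _ _).trans_lt hs0
      have hmem : c + (s / ‖x - c‖) • (x - c) ∈ Ω := by
        apply hc
        rw [mem_ball, dist_eq_norm, add_sub_cancel_left, norm_smul,
          Real.norm_of_nonneg (by positivity), div_mul_cancel₀ _ hpos.ne']
        exact hs1
      refine (infDist_le_dist_of_mem hmem).trans ?_
      rw [dist_eq_norm, show x - (c + (s / ‖x - c‖) • (x - c)) = (1 - s / ‖x - c‖) • (x - c) by
        rw [sub_smul, one_smul]; abel, norm_smul, Real.norm_of_nonneg, sub_mul,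
        div_mul_cancel₀ _ hpos.ne']
      · linarith
      · have : s / ‖x - c‖ ≤ 1 := (div_le_one hpos).2 (by linarith)
        linarith
    linarith

/-- The signed distance is squeezed between those of the two touching balls, which agree to first
order at `x`. The upper bound is `signedDist_lower` for `Ωᶜ`. This ties `outwardNormal`, defined
through `gradient`, to the geometry. -/
theorem hasGradientAt_signedDist {Ω : Set (Sp N)} (ho : IsOpen Ω) {x n : Sp N} {r : ℝ} (hr : 0 < r)
    (hx : x ∈ frontier Ω) (hn : ‖n‖ = 1) (hi : ball (x - r • n) r ⊆ Ω)
    (he : ball (x + r • n) r ⊆ (closure Ω)ᶜ) :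
    HasGradientAt (fun y => infDist y Ωᶜ - infDist y Ω) (-n) x := by
  have hxc : x ∈ closure Ω := frontier_subset_closure hx
  have hxΩ : x ∉ Ω := by
    rw [ho.frontier_eq] at hx
    exact hx.2
  have hne : Ω.Nonempty := closure_nonempty_iff.1 ⟨x, hxc⟩
  have h0 : infDist x Ω = 0 := (mem_closure_iff_infDist_zero hne).1 hxc
  have h0' : infDist x Ωᶜ = 0 := infDist_zero_of_mem hxΩ
  have key : ∀ y, |infDist y Ωᶜ - infDist y Ω + ⟪n, y - x⟫_ℝ| ≤ 1 / (2 * r) * ‖y - x‖ ^ 2 := by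
    intro y
    have hlow := signedDist_lower ⟨x, hxΩ⟩ hr hi y
    have hup := signedDist_lower (Ω := Ωᶜ) (by simpa using hne) hr
      (he.trans (compl_subset_compl.2 subset_closure)) y
    rw [compl_compl] at hup
    have e1 := norm_smul_add_le (v := y - x) hr hn
    have e2 := norm_smul_add_le (n := -n) (v := y - x) hr (by rwa [norm_neg])
    rw [show r • n + (y - x) = y - (x - r • n) by abel] at e1
    rw [show r • -n + (y - x) = y - (x + r • n) by rw [smul_neg]; abel, inner_neg_left] at e2
    have e3 : ‖y - x‖ ^ 2 / (2 * r) = 1 / (2 * r) * ‖y - x‖ ^ 2 := by ring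
    rw [abs_le]
    constructor <;> linarith
  have hO : (fun y => infDist y Ωᶜ - infDist y Ω + ⟪n, y - x⟫_ℝ) =O[𝓝 x]
      fun y => ‖y - x‖ ^ 2 := by
    refine Asymptotics.IsBigO.of_bound (1 / (2 * r)) (Eventually.of_forall fun y => ?_)
    rw [Real.norm_eq_abs, Real.norm_of_nonneg (by positivity)]
    exact key y
  have hd := hO.hasFDerivAt (𝕜 := ℝ) (by norm_num)
  have hl : HasFDerivAt (fun y : Sp N => ⟪n, y - x⟫_ℝ) (innerSL ℝ n) x :=
    (innerSL ℝ n).hasFDerivAt.comp x ((hasFDerivAt_id x).sub_const x)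
  have e₁ : (fun y => infDist y Ωᶜ - infDist y Ω) =
      (fun y => infDist y Ωᶜ - infDist y Ω + ⟪n, y - x⟫_ℝ) - fun y => ⟪n, y - x⟫_ℝ := by
    funext y
    simp
  have e₂ : InnerProductSpace.toDual ℝ (Sp N) (-n) = 0 - innerSL ℝ n := by
    ext y
    simp
  rw [hasGradientAt_iff_hasFDerivAt, e₁, e₂]
  exact hd.sub hl

/-- After shrinking to a common radius, the two balls touching at `y` are disjoint, so `y` is the
midpoint of their centres. -/
theorem exists_ballDomain {Ω : Set (Sp N)} (hΩ : IsC2Domain Ω) (hint : UniformInteriorBall Ω)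
    (hext : UniformExteriorBall Ω) : ∃ r, BallDomain Ω r := by
  obtain ⟨r₁, hr₁, h₁⟩ := hint
  obtain ⟨r₂, hr₂, h₂⟩ := hext
  have hr : 0 < min r₁ r₂ := lt_min hr₁ hr₂
  set r := min r₁ r₂
  have key : ∀ y ∈ frontier Ω, ‖outwardNormal Ω y‖ = 1 ∧ ball (y - r • outwardNormal Ω y) r ⊆ Ω ∧
      ball (y + r • outwardNormal Ω y) r ⊆ (closure Ω)ᶜ := by
    intro y hy
    obtain ⟨c₁, hc₁, hb₁⟩ := h₁ y hy
    obtain ⟨c₂, hc₂, hb₂⟩ := h₂ y (hΩ.frontier_subset hy)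
    obtain ⟨d₁, hd₁, hs₁⟩ := exists_touching_ball_of_le hr (min_le_left _ _) hc₁ hb₁
    obtain ⟨d₂, hd₂, hs₂⟩ := exists_touching_ball_of_le hr (min_le_right _ _) hc₂ hb₂
    rw [mem_sphere, dist_eq_norm] at hd₁ hd₂
    have hdisj : Disjoint (ball d₂ r) (ball d₁ r) :=
      disjoint_left.2 fun w hw hw' => hs₂ hw (subset_closure (hs₁ hw'))
    rw [disjoint_ball_ball_iff hr hr, dist_eq_norm] at hdisj
    have hn : ‖r⁻¹ • (y - d₁)‖ = 1 := by
      rw [norm_smul, hd₁, Real.norm_of_nonneg (by positivity)]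
      field_simp
    have hn₁ : r • r⁻¹ • (y - d₁) = y - d₁ := smul_inv_smul₀ hr.ne' _
    have h3 := eq_norm_smul_of_add_le_norm_add (v := d₂ - y) hr hn (by
      rw [hn₁, sub_add_sub_cancel, norm_sub_rev, hd₂]
      exact hdisj)
    rw [norm_sub_rev, hd₂, hn₁] at h3
    have hg := (hasGradientAt_signedDist hΩ.isOpen hr hy hn
      (by rwa [hn₁, sub_sub_cancel]) (by rwa [hn₁, ← h3, add_sub_cancel])).gradient
    have hnormal : outwardNormal Ω y = r⁻¹ • (y - d₁) := by
      rw [outwardNormal, hg, neg_neg]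
    rw [hnormal]
    refine ⟨hn, ?_, ?_⟩
    · rwa [hn₁, sub_sub_cancel]
    · rwa [hn₁, ← h3, add_sub_cancel]
  exact ⟨r, hr, hΩ.isOpen, hΩ.isConnected.nonempty, fun y hy => (key y hy).1,
    fun y hy => (key y hy).2.1, fun y hy => (key y hy).2.2⟩

/-! ### Normals, projection and distance to the boundary in a ball domain -/

namespace BallDomain

variable {Ω : Set (Sp N)} {r : ℝ}

theorem inner_le (hΩ : BallDomain Ω r) {x y : Sp N} (hx : x ∈ closure Ω) (hy : y ∈ frontier Ω) :
    2 * r * ⟪x - y, outwardNormal Ω y⟫_ℝ ≤ ‖x - y‖ ^ 2 := by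
  have h1 : r ≤ dist x (y + r • outwardNormal Ω y) :=
    not_lt.1 fun h => hΩ.exterior_ball y hy h hx
  rw [dist_eq_norm, ← sub_sub] at h1
  have h2 : r ^ 2 ≤ ‖x - y - r • outwardNormal Ω y‖ ^ 2 := by
    have := hΩ.pos
    gcongr
  rw [norm_sub_sq_real, inner_smul_right, norm_smul, hΩ.norm_normal y hy,
    Real.norm_of_nonneg hΩ.pos.le, mul_one] at h2
  linarith

/-- The interior ball at `y` misses the exterior ball at `w`, and vice versa. Adding the two squared
inequalities cancels the terms linear in `y - w`. -/
theorem norm_normal_sub_le (hΩ : BallDomain Ω r) {y w : Sp N} (hy : y ∈ frontier Ω)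
    (hw : w ∈ frontier Ω) : r * ‖outwardNormal Ω y - outwardNormal Ω w‖ ≤ ‖y - w‖ := by
  have hr := hΩ.pos
  have key : ∀ y ∈ frontier Ω, ∀ w ∈ frontier Ω,
      (2 * r) ^ 2 ≤ ‖(y - w) - r • (outwardNormal Ω y + outwardNormal Ω w)‖ ^ 2 := by
    intro y hy w hw
    have hdisj : Disjoint (ball (y - r • outwardNormal Ω y) r) (ball (w + r • outwardNormal Ω w) r) :=
      disjoint_left.2 fun v hv hv' =>
        hΩ.exterior_ball w hw hv' (subset_closure (hΩ.interior_ball y hy hv))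
    rw [disjoint_ball_ball_iff hr hr, dist_eq_norm] at hdisj
    rw [show y - r • outwardNormal Ω y - (w + r • outwardNormal Ω w) =
      (y - w) - r • (outwardNormal Ω y + outwardNormal Ω w) by rw [smul_add]; abel] at hdisj
    have : 2 * r ≤ ‖(y - w) - r • (outwardNormal Ω y + outwardNormal Ω w)‖ := by linarith
    gcongr
  have h1 := key y hy w hw
  have h2 := key w hw y hy
  rw [norm_sub_sq_real] at h1 h2
  rw [add_comm (outwardNormal Ω w), norm_sub_rev w y, ← neg_sub y w, inner_neg_left] at h2
  have h3 : ‖r • (outwardNormal Ω y + outwardNormal Ω w)‖ ^ 2 =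
      r ^ 2 * (2 + 2 * ⟪outwardNormal Ω y, outwardNormal Ω w⟫_ℝ) := by
    rw [norm_smul, mul_pow, norm_add_sq_real, hΩ.norm_normal y hy, hΩ.norm_normal w hw,
      Real.norm_of_nonneg hr.le]
    ring
  have h4 : ‖outwardNormal Ω y - outwardNormal Ω w‖ ^ 2 =
      2 - 2 * ⟪outwardNormal Ω y, outwardNormal Ω w⟫_ℝ := by
    rw [norm_sub_sq_real, hΩ.norm_normal y hy, hΩ.norm_normal w hw]
    ring
  rw [← pow_le_pow_iff_left₀ (by positivity) (norm_nonneg _) two_ne_zero, mul_pow, h4]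
  nlinarith

theorem inner_normal_ge (hΩ : BallDomain Ω r) {y w : Sp N} (hy : y ∈ frontier Ω)
    (hw : w ∈ frontier Ω) (h : ‖y - w‖ ≤ r) :
    1 / 2 ≤ ⟪outwardNormal Ω y, outwardNormal Ω w⟫_ℝ := by
  have h1 := hΩ.norm_normal_sub_le hy hw
  have h2 : ‖outwardNormal Ω y - outwardNormal Ω w‖ ≤ 1 :=
    le_of_mul_le_mul_left (by linarith) hΩ.pos
  have h3 : ‖outwardNormal Ω y - outwardNormal Ω w‖ ^ 2 ≤ 1 ^ 2 := by gcongr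
  rw [norm_sub_sq_real, hΩ.norm_normal y hy, hΩ.norm_normal w hw] at h3
  linarith

theorem projClosure_spec (hΩ : BallDomain Ω r) (y : Sp N) :
    projClosure Ω y ∈ closure Ω ∧ dist y (projClosure Ω y) = infDist y (closure Ω) := by
  have h : ∃ w ∈ closure Ω, dist y w = infDist y (closure Ω) := by
    obtain ⟨w, hw, he⟩ := isClosed_closure.exists_infDist_eq_dist hΩ.nonempty.closure y
    exact ⟨w, hw, he.symm⟩
  rw [projClosure, dif_pos h]
  exact h.choose_spec

theorem projClosure_mem (hΩ : BallDomain Ω r) (y : Sp N) : projClosure Ω y ∈ closure Ω :=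
  (hΩ.projClosure_spec y).1

theorem projClosure_of_mem (hΩ : BallDomain Ω r) {y : Sp N} (hy : y ∈ closure Ω) :
    projClosure Ω y = y := by
  have := (hΩ.projClosure_spec y).2
  rw [infDist_zero_of_mem hy] at this
  exact (dist_eq_zero.1 this).symm

theorem norm_sub_projClosure_le (hΩ : BallDomain Ω r) (y : Sp N) {w : Sp N} (hw : w ∈ closure Ω) :
    ‖y - projClosure Ω y‖ ≤ ‖y - w‖ := by
  rw [← dist_eq_norm, ← dist_eq_norm, (hΩ.projClosure_spec y).2]
  exact infDist_le_dist_of_mem hw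

theorem projClosure_mem_frontier (hΩ : BallDomain Ω r) {y : Sp N} (hy : y ∉ closure Ω) :
    projClosure Ω y ∈ frontier Ω := by
  rw [hΩ.isOpen.frontier_eq]
  refine ⟨hΩ.projClosure_mem y, fun hw => ?_⟩
  set w := projClosure Ω y with hwdef
  have hne : 0 < ‖y - w‖ := norm_pos_iff.2 fun h => hy (by
    rw [sub_eq_zero.1 h]
    exact hΩ.projClosure_mem y)
  have hc : ContinuousAt (fun s : ℝ => w + s • (y - w)) 0 := by fun_prop
  have hev : ∀ᶠ s in 𝓝[>] (0 : ℝ), w + s • (y - w) ∈ Ω :=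
    (hc.eventually_mem (by simpa using hΩ.isOpen.mem_nhds hw)).filter_mono nhdsWithin_le_nhds
  obtain ⟨s, hs, hs0, hs1⟩ := (hev.and (Ioo_mem_nhdsGT (zero_lt_one' ℝ))).exists
  have h1 := hΩ.norm_sub_projClosure_le y (subset_closure hs)
  rw [← hwdef, show y - (w + s • (y - w)) = (1 - s) • (y - w) by rw [sub_smul, one_smul]; abel,
    norm_smul, Real.norm_of_nonneg (by linarith)] at h1
  nlinarith

/-- The ball about `y` through its projection misses the interior ball there, so the two centres and
the projection are aligned. -/
theorem sub_projClosure (hΩ : BallDomain Ω r) {y : Sp N} (hy : y ∉ closure Ω) :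
    y - projClosure Ω y = ‖y - projClosure Ω y‖ • outwardNormal Ω (projClosure Ω y) := by
  have hw := hΩ.projClosure_mem_frontier hy
  set w := projClosure Ω y with hwdef
  have hne : 0 < ‖y - w‖ := norm_pos_iff.2 fun h => hy (by
    rw [sub_eq_zero.1 h]
    exact hΩ.projClosure_mem y)
  refine eq_norm_smul_of_add_le_norm_add hΩ.pos (hΩ.norm_normal w hw) ?_
  have hdisj : Disjoint (ball y ‖y - w‖) (ball (w - r • outwardNormal Ω w) r) := by
    refine disjoint_left.2 fun v hv hv' => ?_
    have h1 := hΩ.norm_sub_projClosure_le y (subset_closure (hΩ.interior_ball w hw hv'))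
    rw [mem_ball, dist_comm, dist_eq_norm] at hv
    exact absurd hv (not_lt.2 h1)
  rw [disjoint_ball_ball_iff hne hΩ.pos, dist_eq_norm] at hdisj
  rwa [show y - w + r • outwardNormal Ω w = y - (w - r • outwardNormal Ω w) by abel]

/-- A substitute for the obtuse angle property of projections on convex sets. The factor `1 / 4` is
`(r / 2) / (2 * r)`, from `inner_le`. -/
theorem inner_projClosure_le (hΩ : BallDomain Ω r) {y w : Sp N}
    (hy : infDist y (closure Ω) ≤ r / 2) (hw : w ∈ closure Ω) :
    ⟪y - projClosure Ω y, w - projClosure Ω y⟫_ℝ ≤ 1 / 4 * ‖w - projClosure Ω y‖ ^ 2 := by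
  by_cases hyc : y ∈ closure Ω
  · rw [hΩ.projClosure_of_mem hyc, sub_self, inner_zero_left]
    positivity
  · rw [← (hΩ.projClosure_spec y).2, dist_eq_norm] at hy
    have h1 := hΩ.inner_le hw (hΩ.projClosure_mem_frontier hyc)
    rw [hΩ.sub_projClosure hyc, inner_smul_left, real_inner_comm]
    simp only [conj_trivial]
    have hr := hΩ.pos
    set a := ‖y - projClosure Ω y‖
    set b := ⟪w - projClosure Ω y, outwardNormal Ω (projClosure Ω y)⟫_ℝ
    have ha : 0 ≤ a := norm_nonneg _
    rcases le_or_gt b 0 with hb | hb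
    · nlinarith [sq_nonneg ‖w - projClosure Ω y‖]
    · nlinarith

/-- The two angle inequalities lose `1 / 4` each, leaving half of the square, hence the Lipschitz
constant 2. -/
theorem norm_projClosure_sub_le (hΩ : BallDomain Ω r) {y y' : Sp N}
    (hy : infDist y (closure Ω) ≤ r / 2) (hy' : infDist y' (closure Ω) ≤ r / 2) :
    ‖projClosure Ω y - projClosure Ω y'‖ ≤ 2 * ‖y - y'‖ := by
  have h1 := hΩ.inner_projClosure_le hy (hΩ.projClosure_mem y')
  have h2 := hΩ.inner_projClosure_le hy' (hΩ.projClosure_mem y)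
  set w := projClosure Ω y
  set w' := projClosure Ω y'
  rw [norm_sub_rev w' w] at h1
  have h3 : ⟪y - w, w' - w⟫_ℝ + ⟪y' - w', w - w'⟫_ℝ = ‖w - w'‖ ^ 2 - ⟪y - y', w - w'⟫_ℝ := by
    rw [← real_inner_self_eq_norm_sq, ← neg_sub w w', inner_neg_right]
    simp only [inner_sub_left]
    ring
  have h4 := real_inner_le_norm (y - y') (w - w')
  have h5 : ‖w - w'‖ * ‖w - w'‖ ≤ (2 * ‖y - y'‖) * ‖w - w'‖ := by nlinarith
  rcases (norm_nonneg (w - w')).eq_or_lt with h | h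
  · rw [← h]; positivity
  · exact le_of_mul_le_mul_right h5 h

theorem continuousOn_projClosure (hΩ : BallDomain Ω r) :
    ContinuousOn (projClosure Ω) {y | infDist y (closure Ω) ≤ r / 2} :=
  LipschitzOnWith.continuousOn (K := 2) <| LipschitzOnWith.of_dist_le_mul fun y hy y' hy' => by
    rw [dist_eq_norm, dist_eq_norm]
    exact hΩ.norm_projClosure_sub_le hy hy'

theorem continuousOn_outwardNormal (hΩ : BallDomain Ω r) :
    ContinuousOn (outwardNormal Ω) (frontier Ω) :=
  LipschitzOnWith.continuousOn (K := Real.toNNReal r⁻¹) <| LipschitzOnWith.of_dist_le_mul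
    fun y hy w hw => by
      have hr := hΩ.pos
      rw [dist_eq_norm, dist_eq_norm, Real.coe_toNNReal _ (by positivity), inv_mul_eq_div,
        le_div_iff₀' hr]
      exact hΩ.norm_normal_sub_le hy hw

theorem exists_nearest (hΩ : BallDomain Ω r) (hne : Ωᶜ.Nonempty) {x : Sp N} (hx : x ∈ closure Ω) :
    ∃ y ∈ frontier Ω, y - x = infDist x Ωᶜ • outwardNormal Ω y := by
  obtain ⟨y, hy, he⟩ := hΩ.isOpen.isClosed_compl.exists_infDist_eq_dist hne x
  by_cases hxΩ : x ∈ Ω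
  · have hpos : 0 < infDist x Ωᶜ :=
      (hΩ.isOpen.isClosed_compl.notMem_iff_infDist_pos hne).1 (by simpa using hxΩ)
    have hball : ball x (infDist x Ωᶜ) ⊆ Ω := by
      intro v hv
      by_contra h
      have := infDist_le_dist_of_mem (x := x) (s := Ωᶜ) h
      rw [mem_ball, dist_comm] at hv
      linarith
    have hyf : y ∈ frontier Ω := by
      rw [hΩ.isOpen.frontier_eq]
      refine ⟨closure_mono hball ?_, hy⟩
      rw [closure_ball x hpos.ne', mem_closedBall, dist_comm, he]
    refine ⟨y, hyf, ?_⟩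
    have hnorm : ‖y - x‖ = infDist x Ωᶜ := by rw [he, dist_comm, dist_eq_norm]
    rw [← hnorm]
    refine eq_norm_smul_of_add_le_norm_add hΩ.pos (hΩ.norm_normal y hyf) ?_
    have hdisj : Disjoint (ball (y + r • outwardNormal Ω y) r) (ball x (infDist x Ωᶜ)) :=
      disjoint_left.2 fun v hv hv' => hΩ.exterior_ball y hyf hv (subset_closure (hball hv'))
    rw [disjoint_ball_ball_iff hΩ.pos hpos, dist_eq_norm, ← hnorm] at hdisj
    rw [sub_add_eq_add_sub, add_comm ‖y - x‖]
    exact hdisj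
  · refine ⟨x, ?_, ?_⟩
    · rw [hΩ.isOpen.frontier_eq]
      exact ⟨hx, hxΩ⟩
    · rw [infDist_zero_of_mem (by simpa using hxΩ), sub_self, zero_smul]

/-- The interior ball at `y` bounds the distance from below. Its centre is at distance `r - d ≥ r /
2` from `x` along the normal, which keeps the quadratic error of `norm_smul_add_le` under control.
-/
theorem le_infDist_compl (hΩ : BallDomain Ω r) {x y w : Sp N} (hy : y ∈ frontier Ω)
    (hxy : y - x = infDist x Ωᶜ • outwardNormal Ω y) (hd : infDist x Ωᶜ ≤ r / 2) :
    infDist x Ωᶜ - ⟪outwardNormal Ω y, w - x⟫_ℝ - ‖w - x‖ ^ 2 / r ≤ infDist w Ωᶜ := by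
  have hr := hΩ.pos
  have hyΩ : y ∈ Ωᶜ := by
    rw [hΩ.isOpen.frontier_eq] at hy
    exact hy.2
  have h1 : r - ‖w - (y - r • outwardNormal Ω y)‖ ≤ infDist w Ωᶜ := by
    rw [le_infDist ⟨y, hyΩ⟩]
    intro v hv
    have h3 : r ≤ dist v (y - r • outwardNormal Ω y) :=
      not_lt.1 fun h => hv (hΩ.interior_ball y hy h)
    have h4 := dist_triangle v w (y - r • outwardNormal Ω y)
    rw [dist_comm v w, dist_eq_norm w (y - r • outwardNormal Ω y)] at h4
    linarith
  set d := infDist x Ωᶜ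
  have h2 := norm_smul_add_le (a := r - d) (v := w - x) (by linarith) (hΩ.norm_normal y hy)
  have h3 : w - (y - r • outwardNormal Ω y) = (r - d) • outwardNormal Ω y + (w - x) := by
    rw [sub_smul, ← hxy]
    abel
  rw [h3] at h1
  have h4 : ‖w - x‖ ^ 2 / (2 * (r - d)) ≤ ‖w - x‖ ^ 2 / r := by
    gcongr
    linarith
  linarith

/-- A bounded function with at most quadratic growth around each point, whose gradient points
outwards along the boundary. -/
theorem exists_boundary_barrier (hΩ : BallDomain Ω r) (k : ℝ) (hk : 0 ≤ k) :
    ∃ B η : ℝ, 0 ≤ B ∧ 0 < η ∧ ∃ ψ : Sp N → ℝ, (∀ x, 0 ≤ ψ x ∧ ψ x ≤ B) ∧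
      ∀ x ∈ closure Ω, ∃ q : Sp N, ‖q‖ ≤ B ∧
        (∀ w, ψ w ≤ ψ x + ⟪q, w - x⟫_ℝ + B / 2 * ‖w - x‖ ^ 2) ∧
        ∀ y ∈ frontier Ω, dist y x ≤ η → k ≤ ⟪q, outwardNormal Ω y⟫_ℝ := by
  have hr := hΩ.pos
  rcases Ωᶜ.eq_empty_or_nonempty with he | hne
  · refine ⟨0, 1, le_rfl, one_pos, fun _ => 0, by simp, fun x _ => ⟨0, by simp, by simp, ?_⟩⟩
    intro y hy
    rw [hΩ.isOpen.frontier_eq] at hy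
    exact absurd hy.2 (by rw [compl_empty_iff.1 he]; simp)
  -- The barrier is `κ * e ^ 2`: squaring the positive part removes the kink, so a paraboloid above
  -- exists at every point.
  set e : Sp N → ℝ := fun x => max (r / 2 - infDist x Ωᶜ) 0 with he
  have he0 : ∀ x, 0 ≤ e x := fun x => le_max_right _ _
  have he1 : ∀ x, e x ≤ r / 2 := fun x =>
    max_le (by linarith [infDist_nonneg (x := x) (s := Ωᶜ)]) (by linarith)
  -- Within `r / 4` of the boundary `e ≥ r / 4`, and nearby normals have inner product at least `1 /
  -- 2`; so the slope is at least `2 * κ * (r / 4) * (1 / 2) = k`.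
  set κ : ℝ := 4 * k / r with hκ
  have hκ0 : 0 ≤ κ := by positivity
  refine ⟨κ * (r + r ^ 2 + 4), r / 4, by positivity, by positivity, fun x => κ * e x ^ 2,
    fun x => ⟨by positivity, ?_⟩, fun x hx => ?_⟩
  · have : e x ^ 2 ≤ (r / 2) ^ 2 := by
      have := he0 x
      have := he1 x
      gcongr
    exact mul_le_mul_of_nonneg_left (by nlinarith) hκ0
  · obtain ⟨y, hy, hxy⟩ := hΩ.exists_nearest hne hx
    refine ⟨(2 * κ * e x) • outwardNormal Ω y, ?_, fun w => ?_, fun y' hy' hd => ?_⟩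
    · have h1 := he0 x
      have h2 := he1 x
      rw [norm_smul, hΩ.norm_normal y hy, Real.norm_of_nonneg (by positivity)]
      have : 2 * e x * 1 ≤ r + r ^ 2 + 4 := by nlinarith
      calc 2 * κ * e x * 1 = κ * (2 * e x * 1) := by ring
        _ ≤ _ := by gcongr
    · have hlip : |infDist w Ωᶜ - infDist x Ωᶜ| ≤ ‖w - x‖ := by
        have := (lipschitz_infDist_pt Ωᶜ).dist_le_mul w x
        rwa [Real.dist_eq, NNReal.coe_one, one_mul, dist_eq_norm] at this
      have hsq : (infDist w Ωᶜ - infDist x Ωᶜ) ^ 2 ≤ ‖w - x‖ ^ 2 := by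
        rw [← sq_abs]
        gcongr
      have h1 : e w ^ 2 ≤ (e x - (infDist w Ωᶜ - infDist x Ωᶜ)) ^ 2 := by
        rcases le_total (r / 2 - infDist w Ωᶜ) 0 with h | h
        · have : e w = 0 := max_eq_right h
          rw [this, zero_pow two_ne_zero]
          exact sq_nonneg _
        · have h2 : e w = r / 2 - infDist w Ωᶜ := max_eq_left h
          have h3 : r / 2 - infDist x Ωᶜ ≤ e x := le_max_left _ _
          have h4 : e w ≤ e x - (infDist w Ωᶜ - infDist x Ωᶜ) := by linarith
          have := he0 w
          gcongr
      have h2 : -(2 * e x * (infDist w Ωᶜ - infDist x Ωᶜ)) ≤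
          2 * e x * ⟪outwardNormal Ω y, w - x⟫_ℝ + ‖w - x‖ ^ 2 := by
        rcases le_or_gt (infDist x Ωᶜ) (r / 2) with h | h
        · have h3 := hΩ.le_infDist_compl (w := w) hy hxy h
          have h4 := he0 x
          have h5 : 2 * e x * (‖w - x‖ ^ 2 / r) ≤ r * (‖w - x‖ ^ 2 / r) := by
            have := he1 x
            gcongr
            linarith
          rw [mul_div_cancel₀ _ hr.ne'] at h5
          nlinarith
        · have : e x = 0 := max_eq_right (by linarith)
          rw [this]
          simp
      have h3 : e w ^ 2 ≤ e x ^ 2 + 2 * e x * ⟪outwardNormal Ω y, w - x⟫_ℝ + 2 * ‖w - x‖ ^ 2 := by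
        nlinarith
      rw [inner_smul_left]
      simp only [conj_trivial]
      calc κ * e w ^ 2
          ≤ κ * (e x ^ 2 + 2 * e x * ⟪outwardNormal Ω y, w - x⟫_ℝ + 2 * ‖w - x‖ ^ 2) := by gcongr
        _ = κ * e x ^ 2 + 2 * κ * e x * ⟪outwardNormal Ω y, w - x⟫_ℝ
            + κ * 4 / 2 * ‖w - x‖ ^ 2 := by ring
        _ ≤ _ := by
            gcongr
            nlinarith
    · have hy'Ω : y' ∈ Ωᶜ := by
        rw [hΩ.isOpen.frontier_eq] at hy'
        exact hy'.2
      have hdx : infDist x Ωᶜ ≤ r / 4 :=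
        (infDist_le_dist_of_mem hy'Ω).trans (by rwa [dist_comm])
      have hex : r / 4 ≤ e x := le_trans (by linarith) (le_max_left _ _)
      have hyy : ‖y - y'‖ ≤ r := by
        have h1 : ‖y - x‖ = infDist x Ωᶜ := by
          rw [hxy, norm_smul, hΩ.norm_normal y hy, Real.norm_of_nonneg infDist_nonneg, mul_one]
        have h2 := norm_sub_le_norm_sub_add_norm_sub y x y'
        rw [dist_comm, dist_eq_norm] at hd
        linarith
      have h1 := hΩ.inner_normal_ge hy hy' hyy
      rw [inner_smul_left]
      simp only [conj_trivial]
      calc k = 2 * κ * (r / 4) * (1 / 2) := by rw [hκ]; field_simp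
        _ ≤ _ := by gcongr

/-- Treats boundary and interior points together: away from the frontier `n = 0` works, the
condition being void. -/
theorem exists_outward_direction (hΩ : BallDomain Ω r) (x : Sp N) :
    ∃ n : Sp N, ‖n‖ ≤ 1 ∧ ∃ η : ℝ, 0 < η ∧ ∀ y ∈ frontier Ω, dist y x ≤ η →
      1 / 2 ≤ ⟪n, outwardNormal Ω y⟫_ℝ := by
  by_cases hx : x ∈ frontier Ω
  · refine ⟨outwardNormal Ω x, (hΩ.norm_normal x hx).le, r, hΩ.pos, fun y hy hd => ?_⟩
    rw [dist_comm, dist_eq_norm] at hd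
    exact hΩ.inner_normal_ge hx hy hd
  · obtain ⟨η, hη, hb⟩ := Metric.isOpen_iff.1 isClosed_frontier.isOpen_compl x hx
    refine ⟨0, by simp, η / 2, by positivity, fun y hy hd => ?_⟩
    exact absurd hy (hb (by rw [mem_ball]; linarith))

end BallDomain

/-! ### Mark's answer to an arbitrary move of Helen -/

theorem eventually_mul_rpow_le {a b c : ℝ} (K : ℝ) (hab : a < b) (hc : 0 < c) :
    ∀ᶠ ε in 𝓝[>] (0 : ℝ), K * ε ^ b ≤ c * ε ^ a := by
  have h1 : Tendsto (fun ε : ℝ => K * ε ^ (b - a)) (𝓝[>] 0) (𝓝 0) := by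
    have h2 : ContinuousAt (fun ε : ℝ => K * ε ^ (b - a)) 0 :=
      continuousAt_const.mul (Real.continuousAt_rpow_const _ _ (Or.inr (by linarith)))
    have h3 : Tendsto (fun ε : ℝ => K * ε ^ (b - a)) (𝓝 0) (𝓝 (K * 0 ^ (b - a))) := h2
    rw [Real.zero_rpow (by linarith), mul_zero] at h3
    exact h3.mono_left nhdsWithin_le_nhds
  filter_upwards [h1.eventually (gt_mem_nhds hc), self_mem_nhdsWithin] with ε h hε
  have hε' : 0 < ε := hε
  rw [show b = (b - a) + a by ring, Real.rpow_add hε', ← mul_assoc]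
  gcongr

theorem rpow_neg_add_le {ε b s K : ℝ} (hε : 0 < ε) (hε1 : ε ≤ 1) (hb : 0 ≤ b) (hs : 0 ≤ s)
    (hK : 0 ≤ K) : (ε ^ (-b) + K) ^ s ≤ (1 + K) ^ s * ε ^ (-(b * s)) := by
  have h1 : 1 ≤ ε ^ (-b) := Real.one_le_rpow_of_pos_of_le_one_of_nonpos hε hε1 (by linarith)
  have h2 : ε ^ (-b) + K ≤ (1 + K) * ε ^ (-b) := by nlinarith
  calc (ε ^ (-b) + K) ^ s ≤ ((1 + K) * ε ^ (-b)) ^ s := by gcongr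
    _ = (1 + K) ^ s * ε ^ (-(b * s)) := by
      rw [Real.mul_rpow (by positivity) (by positivity), ← Real.rpow_mul hε.le, neg_mul]

theorem eventually_le_one : ∀ᶠ ε in 𝓝[>] (0 : ℝ), 0 < ε ∧ ε ≤ 1 :=
  mem_of_superset (Ioc_mem_nhdsGT one_pos) fun _ h => h

/-- A move of size `ε ^ (-b)`, with growth of order `s`, costs about `ε ^ (2 - b * s)` in one round.
Each exponent condition on `f` says that this is negligible against a gain `ε ^ a`. -/
theorem eventually_rpow_neg_mul_sq_le {a b s c : ℝ} (K L : ℝ) (hb : 0 ≤ b) (hs : 0 ≤ s) (hK : 0 ≤ K)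
    (hL : 0 ≤ L) (hab : a + b * s < 2) (hc : 0 < c) :
    ∀ᶠ ε in 𝓝[>] (0 : ℝ), ε ^ 2 * (L * (ε ^ (-b) + K) ^ s) ≤ c * ε ^ a := by
  filter_upwards [eventually_mul_rpow_le (L * (1 + K) ^ s) (show a < 2 - b * s by linarith) hc,
    eventually_le_one] with ε h1 ⟨hε, hε1⟩
  refine le_trans ?_ h1
  have h2 := rpow_neg_add_le hε hε1 hb hs hK
  calc ε ^ 2 * (L * (ε ^ (-b) + K) ^ s)
      ≤ ε ^ 2 * (L * ((1 + K) ^ s * ε ^ (-(b * s)))) := by gcongr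
    _ = L * (1 + K) ^ s * (ε ^ (2 : ℝ) * ε ^ (-(b * s))) := by rw [Real.rpow_two]; ring
    _ = L * (1 + K) ^ s * ε ^ (2 - b * s) := by rw [← Real.rpow_add hε, ← sub_eq_add_neg]

theorem rpow_le_mul_rpow_sub_one {x y s : ℝ} (hx : 0 < x) (hxy : x ≤ y) (hs : 1 ≤ s) :
    x ^ s ≤ x * y ^ (s - 1) := by
  calc x ^ s = x * x ^ (s - 1) := by
        rw [← Real.rpow_one_add' hx.le (by linarith)]; congr 1; ring
    _ ≤ x * y ^ (s - 1) := by
        have : 0 ≤ s - 1 := by linarith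
        gcongr

/-- A self-adjoint operator which is not below `θ` attains its largest eigenvalue. -/
theorem exists_maximal_direction (A : Mat N) {θ : ℝ} (h : ¬ ∀ v, ⟪A v, v⟫_ℝ ≤ θ * ‖v‖ ^ 2) :
    ∃ e : Sp N, ‖e‖ = 1 ∧ θ < ⟪A e, e⟫_ℝ ∧ ∀ v, ⟪A v, v⟫_ℝ ≤ ⟪A e, e⟫_ℝ * ‖v‖ ^ 2 := by
  push Not at h
  obtain ⟨v₀, hv₀⟩ := h
  have hne : v₀ ≠ 0 := by
    rintro rfl
    simp at hv₀
  have hn : ∀ v : Sp N, v ≠ 0 → ‖‖v‖⁻¹ • v‖ = 1 := fun v hv => by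
    rw [norm_smul, norm_inv, norm_norm, inv_mul_cancel₀ (norm_ne_zero_iff.2 hv)]
  have hscale : ∀ v : Sp N, v ≠ 0 →
      ⟪A v, v⟫_ℝ = ⟪A (‖v‖⁻¹ • v), ‖v‖⁻¹ • v⟫_ℝ * ‖v‖ ^ 2 := fun v hv => by
    rw [map_smul, inner_smul_left, inner_smul_right]
    have := norm_ne_zero_iff.2 hv
    simp only [conj_trivial]
    field_simp
  have hcont : ContinuousOn (fun v : Sp N => ⟪A v, v⟫_ℝ) (sphere 0 1) := by fun_prop
  obtain ⟨e, he, hmax⟩ := (isCompact_sphere (0 : Sp N) 1).exists_isMaxOn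
    ⟨‖v₀‖⁻¹ • v₀, by simpa using hn v₀ hne⟩ hcont
  have hmax' : ∀ v, ⟪A v, v⟫_ℝ ≤ ⟪A e, e⟫_ℝ * ‖v‖ ^ 2 := fun v => by
    by_cases hv : v = 0
    · simp [hv]
    · rw [hscale v hv]
      gcongr
      exact hmax (by simpa using hn v hv)
  refine ⟨e, by simpa using he, ?_, hmax'⟩
  have h1 : 0 < ‖v₀‖ ^ 2 := by positivity
  exact lt_of_mul_lt_mul_right (hv₀.trans_le (hmax' v₀)) h1.le

theorem isSelfAdjoint_add_smul_one {X : Mat N} (hX : IsSelfAdjoint X) (c : ℝ) :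
    IsSelfAdjoint (X + c • (1 : Mat N)) := by
  rw [ContinuousLinearMap.isSelfAdjoint_iff_isSymmetric] at hX ⊢
  intro x y
  have h := hX x y
  simp only [ContinuousLinearMap.coe_coe] at h ⊢
  simp [inner_add_left, inner_add_right, inner_smul_left, inner_smul_right, h]

theorem isPositive_of_le {X Γ : Mat N} (hX : IsSelfAdjoint X) (hΓ : IsSelfAdjoint Γ) {c : ℝ}
    (h : ∀ v, ⟪(Γ - X) v, v⟫_ℝ ≤ c * ‖v‖ ^ 2) : (X + c • (1 : Mat N) - Γ).IsPositive := by
  rw [ContinuousLinearMap.isPositive_def']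
  refine ⟨(isSelfAdjoint_add_smul_one hX c).sub hΓ, fun v => ?_⟩
  have h1 := h v
  rw [ContinuousLinearMap.reApplyInnerSelf_apply]
  simp only [sub_apply, add_apply, smul_apply, one_apply_eq_self, inner_sub_left, inner_add_left,
    inner_smul_left, real_inner_self_eq_norm_sq, conj_trivial, RCLike.re_to_real] at h1 ⊢
  linarith

theorem norm_add_smul_one_le {X : Mat N} {R c : ℝ} (hX : ‖X‖ ≤ R) (hc : 0 ≤ c) :
    ‖X + c • (1 : Mat N)‖ ≤ R + c := by
  refine (norm_add_le _ _).trans (add_le_add hX ?_)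
  rw [norm_smul, Real.norm_of_nonneg hc]
  exact mul_le_of_le_one_right hc ContinuousLinearMap.norm_id_le

theorem inner_apply_self_le (A : Mat N) (v : Sp N) : |⟪A v, v⟫_ℝ| ≤ ‖A‖ * ‖v‖ ^ 2 := by
  refine (abs_real_inner_le_norm _ _).trans ?_
  rw [pow_two, ← mul_assoc]
  gcongr
  exact A.le_opNorm v

/-- One factor is kept proportional to the deviation `D`, and only the other `s - 1` are bounded
crudely. The loss can then be compared with a gain proportional to `D`, which is why `q - 1` and `r
- 1` occur in the exponent conditions. -/
theorem rpow_le_of_le_add {x D E R θ s : ℝ} (hx : 0 ≤ x) (hR : 0 ≤ R) (hθ : 0 < θ) (hθD : θ ≤ D)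
    (hxD : x ≤ D + R) (hDE : D ≤ E + R) (hs : 1 ≤ s) :
    x ^ s ≤ D * ((1 + R / θ) * (E + 2 * R) ^ (s - 1)) := by
  have hs0 : 0 ≤ s := by linarith
  have hE : 0 ≤ E + 2 * R := by linarith
  calc x ^ s ≤ (D + R) ^ s := by gcongr
    _ ≤ (D + R) * (E + 2 * R) ^ (s - 1) :=
      rpow_le_mul_rpow_sub_one (by linarith) (by linarith) hs
    _ ≤ (D * (1 + R / θ)) * (E + 2 * R) ^ (s - 1) := by
      gcongr
      have : R ≤ D * (R / θ) := by
        calc R = θ * (R / θ) := by field_simp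
          _ ≤ _ := by gcongr
      linarith
    _ = _ := by ring

/-- The move of length `s` along `v` gains `‖v‖ * s`, and the quadratic term costs at most an eighth
of it. -/
theorem exists_move_of_norm {v : Sp N} {A : Mat N} {s K y : ℝ} (hv : 0 < ‖v‖) (hs : 0 ≤ s)
    (hA : ‖A‖ * s ^ 2 ≤ ‖v‖ * s / 4) (hK : K ≤ y + 7 / 8 * (‖v‖ * s)) :
    ∃ d : Sp N, ‖d‖ ≤ s ∧ K ≤ ⟪v, d⟫_ℝ + 1 / 2 * ⟪A d, d⟫_ℝ + y := by
  have hdn : ‖(s / ‖v‖) • v‖ = s := by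
    rw [norm_smul, Real.norm_of_nonneg (by positivity), div_mul_cancel₀ _ hv.ne']
  refine ⟨(s / ‖v‖) • v, hdn.le, ?_⟩
  have h1 : ⟪v, (s / ‖v‖) • v⟫_ℝ = ‖v‖ * s := by
    rw [inner_smul_right, real_inner_self_eq_norm_sq]
    field_simp
  have h2 := (abs_le.1 (inner_apply_self_le A ((s / ‖v‖) • v))).1
  rw [hdn] at h2
  rw [h1]
  linarith

/-- The sign of `± e` is chosen so that the linear term is nonnegative. -/
theorem exists_move_of_inner {v e : Sp N} {A : Mat N} {s K y : ℝ} (he : ‖e‖ = 1) (hs : 0 ≤ s)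
    (hK : K ≤ y + 1 / 2 * (s ^ 2 * ⟪A e, e⟫_ℝ)) :
    ∃ d : Sp N, ‖d‖ ≤ s ∧ K ≤ ⟪v, d⟫_ℝ + 1 / 2 * ⟪A d, d⟫_ℝ + y := by
  obtain ⟨σ, hσ, hσ1⟩ : ∃ σ : ℝ, σ ^ 2 = 1 ∧ 0 ≤ ⟪v, σ • e⟫_ℝ := by
    rcases le_total 0 ⟪v, e⟫_ℝ with h | h
    · exact ⟨1, by norm_num, by simpa using h⟩
    · exact ⟨-1, by norm_num, by simpa using h⟩
  have hσn : |σ| = 1 := by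
    rw [← sq_eq_sq₀ (abs_nonneg _) zero_le_one, sq_abs, hσ, one_pow]
  refine ⟨s • σ • e, ?_, ?_⟩
  · rw [norm_smul, norm_smul, he, Real.norm_eq_abs σ, hσn, Real.norm_of_nonneg hs]
    simp
  have h1 : 0 ≤ ⟪v, s • σ • e⟫_ℝ := by
    rw [inner_smul_right]
    positivity
  have h2 : ⟪A (s • σ • e), s • σ • e⟫_ℝ = s ^ 2 * ⟪A e, e⟫_ℝ := by
    rw [map_smul, map_smul, inner_smul_left, inner_smul_left, inner_smul_right, inner_smul_right]
    simp only [conj_trivial]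
    linear_combination s ^ 2 * ⟪A e, e⟫_ℝ * hσ
  rw [h2]
  linarith

/-- Here `F` stands for `f` at frozen `(t, x, z)` and `M` for `1 + |z|`; `(p, X)` comes from a
paraboloid and `(p', Γ)` is Helen's move. The threshold on `ε` is independent of all of these, as
the inductions on rounds require. When the move deviates, the gain beats `ε ^ 2 * L` for any
prescribed `L`. -/
theorem exists_move {α β γ q r : ℝ} (hpar : ExponentHypotheses α β γ q r) (hq : 1 ≤ q) (hr : 1 ≤ r)
    {R δ C C' : ℝ} (L : ℝ) (hR : 0 ≤ R) (hδ : 0 < δ) (hC : 0 ≤ C) (hC' : 0 ≤ C') :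
    ∀ᶠ ε in 𝓝[>] (0 : ℝ), ∀ (F : Sp N → Mat N → ℝ) (M : ℝ), 0 ≤ M →
      (∀ p Γ₁ Γ₂, IsSelfAdjoint Γ₁ → Γ₂.IsPositive → F p (Γ₁ + Γ₂) ≤ F p Γ₁) →
      (∀ p p' Γ Γ', IsSelfAdjoint Γ → IsSelfAdjoint Γ' → ‖(p, Γ)‖ + ‖(p', Γ')‖ ≤ 2 * R + 1 →
        |F p Γ - F p' Γ'| ≤ C' * M * ‖(p, Γ) - (p', Γ')‖) →
      (∀ p Γ, IsSelfAdjoint Γ → |F p Γ| ≤ C * (M + ‖p‖ ^ q + ‖Γ‖ ^ r)) →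
      ∀ p X p' Γ, ‖p‖ ≤ R → ‖X‖ ≤ R → IsSelfAdjoint X → IsSelfAdjoint Γ →
        ‖p'‖ ≤ ε ^ (-β) → ‖Γ‖ ≤ ε ^ (-γ) →
        ∃ d : Sp N, ‖d‖ ≤ ε ^ (1 - α) ∧
          (ε ^ 2 * (F p X - δ * M) ≤
              ⟪p' - p, d⟫_ℝ + 1 / 2 * ⟪(Γ - X) d, d⟫_ℝ + ε ^ 2 * F p' Γ ∨
            ε ^ 2 * (L - C * M) ≤
              ⟪p' - p, d⟫_ℝ + 1 / 2 * ⟪(Γ - X) d, d⟫_ℝ + ε ^ 2 * F p' Γ) := by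
  obtain ⟨hα0, hβ0, hγ0, hα, -, -, -, hγα, hβq, hγr1, hγr⟩ := hpar
  -- Deviations below `θ` change `F` by at most `δ * M`; larger ones are exploited by Mark.
  obtain ⟨θ, hθ0, hθ1, hθδ⟩ : ∃ θ : ℝ, 0 < θ ∧ θ ≤ 1 / 2 ∧ C' * θ ≤ δ := by
    refine ⟨min (1 / 2) (δ / (C' + 1)), by positivity, min_le_left _ _, ?_⟩
    calc C' * min (1 / 2) (δ / (C' + 1)) ≤ (C' + 1) * (δ / (C' + 1)) := by
          gcongr
          · linarith
          · exact min_le_right _ _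
      _ = δ := by field_simp
  have hd : 0 ≤ 1 + R / θ := by positivity
  filter_upwards [eventually_le_one,
    eventually_mul_rpow_le |L| (show 1 - α < 2 by linarith) (show 0 < θ / 8 by positivity),
    eventually_mul_rpow_le (1 + R) (show 1 - α < 2 - 2 * α - γ by linarith)
      (show 0 < θ / 4 by positivity),
    eventually_rpow_neg_mul_sq_le (a := 1 - α) (s := r) (2 * R + 1) C hγ0.le (by linarith)
      (by linarith) hC (by linarith) (show 0 < θ / 4 by positivity),
    eventually_rpow_neg_mul_sq_le (a := 1 - α) (2 * R) (C * (1 + R / θ)) hβ0.le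
      (show 0 ≤ q - 1 by linarith) (by linarith) (by positivity) (by linarith)
      (show (0 : ℝ) < 1 / 4 by norm_num),
    eventually_mul_rpow_le (|L| + C * (R + 1) ^ q) (show 2 - 2 * α < 2 by linarith)
      (show 0 < θ / 4 by positivity),
    eventually_rpow_neg_mul_sq_le (a := 2 - 2 * α) (2 * R) (C * (1 + R / θ)) hγ0.le
      (show 0 ≤ r - 1 by linarith) (by linarith) (by positivity) (by linarith)
      (show (0 : ℝ) < 1 / 4 by norm_num)]
    with ε ⟨hε, hε1⟩ e1 e2 e3 e4 e5 e6 F M hM hmono hlip hgrowth p X p' Γ hp hX hXs hΓs hp' hΓ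
  rw [Real.rpow_two] at e1 e5
  have hL : L ≤ |L| := le_abs_self L
  have hεsq : 0 < ε ^ 2 := by positivity
  have hnorm : ‖Γ - X‖ ≤ ε ^ (-γ) + R := (norm_sub_le _ _).trans (add_le_add hΓ hX)
  -- Ellipticity replaces `Γ` by the larger `X + c`, so only the part of `Γ` above `X` matters; a
  -- very negative `Γ` costs nothing.
  have hlower : ∀ c : ℝ, 0 ≤ c → (∀ v, ⟪(Γ - X) v, v⟫_ℝ ≤ c * ‖v‖ ^ 2) →
      F p' (X + c • (1 : Mat N)) ≤ F p' Γ := fun c hc h => by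
    have := hmono p' Γ _ hΓs (isPositive_of_le hXs hΓs h)
    rwa [add_sub_cancel] at this
  have hSA := isSelfAdjoint_add_smul_one hXs
  have hlower' : ∀ c : ℝ, 0 ≤ c → (∀ v, ⟪(Γ - X) v, v⟫_ℝ ≤ c * ‖v‖ ^ 2) →
      -(C * (M + ‖p'‖ ^ q + (R + c) ^ r)) ≤ F p' Γ := fun c hc h => by
    have h1 := hlower c hc h
    have h2 := (abs_le.1 (hgrowth p' _ (hSA c))).1
    have h3 : ‖X + c • (1 : Mat N)‖ ^ r ≤ (R + c) ^ r := by
      have := norm_add_smul_one_le hX hc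
      gcongr
    have h4 : C * (M + ‖p'‖ ^ q + ‖X + c • (1 : Mat N)‖ ^ r) ≤
      C * (M + ‖p'‖ ^ q + (R + c) ^ r) := by gcongr
    linarith
  rcases le_or_gt θ ‖p' - p‖ with hcase | hcase
  -- Wrong slope: a full step along `p' - p` gains order `‖p' - p‖ * ε ^ (1 - α)`, which dominates
  -- every other term.
  · have hP : 0 < ‖p' - p‖ := hθ0.trans_le hcase
    have hs0 : 0 < ε ^ (1 - α) := Real.rpow_pos_of_pos hε _
    have h9 : θ * ε ^ (1 - α) ≤ ‖p' - p‖ * ε ^ (1 - α) := by gcongr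
    have h3 : ‖Γ - X‖ * (ε ^ (1 - α)) ^ 2 ≤ θ / 4 * ε ^ (1 - α) := by
      refine le_trans ?_ e2
      calc ‖Γ - X‖ * (ε ^ (1 - α)) ^ 2 ≤ (ε ^ (-γ) + R) * (ε ^ (1 - α)) ^ 2 := by gcongr
        _ ≤ ((1 + R) * ε ^ (-γ)) * (ε ^ (1 - α)) ^ 2 := by
          have : 1 ≤ ε ^ (-γ) := Real.one_le_rpow_of_pos_of_le_one_of_nonpos hε hε1 (by linarith)
          gcongr
          nlinarith
        _ = (1 + R) * ε ^ (2 - 2 * α - γ) := by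
          rw [← Real.rpow_two, ← Real.rpow_mul hε.le, mul_assoc, ← Real.rpow_add hε]
          ring_nf
    have hc : 0 ≤ ε ^ (-γ) + R := by positivity
    have h4 := hlower' (ε ^ (-γ) + R) hc fun v =>
      (le_abs_self _).trans ((inner_apply_self_le _ v).trans (by gcongr))
    have h5 : (R + (ε ^ (-γ) + R)) ^ r ≤ (ε ^ (-γ) + (2 * R + 1)) ^ r := by
      have : 0 ≤ r := by linarith
      gcongr ?_ ^ r
      linarith
    have h6 : ‖p'‖ ^ q ≤ ‖p' - p‖ * ((1 + R / θ) * (ε ^ (-β) + 2 * R) ^ (q - 1)) := by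
      refine rpow_le_of_le_add (norm_nonneg _) hR hθ0 hcase ?_
        ((norm_sub_le _ _).trans (add_le_add hp' hp)) hq
      have := norm_le_norm_add_norm_sub' p' p
      linarith
    have h7 : ε ^ 2 * (C * ‖p'‖ ^ q) ≤ ‖p' - p‖ * (1 / 4 * ε ^ (1 - α)) := by
      calc ε ^ 2 * (C * ‖p'‖ ^ q)
          ≤ ε ^ 2 * (C * (‖p' - p‖ * ((1 + R / θ) * (ε ^ (-β) + 2 * R) ^ (q - 1)))) := by gcongr
        _ = ‖p' - p‖ * (ε ^ 2 * (C * (1 + R / θ) * (ε ^ (-β) + 2 * R) ^ (q - 1))) := by ring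
        _ ≤ _ := by gcongr
    have h8 : ε ^ 2 * (C * (R + (ε ^ (-γ) + R)) ^ r) ≤ θ / 4 * ε ^ (1 - α) :=
      le_trans (by gcongr) e3
    have h10 : ε ^ 2 * L ≤ |L| * ε ^ 2 := by
      rw [mul_comm]
      gcongr
    have h11 := mul_le_mul_of_nonneg_left h4 hεsq.le
    have h12 := mul_pos hP hs0
    obtain ⟨d, hd, hK⟩ := exists_move_of_norm (A := Γ - X) (K := ε ^ 2 * (L - C * M)) (y := ε ^ 2 * F p' Γ) hP
      hs0.le (by linarith) (by linarith)
    exact ⟨d, hd, Or.inr hK⟩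
  · by_cases hθ : ∀ v, ⟪(Γ - X) v, v⟫_ℝ ≤ θ * ‖v‖ ^ 2
    -- Slope nearly right and `Γ ≤ X + θ`: Mark stands still; monotonicity and the Lipschitz bound
    -- suffice.
    · refine ⟨0, by rw [norm_zero]; positivity, Or.inl ?_⟩
      have h1 := hlower θ hθ0.le hθ
      have h2 := norm_add_smul_one_le hX hθ0.le
      have h3 : ‖p'‖ ≤ R + 1 / 2 := by
        have := norm_le_norm_add_norm_sub' p' p
        linarith
      have h4 : ‖(p, X)‖ ≤ R := by
        rw [Prod.norm_mk]
        exact max_le hp hX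
      have h5 : ‖(p', X + θ • (1 : Mat N))‖ ≤ R + 1 / 2 := by
        rw [Prod.norm_mk]
        exact max_le h3 (by linarith)
      have h6 := hlip p p' X (X + θ • (1 : Mat N)) hXs (hSA θ) (by linarith)
      have h7 : ‖(p, X) - (p', X + θ • (1 : Mat N))‖ ≤ θ := by
        rw [Prod.mk_sub_mk, Prod.norm_mk]
        refine max_le (by rw [norm_sub_rev]; exact hcase.le) ?_
        rw [sub_add_cancel_left, norm_neg]
        simpa using norm_add_smul_one_le (N := N) (X := 0) (R := 0) (by simp) hθ0.le
      have h8 : C' * M * ‖(p, X) - (p', X + θ • (1 : Mat N))‖ ≤ δ * M := by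
        calc C' * M * ‖(p, X) - (p', X + θ • (1 : Mat N))‖ ≤ C' * M * θ := by gcongr
          _ = C' * θ * M := by ring
          _ ≤ _ := by gcongr
      have h9 := (abs_le.1 h6).2
      simp only [inner_zero_right, mul_zero, zero_add]
      gcongr
      linarith
    -- Slope nearly right but largest eigenvalue `lam > θ`: a step along its eigenvector gains `lam
    -- * ε ^ (2 - 2 * α) / 2`.
    · obtain ⟨e, he, hθe, hmax⟩ := exists_maximal_direction _ hθ
      have hlam0 : 0 < ⟪(Γ - X) e, e⟫_ℝ := hθ0.trans hθe
      have hlam1 : ⟪(Γ - X) e, e⟫_ℝ ≤ ε ^ (-γ) + R := by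
        have := (le_abs_self _).trans (inner_apply_self_le (Γ - X) e)
        rw [he, one_pow, mul_one] at this
        exact this.trans hnorm
      generalize hlam : ⟪(Γ - X) e, e⟫_ℝ = lam at *
      have hs0 : 0 < ε ^ (1 - α) := Real.rpow_pos_of_pos hε _
      have hss : (ε ^ (1 - α)) ^ 2 = ε ^ (2 - 2 * α) := by
        rw [← Real.rpow_two, ← Real.rpow_mul hε.le]
        ring_nf
      have h4 := hlower' lam hlam0.le hmax
      have h5 : ‖p'‖ ^ q ≤ (R + 1) ^ q := by
        have := norm_le_norm_add_norm_sub' p' p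
        have hq0 : 0 ≤ q := by linarith
        gcongr
        linarith
      have h6 : (R + lam) ^ r ≤ lam * ((1 + R / θ) * (ε ^ (-γ) + 2 * R) ^ (r - 1)) :=
        rpow_le_of_le_add (by linarith) hR hθ0 hθe.le (by linarith) hlam1 hr
      have h7 : ε ^ 2 * (C * (R + lam) ^ r) ≤ lam * (1 / 4 * (ε ^ (1 - α)) ^ 2) := by
        rw [hss]
        calc ε ^ 2 * (C * (R + lam) ^ r)
            ≤ ε ^ 2 * (C * (lam * ((1 + R / θ) * (ε ^ (-γ) + 2 * R) ^ (r - 1)))) := by gcongr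
          _ = lam * (ε ^ 2 * (C * (1 + R / θ) * (ε ^ (-γ) + 2 * R) ^ (r - 1))) := by ring
          _ ≤ _ := by gcongr
      rw [← hss] at e5
      have h8 : θ * (ε ^ (1 - α)) ^ 2 ≤ lam * (ε ^ (1 - α)) ^ 2 := by gcongr
      have h9 : ε ^ 2 * (C * ‖p'‖ ^ q) ≤ ε ^ 2 * (C * (R + 1) ^ q) := by gcongr
      have h10 : ε ^ 2 * L ≤ |L| * ε ^ 2 := by
        rw [mul_comm]
        gcongr
      have h11 := mul_le_mul_of_nonneg_left h4 hεsq.le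
      obtain ⟨d, hd, hK⟩ := exists_move_of_inner (v := p' - p) (A := Γ - X)
        (K := ε ^ 2 * (L - C * M)) (y := ε ^ 2 * F p' Γ) he hs0.le (by rw [hlam]; linarith)
      exact ⟨d, hd, Or.inr hK⟩

/-! ### Semicontinuity of the value function and the dynamic programming principle -/

/-- The tube lemma makes the strict bound uniform over `K`; the intermediate `y'` keeps it strict
after the infimum. -/
theorem lowerSemicontinuousOn_biInf_of_isCompact {β κ δ : Type*} [TopologicalSpace β]
    [TopologicalSpace κ] [CompleteLinearOrder δ] [DenselyOrdered δ] {S : Set β} {K : Set κ}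
    (hK : IsCompact K) {F : β × κ → δ} (hF : LowerSemicontinuousOn F (S ×ˢ K)) :
    LowerSemicontinuousOn (fun b => ⨅ k ∈ K, F (b, k)) S := by
  intro b₀ hb₀ y hy
  obtain ⟨y', hyy', hy'⟩ := exists_between hy
  have h1 : ∀ᶠ b in 𝓝 b₀, ∀ k ∈ K, b ∈ S → k ∈ K → y' < F (b, k) := by
    refine hK.eventually_forall_of_forall_eventually
      (P := fun b k => b ∈ S → k ∈ K → y' < F (b, k)) fun k hk => ?_
    have h2 := hF (b₀, k) ⟨hb₀, hk⟩ y' (hy'.trans_le (iInf₂_le k hk))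
    rw [eventually_nhdsWithin_iff] at h2
    exact h2.mono fun a ha hb hk => ha ⟨hb, hk⟩
  rw [eventually_nhdsWithin_iff]
  exact h1.mono fun b hb hbS => hyy'.trans_le (le_iInf₂ fun k hk => (hb k hk hbS hk).le)

theorem upperSemicontinuousOn_biSup_of_isCompact {β κ δ : Type*} [TopologicalSpace β]
    [TopologicalSpace κ] [CompleteLinearOrder δ] [DenselyOrdered δ] {S : Set β} {K : Set κ}
    (hK : IsCompact K) {F : β × κ → δ} (hF : UpperSemicontinuousOn F (S ×ˢ K)) :
    UpperSemicontinuousOn (fun b => ⨆ k ∈ K, F (b, k)) S :=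
  lowerSemicontinuousOn_biInf_of_isCompact (δ := δᵒᵈ) hK hF

/-- Helen's admissible moves. -/
def moves (N : ℕ) (β γ ε : ℝ) : Set (Sp N × Mat N) :=
  {a | IsSelfAdjoint a.2 ∧ ‖a.1‖ ≤ ε ^ (-β) ∧ ‖a.2‖ ≤ ε ^ (-γ)}

theorem isCompact_moves (N : ℕ) (β γ ε : ℝ) : IsCompact (moves N β γ ε) := by
  have h1 : IsClosed {Γ : Mat N | IsSelfAdjoint Γ} :=
    isClosed_eq (ContinuousLinearMap.adjoint (𝕜 := ℝ) (E := Sp N) (F := Sp N)).continuous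
      continuous_id
  have h2 : moves N β γ ε =
      closedBall 0 (ε ^ (-β)) ×ˢ (closedBall 0 (ε ^ (-γ)) ∩ {Γ : Mat N | IsSelfAdjoint Γ}) := by
    ext a
    simp only [moves, mem_ofPred_eq, mem_prod, mem_closedBall_zero_iff, mem_inter_iff]
    tauto
  rw [h2]
  exact (isCompact_closedBall _ _).prod ((isCompact_closedBall _ _).inter_right h1)

theorem isSelfAdjoint_zero : IsSelfAdjoint (0 : Mat N) := by
  rw [ContinuousLinearMap.isSelfAdjoint_iff_isSymmetric]
  intro x y
  simp

theorem isSelfAdjoint_neg {X : Mat N} (hX : IsSelfAdjoint X) : IsSelfAdjoint (-X) := by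
  rw [ContinuousLinearMap.isSelfAdjoint_iff_isSymmetric] at hX ⊢
  intro x y
  have h := hX x y
  simp only [ContinuousLinearMap.coe_coe] at h ⊢
  simp [inner_neg_left, inner_neg_right, h]

theorem zero_mem_moves {β γ ε : ℝ} (hε : 0 < ε) : (0, 0) ∈ moves N β γ ε := by
  refine ⟨isSelfAdjoint_zero, ?_, ?_⟩ <;> rw [norm_zero] <;> positivity

theorem valueU_succ (P : FinalValueProblem N) (α β γ ε : ℝ) (j : ℕ) (x : Sp N) (z : ℝ) :
    valueU P α β γ ε (j + 1) x z = ⨆ a ∈ moves N β γ ε, ⨅ d ∈ closedBall (0 : Sp N) (ε ^ (1 - α)),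
      valueU P α β γ ε j (projClosure P.Ω (x + d))
        (nextDebt P ε (P.T - (j + 1) * ε ^ 2) x z a.1 a.2 d) := by
  rw [valueU, iSup_prod]
  simp only [moves, mem_ofPred_eq, iSup_and, mem_closedBall_zero_iff]

section

variable {P : FinalValueProblem N} {α β γ q r ε ϱ : ℝ}

theorem continuousOn_nextDebt_snd (hf : FHypotheses P q r) {x : Sp N} (hx : x ∈ closure P.Ω)
    (t : ℝ) (d : Sp N) : ContinuousOn (fun b : ℝ × (Sp N × Mat N) =>
      nextDebt P ε t x b.1 b.2.1 b.2.2 d) (univ ×ˢ moves N β γ ε) := by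
  have h1 : ContinuousOn (fun b : ℝ × (Sp N × Mat N) => P.f t x b.1 b.2.1 b.2.2)
      (univ ×ˢ moves N β γ ε) :=
    hf.continuous.comp (f := fun b : ℝ × (Sp N × Mat N) => (t, x, b.1, b.2.1, b.2.2))
      (by fun_prop) fun b hb => ⟨hx, hb.2.1⟩
  unfold nextDebt
  fun_prop

/-- Infima preserve upper semicontinuity, and so does the supremum over the compact set of moves.
Only `z` varies: with `x` and `d` fixed the next position does not depend on Helen's move, so
continuity of the projection is not needed. -/
theorem upperSemicontinuous_valueU (hΩ : BallDomain P.Ω ϱ) (hf : FHypotheses P q r) (j : ℕ) :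
    ∀ x ∈ closure P.Ω, UpperSemicontinuousOn (valueU P α β γ ε j x) univ := by
  induction j with
  | zero =>
    intro x _
    have : Continuous fun z : ℝ => ((P.g x - z : ℝ) : EReal) :=
      continuous_coe_real_ereal.comp (by fun_prop)
    exact this.upperSemicontinuous.upperSemicontinuousOn _
  | succ j ih =>
    intro x hx
    have h : valueU P α β γ ε (j + 1) x = fun z => ⨆ a ∈ moves N β γ ε,
        ⨅ d ∈ closedBall (0 : Sp N) (ε ^ (1 - α)),
          valueU P α β γ ε j (projClosure P.Ω (x + d))
            (nextDebt P ε (P.T - (j + 1) * ε ^ 2) x z a.1 a.2 d) :=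
      funext fun z => valueU_succ P α β γ ε j x z
    rw [h]
    refine upperSemicontinuousOn_biSup_of_isCompact (F := fun b : ℝ × (Sp N × Mat N) =>
      ⨅ d ∈ closedBall (0 : Sp N) (ε ^ (1 - α)), valueU P α β γ ε j (projClosure P.Ω (x + d))
        (nextDebt P ε (P.T - (j + 1) * ε ^ 2) x b.1 b.2.1 b.2.2 d))
      (isCompact_moves N β γ ε) ?_
    refine upperSemicontinuousOn_biInf fun d _ => ?_
    exact (ih _ (hΩ.projClosure_mem _)).comp (continuousOn_nextDebt_snd hf hx _ d)
      fun _ _ => mem_univ _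

/-- Helen has an optimal move. -/
theorem exists_move_of_nonneg_valueU (hΩ : BallDomain P.Ω ϱ) (hf : FHypotheses P q r)
    (hε : 0 < ε) {j : ℕ} {x : Sp N} (hx : x ∈ closure P.Ω) {z : ℝ}
    (h : 0 ≤ valueU P α β γ ε (j + 1) x z) :
    ∃ (p : Sp N) (Γ : Mat N), IsSelfAdjoint Γ ∧ ‖p‖ ≤ ε ^ (-β) ∧ ‖Γ‖ ≤ ε ^ (-γ) ∧
      ∀ d : Sp N, ‖d‖ ≤ ε ^ (1 - α) → 0 ≤ valueU P α β γ ε j (projClosure P.Ω (x + d))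
        (nextDebt P ε (P.T - (j + 1) * ε ^ 2) x z p Γ d) := by
  rw [valueU_succ] at h
  have husc : UpperSemicontinuousOn (fun a : Sp N × Mat N =>
      ⨅ d ∈ closedBall (0 : Sp N) (ε ^ (1 - α)), valueU P α β γ ε j (projClosure P.Ω (x + d))
        (nextDebt P ε (P.T - (j + 1) * ε ^ 2) x z a.1 a.2 d)) (moves N β γ ε) := by
    refine upperSemicontinuousOn_biInf fun d _ => ?_
    refine (upperSemicontinuous_valueU hΩ hf j _ (hΩ.projClosure_mem _)).comp
      (g := fun a : Sp N × Mat N => nextDebt P ε (P.T - (j + 1) * ε ^ 2) x z a.1 a.2 d) ?_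
      fun _ _ => mem_univ _
    exact (continuousOn_nextDebt_snd hf hx _ d).comp
      (f := fun a : Sp N × Mat N => (z, a)) (by fun_prop) fun a ha => ⟨mem_univ _, ha⟩
  obtain ⟨a, ha, hmax⟩ := husc.exists_isMaxOn ⟨_, zero_mem_moves hε⟩ (isCompact_moves N β γ ε)
  refine ⟨a.1, a.2, ha.1, ha.2.1, ha.2.2, fun d hd => ?_⟩
  exact (h.trans (iSup₂_le hmax)).trans (iInf₂_le d (by simpa using hd))

/-- The function `h` is controlled only on the frontier. At points of `closure Ω` the product tends
to zero because `h` is bounded there. -/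
theorem continuousOn_reflection (hΩ : BallDomain P.Ω ϱ) (hh : ContinuousOn P.h (frontier P.Ω))
    (hhb : BoundedOn P.h (frontier P.Ω)) :
    ContinuousOn (fun y => ‖y - projClosure P.Ω y‖ * P.h (projClosure P.Ω y))
      {y | infDist y (closure P.Ω) ≤ ϱ / 2} := by
  intro y hy
  have hproj := hΩ.continuousOn_projClosure y hy
  have hnorm : ContinuousWithinAt (fun y => ‖y - projClosure P.Ω y‖)
      {y | infDist y (closure P.Ω) ≤ ϱ / 2} y := (continuousWithinAt_id.sub hproj).norm
  by_cases hyc : y ∈ closure P.Ω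
  · obtain ⟨C, hC⟩ := hhb
    have h0 : ‖y - projClosure P.Ω y‖ = 0 := by simp [hΩ.projClosure_of_mem hyc]
    have hlim : Tendsto (fun y => ‖y - projClosure P.Ω y‖ * C)
        (𝓝[{y | infDist y (closure P.Ω) ≤ ϱ / 2}] y) (𝓝 0) := by
      have := hnorm.tendsto.mul_const C
      rwa [h0, zero_mul] at this
    rw [ContinuousWithinAt, h0, zero_mul]
    refine squeeze_zero_norm (fun w => ?_) hlim
    rw [norm_mul, norm_norm]
    by_cases hw : w ∈ closure P.Ω
    · simp [hΩ.projClosure_of_mem hw]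
    · gcongr
      exact hC _ (hΩ.projClosure_mem_frontier hw)
  · refine hnorm.mul ?_
    have hev : (closure P.Ω)ᶜ ∈ 𝓝 y := isClosed_closure.isOpen_compl.mem_nhds hyc
    rw [← continuousWithinAt_inter hev] at hproj ⊢
    exact (hh _ (hΩ.projClosure_mem_frontier hyc)).comp hproj
      fun w hw => hΩ.projClosure_mem_frontier hw.2

theorem infDist_add_le {x d : Sp N} {Ω : Set (Sp N)} (hx : x ∈ closure Ω) :
    infDist (x + d) (closure Ω) ≤ ‖d‖ := by
  refine (infDist_le_dist_of_mem hx).trans ?_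
  rw [dist_eq_norm, add_sub_cancel_left]

theorem continuousOn_step (hΩ : BallDomain P.Ω ϱ) (hf : FHypotheses P q r)
    (hh : ContinuousOn P.h (frontier P.Ω)) (hhb : BoundedOn P.h (frontier P.Ω))
    (hε : ε ^ (1 - α) ≤ ϱ / 2) (t : ℝ) (p : Sp N) {Γ : Mat N} (hΓ : IsSelfAdjoint Γ) :
    ContinuousOn (fun b : (Sp N × ℝ) × Sp N =>
      (projClosure P.Ω (b.1.1 + b.2), nextDebt P ε t b.1.1 b.1.2 p Γ b.2))
      ((closure P.Ω ×ˢ univ) ×ˢ closedBall 0 (ε ^ (1 - α))) := by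
  have hadd : ContinuousOn (fun b : (Sp N × ℝ) × Sp N => b.1.1 + b.2)
      ((closure P.Ω ×ˢ univ) ×ˢ closedBall 0 (ε ^ (1 - α))) := by fun_prop
  have hmaps : MapsTo (fun b : (Sp N × ℝ) × Sp N => b.1.1 + b.2)
      ((closure P.Ω ×ˢ univ) ×ˢ closedBall 0 (ε ^ (1 - α)))
      {y | infDist y (closure P.Ω) ≤ ϱ / 2} := fun b hb =>
    (infDist_add_le hb.1.1).trans ((mem_closedBall_zero_iff.1 hb.2).trans hε)
  refine (hΩ.continuousOn_projClosure.comp hadd hmaps).prodMk ?_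
  have h1 := (continuousOn_reflection hΩ hh hhb).comp hadd hmaps
  have h2 : ContinuousOn (fun b : (Sp N × ℝ) × Sp N => P.f t b.1.1 b.1.2 p Γ)
      ((closure P.Ω ×ˢ univ) ×ˢ closedBall 0 (ε ^ (1 - α))) :=
    hf.continuous.comp (f := fun b : (Sp N × ℝ) × Sp N => (t, b.1.1, b.1.2, p, Γ))
      (by fun_prop) fun b hb => ⟨hb.1.1, hΓ⟩
  have h3 : ∀ b : (Sp N × ℝ) × Sp N, nextDebt P ε t b.1.1 b.1.2 p Γ b.2 =
      b.1.2 + ⟪p, b.2⟫_ℝ + 1 / 2 * ⟪Γ b.2, b.2⟫_ℝ + ε ^ 2 * P.f t b.1.1 b.1.2 p Γ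
        - ((fun y => ‖y - projClosure P.Ω y‖ * P.h (projClosure P.Ω y)) ∘
          fun b : (Sp N × ℝ) × Sp N => b.1.1 + b.2) b := by
    intro b
    simp only [nextDebt, Function.comp]
    rw [show b.2 - (projClosure P.Ω (b.1.1 + b.2) - b.1.1) =
      b.1.1 + b.2 - projClosure P.Ω (b.1.1 + b.2) by abel]
  simp only [h3]
  exact ContinuousOn.sub (by fun_prop) h1

/-- Now the infimum over Mark's compact ball is the delicate operation. His move changes the
position, so semicontinuity must be joint in `(x, z)` and the steps short enough for the projection
to be continuous. -/
theorem lowerSemicontinuous_valueU (hΩ : BallDomain P.Ω ϱ) (hf : FHypotheses P q r)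
    (hg : ContinuousOn P.g (closure P.Ω)) (hh : ContinuousOn P.h (frontier P.Ω))
    (hhb : BoundedOn P.h (frontier P.Ω)) (hε : ε ^ (1 - α) ≤ ϱ / 2) (j : ℕ) :
    LowerSemicontinuousOn (fun b : Sp N × ℝ => valueU P α β γ ε j b.1 b.2)
      (closure P.Ω ×ˢ univ) := by
  induction j with
  | zero =>
    have h1 : ContinuousOn (fun b : Sp N × ℝ => P.g b.1) (closure P.Ω ×ˢ univ) :=
      hg.comp continuousOn_fst fun b hb => hb.1
    have : ContinuousOn (fun b : Sp N × ℝ => ((P.g b.1 - b.2 : ℝ) : EReal))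
        (closure P.Ω ×ˢ univ) :=
      continuous_coe_real_ereal.comp_continuousOn (h1.sub continuousOn_snd)
    exact this.lowerSemicontinuousOn
  | succ j ih =>
    have h : (fun b : Sp N × ℝ => valueU P α β γ ε (j + 1) b.1 b.2) = fun b => ⨆ a ∈ moves N β γ ε,
        ⨅ d ∈ closedBall (0 : Sp N) (ε ^ (1 - α)),
          valueU P α β γ ε j (projClosure P.Ω (b.1 + d))
            (nextDebt P ε (P.T - (j + 1) * ε ^ 2) b.1 b.2 a.1 a.2 d) :=
      funext fun b => valueU_succ P α β γ ε j b.1 b.2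
    rw [h]
    refine lowerSemicontinuousOn_biSup fun a ha => ?_
    refine lowerSemicontinuousOn_biInf_of_isCompact (F := fun b : (Sp N × ℝ) × Sp N =>
      valueU P α β γ ε j (projClosure P.Ω (b.1.1 + b.2))
        (nextDebt P ε (P.T - (j + 1) * ε ^ 2) b.1.1 b.1.2 a.1 a.2 b.2))
      (isCompact_closedBall _ _) ?_
    exact ih.comp (continuousOn_step hΩ hf hh hhb hε _ a.1 ha.1)
      fun b _ => ⟨hΩ.projClosure_mem _, mem_univ _⟩

/-- Mark has an optimal answer. -/
theorem exists_move_of_valueU_nonpos (hΩ : BallDomain P.Ω ϱ) (hf : FHypotheses P q r)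
    (hg : ContinuousOn P.g (closure P.Ω)) (hh : ContinuousOn P.h (frontier P.Ω))
    (hhb : BoundedOn P.h (frontier P.Ω)) (hε0 : 0 < ε) (hε : ε ^ (1 - α) ≤ ϱ / 2) {j : ℕ}
    {x : Sp N} (hx : x ∈ closure P.Ω) {z : ℝ} (h : valueU P α β γ ε (j + 1) x z ≤ 0) {p : Sp N}
    {Γ : Mat N} (hΓ : IsSelfAdjoint Γ) (hp : ‖p‖ ≤ ε ^ (-β)) (hΓn : ‖Γ‖ ≤ ε ^ (-γ)) :
    ∃ d : Sp N, ‖d‖ ≤ ε ^ (1 - α) ∧ valueU P α β γ ε j (projClosure P.Ω (x + d))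
      (nextDebt P ε (P.T - (j + 1) * ε ^ 2) x z p Γ d) ≤ 0 := by
  rw [valueU_succ] at h
  have hlsc : LowerSemicontinuousOn (fun d : Sp N =>
      valueU P α β γ ε j (projClosure P.Ω (x + d))
        (nextDebt P ε (P.T - (j + 1) * ε ^ 2) x z p Γ d)) (closedBall 0 (ε ^ (1 - α))) :=
    (lowerSemicontinuous_valueU hΩ hf hg hh hhb hε j).comp
      ((continuousOn_step hΩ hf hh hhb hε (P.T - (j + 1) * ε ^ 2) p hΓ).comp
        (f := fun d : Sp N => ((x, z), d)) (by fun_prop) fun d hd => ⟨⟨hx, mem_univ _⟩, hd⟩)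
      fun b _ => ⟨hΩ.projClosure_mem _, mem_univ _⟩
  obtain ⟨d, hd, hmin⟩ := hlsc.exists_isMinOn ⟨0, by simp; positivity⟩ (isCompact_closedBall _ _)
  refine ⟨d, by simpa using hd, ?_⟩
  have h1 := (le_iSup₂ (f := fun a (_ : a ∈ moves N β γ ε) =>
    ⨅ d ∈ closedBall (0 : Sp N) (ε ^ (1 - α)), valueU P α β γ ε j (projClosure P.Ω (x + d))
        (nextDebt P ε (P.T - (j + 1) * ε ^ 2) x z a.1 a.2 d)) (p, Γ) ⟨hΓ, hp, hΓn⟩).trans h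
  exact (le_iInf₂ fun d' hd' => hmin hd').trans h1

end

/-! ### Consistency of the game with the final-value problem -/

/-- The superlevel sets `A ε j x` of a scheme for the problem `P` are consistent with `P`: they lie
below `g` at the final time, and if `z` belongs to the set at `x` with `j + 1` rounds left while the
sets with `j` rounds left lie near `x` below a paraboloid with value `z + b * ε ^ 2`, gradient `p`
and Hessian `X` at `x`, which is strictly above the Neumann condition, then `f` is at most `b` up to
an error. -/
structure Consistent (P : FinalValueProblem N) (α : ℝ) (A : ℝ → ℕ → Sp N → ℝ → Prop) : Prop where
  terminal : ∀ ε, ∀ x ∈ closure P.Ω, ∀ z, A ε 0 x z → z ≤ P.g x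
  interior : ∀ R δ : ℝ, 0 ≤ R → 0 < δ → ∀ᶠ ε in 𝓝[>] (0 : ℝ), ∀ (j : ℕ), ∀ x ∈ closure P.Ω,
    ∀ (p : Sp N) (X : Mat N) (z b : ℝ), IsSelfAdjoint X → ‖p‖ ≤ R → ‖X‖ ≤ R → |z| ≤ R →
      A ε (j + 1) x z →
      (∀ y ∈ frontier P.Ω, dist y x ≤ 2 * ε ^ (1 - α) →
        P.h y + δ ≤ ⟪p, outwardNormal P.Ω y⟫_ℝ) →
      (∀ w ∈ closure P.Ω, dist w x ≤ 2 * ε ^ (1 - α) → ∀ z', A ε j w z' →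
        z' ≤ z + ⟪p, w - x⟫_ℝ + 1 / 2 * ⟪X (w - x), w - x⟫_ℝ + b * ε ^ 2) →
      P.f (P.T - (j + 1) * ε ^ 2) x z p X ≤ b + δ
  growth : ∀ R δ : ℝ, 0 ≤ R → 0 < δ → ∃ C : ℝ, 0 ≤ C ∧ ∀ᶠ ε in 𝓝[>] (0 : ℝ),
    ∀ (j : ℕ), ∀ x ∈ closure P.Ω,
    ∀ (p : Sp N) (X : Mat N) (z b : ℝ), IsSelfAdjoint X → ‖p‖ ≤ R → ‖X‖ ≤ R →
      A ε (j + 1) x z →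
      (∀ y ∈ frontier P.Ω, dist y x ≤ 2 * ε ^ (1 - α) →
        P.h y + δ ≤ ⟪p, outwardNormal P.Ω y⟫_ℝ) →
      (∀ w ∈ closure P.Ω, dist w x ≤ 2 * ε ^ (1 - α) → ∀ z', A ε j w z' →
        z' ≤ z + ⟪p, w - x⟫_ℝ + 1 / 2 * ⟪X (w - x), w - x⟫_ℝ + b * ε ^ 2) →
      -(C * (1 + |z|)) ≤ b

/-- The final-value problem solved by `-u` when `u` solves `P`. -/
def FinalValueProblem.neg (P : FinalValueProblem N) : FinalValueProblem N where
  Ω := P.Ω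
  T := P.T
  f t x z p Γ := -P.f t x (-z) (-p) (-Γ)
  g x := -P.g x
  h x := -P.h x

section

variable {P : FinalValueProblem N} {α β γ q r ϱ : ℝ}

theorem dist_projClosure_le (hΩ : BallDomain P.Ω ϱ) {x d : Sp N} {s : ℝ} (hx : x ∈ closure P.Ω)
    (hd : ‖d‖ ≤ s) : dist (projClosure P.Ω (x + d)) x ≤ 2 * s := by
  have h1 := hΩ.norm_sub_projClosure_le (x + d) hx
  rw [add_sub_cancel_left] at h1
  have h2 := norm_sub_le_norm_sub_add_norm_sub (projClosure P.Ω (x + d)) (x + d) x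
  rw [add_sub_cancel_left, norm_sub_rev _ (x + d)] at h2
  rw [dist_eq_norm]
  linarith

/-- The reflection off the boundary favours a paraboloid that is strictly above the Neumann
condition. -/
theorem paraboloid_reflection_le (hΩ : BallDomain P.Ω ϱ) {x d p : Sp N} {X : Mat N} {s R δ : ℝ}
    (hx : x ∈ closure P.Ω) (hd : ‖d‖ ≤ s) (hX : ‖X‖ ≤ R) (hs : 5 / 2 * R * s ≤ δ)
    (hp : ∀ y ∈ frontier P.Ω, dist y x ≤ 2 * s → P.h y + δ ≤ ⟪p, outwardNormal P.Ω y⟫_ℝ) :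
    ⟪p, projClosure P.Ω (x + d) - x⟫_ℝ
      + 1 / 2 * ⟪X (projClosure P.Ω (x + d) - x), projClosure P.Ω (x + d) - x⟫_ℝ
      + ‖d - (projClosure P.Ω (x + d) - x)‖ * P.h (projClosure P.Ω (x + d))
      ≤ ⟪p, d⟫_ℝ + 1 / 2 * ⟪X d, d⟫_ℝ := by
  by_cases hc : x + d ∈ closure P.Ω
  · simp [hΩ.projClosure_of_mem hc]
  have hwf := hΩ.projClosure_mem_frontier hc
  have hwx := dist_projClosure_le hΩ hx hd
  have hn := hΩ.sub_projClosure hc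
  have hρ := hΩ.norm_sub_projClosure_le (x + d) hx
  rw [add_sub_cancel_left] at hρ
  set w := projClosure P.Ω (x + d)
  rw [dist_eq_norm] at hwx
  obtain ⟨e, he⟩ : ∃ e, e = d - (w - x) := ⟨_, rfl⟩
  have he' : x + d - w = e := by rw [he]; abel
  have hde : d = (w - x) + e := by rw [he]; abel
  rw [he'] at hn hρ
  have hnn := hΩ.norm_normal w hwf
  have h1 := hp w hwf (by rwa [dist_eq_norm])
  have h2 : ⟪p, e⟫_ℝ = ‖e‖ * ⟪p, outwardNormal P.Ω w⟫_ℝ := by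
    conv_lhs => rw [hn, inner_smul_right]
  have hR : 0 ≤ R := (norm_nonneg _).trans hX
  have hb : ∀ a b : Sp N, -(R * (‖a‖ * ‖b‖)) ≤ ⟪X a, b⟫_ℝ := fun a b => by
    have h3 := (abs_le.1 (abs_real_inner_le_norm (X a) b)).1
    have h4 : ‖X a‖ * ‖b‖ ≤ R * (‖a‖ * ‖b‖) := by
      rw [← mul_assoc]
      gcongr
      exact X.le_of_opNorm_le hX a
    linarith
  have hes : ‖e‖ ≤ s := hρ.trans hd
  -- Since `‖w - x‖ ≤ 2 * s` and `‖e‖ ≤ s`, the quadratic terms involving `e` cost at most `(2 + 2 +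
  -- 1) / 2 * R * s * ‖e‖`, the source of `5 / 2`.
  have b1 := hb (w - x) e
  have b2 := hb e (w - x)
  have b3 := hb e e
  have b4 : R * (‖w - x‖ * ‖e‖) ≤ R * (2 * s * ‖e‖) := by gcongr
  have b5 : R * (‖e‖ * ‖w - x‖) ≤ R * (‖e‖ * (2 * s)) := by gcongr
  have b6 : R * (‖e‖ * ‖e‖) ≤ R * (‖e‖ * s) := by gcongr
  have b7 : 5 / 2 * R * s * ‖e‖ ≤ δ * ‖e‖ := by gcongr
  have b8 : ‖e‖ * (P.h w + δ) ≤ ‖e‖ * ⟪p, outwardNormal P.Ω w⟫_ℝ := by gcongr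
  rw [← he, hde, map_add, inner_add_right, inner_add_left, inner_add_right, inner_add_right, h2]
  linarith

theorem eventually_mul_step_le (hα : α < 1) (K : ℝ) {c : ℝ} (hc : 0 < c) :
    ∀ᶠ ε in 𝓝[>] (0 : ℝ), K * ε ^ (1 - α) ≤ c := by
  filter_upwards [eventually_mul_rpow_le K (show 0 < 1 - α by linarith) hc] with ε h
  rwa [Real.rpow_zero, mul_one] at h

/-- Helen's superlevel sets are consistent with the problem. -/
theorem consistent_nonneg_valueU (hΩ : BallDomain P.Ω ϱ) (hf : FHypotheses P q r)
    (hpar : ExponentHypotheses α β γ q r) :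
    Consistent P α fun ε j x z => 0 ≤ valueU P α β γ ε j x z := by
  obtain ⟨C, hC, hgrow⟩ := hf.controlled_growth
  have hα : α < 1 := by linarith [hpar.α_lt]
  have key : ∀ R δ δ' L : ℝ, 0 ≤ R → 0 < δ → 0 < δ' → ∀ᶠ ε in 𝓝[>] (0 : ℝ),
      ∀ (j : ℕ), ∀ x ∈ closure P.Ω,
      ∀ (p : Sp N) (X : Mat N) (z b : ℝ), IsSelfAdjoint X → ‖p‖ ≤ R → ‖X‖ ≤ R →
      0 ≤ valueU P α β γ ε (j + 1) x z →
      (∀ y ∈ frontier P.Ω, dist y x ≤ 2 * ε ^ (1 - α) →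
        P.h y + δ ≤ ⟪p, outwardNormal P.Ω y⟫_ℝ) →
      (∀ w ∈ closure P.Ω, dist w x ≤ 2 * ε ^ (1 - α) → ∀ z', 0 ≤ valueU P α β γ ε j w z' →
        z' ≤ z + ⟪p, w - x⟫_ℝ + 1 / 2 * ⟪X (w - x), w - x⟫_ℝ + b * ε ^ 2) →
      P.f (P.T - (j + 1) * ε ^ 2) x z p X - δ' * (1 + |z|) ≤ b ∨ L - C * (1 + |z|) ≤ b := by
    intro R δ δ' L hR hδ hδ'
    obtain ⟨C', hC', hlip⟩ := hf.locally_lipschitz (2 * R + 1)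
    filter_upwards [exists_move hpar hf.one_le_q hf.one_le_r L hR hδ' hC.le hC', eventually_le_one,
      eventually_mul_step_le hα (5 / 2 * R) hδ]
      with ε hmove ⟨hε, _⟩ hs j x hx p X z b hXs hp hX hz hbd hpar
    obtain ⟨p', Γ, hΓs, hp', hΓ, hd⟩ := exists_move_of_nonneg_valueU hΩ hf hε hx hz
    obtain ⟨d, hds, hor⟩ := hmove (P.f (P.T - (j + 1) * ε ^ 2) x z) (1 + |z|) (by positivity)
      (hf.monotone _ x hx z) (hlip _ x hx z) (hgrow _ x hx z) p X p' Γ hp hX hXs hΓs hp' hΓ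
    have h1 := hpar _ (hΩ.projClosure_mem _) (dist_projClosure_le hΩ hx hds) _ (hd d hds)
    have h2 := paraboloid_reflection_le hΩ hx hds hX hs hbd
    rw [nextDebt] at h1
    have h3 : ⟪p' - p, d⟫_ℝ + 1 / 2 * ⟪(Γ - X) d, d⟫_ℝ
        + ε ^ 2 * P.f (P.T - (j + 1) * ε ^ 2) x z p' Γ ≤ ε ^ 2 * b := by
      rw [inner_sub_left, sub_apply, inner_sub_left]
      linarith
    have hε2 : 0 < ε ^ 2 := by positivity
    exact hor.imp (fun h => le_of_mul_le_mul_left (h.trans h3) hε2)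
      fun h => le_of_mul_le_mul_left (h.trans h3) hε2
  refine ⟨fun ε x _ z hz => ?_, fun R δ hR hδ => ?_, fun R δ hR hδ => ?_⟩
  · have h1 : (0 : EReal) ≤ ((P.g x - z : ℝ) : EReal) := hz
    have h2 : (0 : ℝ) ≤ P.g x - z := by exact_mod_cast h1
    linarith
  · obtain ⟨C₁, hC₁, hlin⟩ := hf.linear_growth R
    -- This `L` is so large that, for `|z| ≤ R`, the second alternative also implies the bound on
    -- `f`; the error `δ / (1 + R)` gets multiplied by `1 + |z|`.
    filter_upwards [key R δ (δ / (1 + R)) ((C + C₁) * (1 + R)) hR hδ (by positivity)]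
      with ε h j x hx p X z b hXs hp hX hzR hz hbd hpar
    have hpX : ‖(p, X)‖ ≤ R := by
      rw [Prod.norm_mk]
      exact max_le hp hX
    rcases h j x hx p X z b hXs hp hX hz hbd hpar with h | h
    · have : δ / (1 + R) * (1 + |z|) ≤ δ := by
        calc δ / (1 + R) * (1 + |z|) ≤ δ / (1 + R) * (1 + R) := by gcongr
          _ = δ := by field_simp
      linarith
    · have h1 := (abs_le.1 (hlin (P.T - (j + 1) * ε ^ 2) x hx z p X hXs hpX)).2
      have h2 : (C + C₁) * (1 + |z|) ≤ (C + C₁) * (1 + R) := by gcongr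
      linarith
  · obtain ⟨C₁, hC₁, hlin⟩ := hf.linear_growth R
    refine ⟨C₁ + C + 1, by positivity, ?_⟩
    filter_upwards [key R δ 1 0 hR hδ one_pos] with ε h j x hx p X z b hXs hp hX hz hbd hpar
    have hpX : ‖(p, X)‖ ≤ R := by
      rw [Prod.norm_mk]
      exact max_le hp hX
    have hz0 : 0 ≤ 1 + |z| := by positivity
    have h3 := mul_nonneg hC.le hz0
    have h4 := mul_nonneg hC₁ hz0
    rcases h j x hx p X z b hXs hp hX hz hbd hpar with h | h
    · have h1 := (abs_le.1 (hlin (P.T - (j + 1) * ε ^ 2) x hx z p X hXs hpX)).1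
      linarith
    · linarith

theorem eventually_le_rpow_neg {b : ℝ} (hb : 0 < b) (R : ℝ) :
    ∀ᶠ ε in 𝓝[>] (0 : ℝ), R ≤ ε ^ (-b) := by
  filter_upwards [eventually_mul_rpow_le R hb one_pos, eventually_le_one] with ε h ⟨hε, _⟩
  rw [Real.rpow_zero, mul_one] at h
  rw [Real.rpow_neg hε.le, ← one_div, le_div_iff₀ (Real.rpow_pos_of_pos hε _)]
  exact h

/-- The reflected sublevel sets are consistent with the reflected problem. -/
theorem consistent_valueU_nonpos (hΩ : BallDomain P.Ω ϱ) (hf : FHypotheses P q r)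
    (hg : ContinuousOn P.g (closure P.Ω)) (hh : ContinuousOn P.h (frontier P.Ω))
    (hhb : BoundedOn P.h (frontier P.Ω)) (hpar : ExponentHypotheses α β γ q r) :
    Consistent P.neg α fun ε j x z => valueU P α β γ ε j x (-z) ≤ 0 := by
  have hα : α < 1 := by linarith [hpar.α_lt]
  have key : ∀ R δ : ℝ, 0 ≤ R → 0 < δ → ∀ᶠ ε in 𝓝[>] (0 : ℝ),
      ∀ (j : ℕ), ∀ x ∈ closure P.Ω,
      ∀ (p : Sp N) (X : Mat N) (z b : ℝ), IsSelfAdjoint X → ‖p‖ ≤ R → ‖X‖ ≤ R →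
      valueU P α β γ ε (j + 1) x (-z) ≤ 0 →
      (∀ y ∈ frontier P.Ω, dist y x ≤ 2 * ε ^ (1 - α) →
        -P.h y + δ ≤ ⟪p, outwardNormal P.Ω y⟫_ℝ) →
      (∀ w ∈ closure P.Ω, dist w x ≤ 2 * ε ^ (1 - α) → ∀ z', valueU P α β γ ε j w (-z') ≤ 0 →
        z' ≤ z + ⟪p, w - x⟫_ℝ + 1 / 2 * ⟪X (w - x), w - x⟫_ℝ + b * ε ^ 2) →
      -P.f (P.T - (j + 1) * ε ^ 2) x (-z) (-p) (-X) ≤ b := by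
    intro R δ hR hδ
    filter_upwards [eventually_le_one, eventually_mul_step_le hα (5 / 2 * R) hδ,
      eventually_mul_step_le hα 1 (half_pos hΩ.pos), eventually_le_rpow_neg hpar.β_pos R,
      eventually_le_rpow_neg hpar.γ_pos R]
      with ε ⟨hε, _⟩ hs hs' hβ hγ j x hx p X z b hXs hp hX hz hbd hpar
    rw [one_mul] at hs'
    -- Helen may play exactly `(-p, -X)`, admissible for small `ε`; Mark's optimal answer then
    -- yields the inequality without any case distinction.
    obtain ⟨d, hds, hd⟩ := exists_move_of_valueU_nonpos hΩ hf hg hh hhb hε hs' hx hz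
      (p := -p) (isSelfAdjoint_neg hXs) (by rw [norm_neg]; exact hp.trans hβ)
      (by rw [norm_neg]; exact hX.trans hγ)
    rw [← neg_neg (nextDebt _ _ _ _ _ _ _ _)] at hd
    have h1 := hpar _ (hΩ.projClosure_mem _) (dist_projClosure_le hΩ hx hds) _ hd
    have h2 := paraboloid_reflection_le (P := P.neg) hΩ hx hds hX hs hbd
    have h3 : P.neg.h (projClosure P.neg.Ω (x + d)) = -P.h (projClosure P.Ω (x + d)) := rfl
    have h4 : P.neg.Ω = P.Ω := rfl
    rw [h3, h4] at h2
    rw [nextDebt, inner_neg_left, neg_apply, inner_neg_left] at h1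
    refine le_of_mul_le_mul_left ?_ (show 0 < ε ^ 2 by positivity)
    linarith
  refine ⟨fun ε x _ z hz => ?_, fun R δ hR hδ => ?_, fun R δ hR hδ => ?_⟩
  · have h1 : ((P.g x - -z : ℝ) : EReal) ≤ 0 := hz
    have h2 : P.g x - -z ≤ (0 : ℝ) := by exact_mod_cast h1
    change z ≤ -P.g x
    linarith
  · filter_upwards [key R δ hR hδ] with ε h j x hx p X z b hXs hp hX _ hz hbd hpar
    have := h j x hx p X z b hXs hp hX hz hbd hpar
    change -P.f (P.T - (j + 1) * ε ^ 2) x (-z) (-p) (-X) ≤ _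
    linarith
  · obtain ⟨C₁, hC₁, hlin⟩ := hf.linear_growth R
    refine ⟨C₁, hC₁, ?_⟩
    filter_upwards [key R δ hR hδ] with ε h j x hx p X z b hXs hp hX hz hbd hpar
    have hpX : ‖(-p, -X)‖ ≤ R := by
      rw [Prod.norm_mk, norm_neg, norm_neg]
      exact max_le hp hX
    have h1 := (abs_le.1 (hlin (P.T - (j + 1) * ε ^ 2) x hx (-z) (-p) (-X)
      (isSelfAdjoint_neg hXs) hpX)).2
    rw [abs_neg] at h1
    have h2 := h j x hx p X z b hXs hp hX hz hbd hpar
    linarith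

end

/-! ### Relaxed limits -/

theorem eventually_approach_iff {P : FinalValueProblem N} {x : Sp N} {t : ℝ}
    {p : ℝ × Sp N × ℕ → Prop} :
    (∀ᶠ a in approach P x t, p a) ↔ ∃ η > 0, ∀ ε, 0 < ε → ε < η → ∀ y ∈ closure P.Ω, dist y x < η →
      ∀ j : ℕ, |P.T - j * ε ^ 2 - t| < η → p (ε, y, j) := by
  have hb := (((nhdsGT_basis (0 : ℝ)).prod ((nhdsWithin_basis_ball (x := x)
    (s := closure P.Ω)).prod (hasBasis_top (α := ℕ)))).inf
    ((nhds_basis_ball (x := t)).comap (fun a : ℝ × Sp N × ℕ => P.T - a.2.2 * a.1 ^ 2)))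
  have hb' := hb.eventually_iff (q := p)
  rw [approach, hb']
  constructor
  · rintro ⟨⟨⟨a, b, u⟩, c⟩, ⟨⟨ha, hb, hu⟩, hc⟩, h⟩
    refine ⟨min a (min b c), lt_min ha (lt_min hb hc), fun ε hε hεη y hy hyx j hj => ?_⟩
    simp only [lt_min_iff] at hεη hyx hj
    refine h ⟨⟨⟨hε, hεη.1⟩, ⟨hyx.2.1, hy⟩, mem_univ _⟩, ?_⟩
    rw [mem_preimage, mem_ball, Real.dist_eq]
    exact hj.2.2
  · rintro ⟨η, hη, h⟩
    refine ⟨⟨⟨η, η, ()⟩, η⟩, ⟨⟨hη, hη, trivial⟩, hη⟩, ?_⟩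
    rintro ⟨ε, y, j⟩ ⟨⟨⟨h1, h2⟩, ⟨h3, h4⟩, -⟩, h5⟩
    rw [mem_preimage, mem_ball, Real.dist_eq] at h5
    exact h ε h1 h2 y h4 h3 j h5

/-- The grid time with `j = ⌊(T - t) / ε ^ 2⌋` is within `ε ^ 2` of `t`. Nontriviality is what
allows the comparison of liminf and limsup. -/
theorem approach_neBot {P : FinalValueProblem N} {x : Sp N} {t : ℝ} (hx : x ∈ closure P.Ω)
    (ht : t ≤ P.T) : (approach P x t).NeBot := by
  rw [neBot_iff]
  intro hbot
  have h : ∀ᶠ _ in approach P x t, False := by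
    rw [hbot]
    exact eventually_bot
  obtain ⟨η, hη, h⟩ := eventually_approach_iff.1 h
  set ε := min (η / 2) (1 / 2) with hεdef
  have hε : 0 < ε := by positivity
  have hε1 : ε ≤ 1 / 2 := min_le_right _ _
  have hε2 : ε ≤ η / 2 := min_le_left _ _
  have hsq : ε ^ 2 < η := by nlinarith
  have hs0 : 0 < ε ^ 2 := by positivity
  refine h ε hε (by linarith) x hx (by simpa using hη) ⌊(P.T - t) / ε ^ 2⌋₊ ?_
  have h1 := Nat.floor_le (show 0 ≤ (P.T - t) / ε ^ 2 from div_nonneg (by linarith) hs0.le)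
  have h2 := Nat.lt_floor_add_one ((P.T - t) / ε ^ 2)
  rw [le_div_iff₀ hs0] at h1
  rw [div_lt_iff₀ hs0] at h2
  rw [abs_lt]
  constructor <;> nlinarith

theorem eventually_approach_fst {P : FinalValueProblem N} {x : Sp N} {t : ℝ} {p : ℝ → Prop}
    (h : ∀ᶠ ε in 𝓝[>] (0 : ℝ), p ε) : ∀ᶠ a in approach P x t, p a.1 :=
  (tendsto_fst.mono_left inf_le_left).eventually h

theorem eventually_approach_snd {P : FinalValueProblem N} {x : Sp N} {t : ℝ}
    {p : Sp N × ℝ → Prop} (h : ∀ᶠ b in 𝓝 (x, t), p b) : ∀ᶠ a in approach P x t,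
      a.2.1 ∈ closure P.Ω ∧ p (a.2.1, P.T - a.2.2 * a.1 ^ 2) := by
  obtain ⟨η, hη, hb⟩ := Metric.eventually_nhds_iff.1 h
  refine eventually_approach_iff.2 ⟨η, hη, fun ε _ _ y hy hyx j hj => ⟨hy, hb ?_⟩⟩
  rw [Prod.dist_eq]
  exact max_lt hyx (by rwa [Real.dist_eq])

/-- The upper relaxed semi-limit of a family of functions. -/
def upperLimit (P : FinalValueProblem N) (W : ℝ → ℕ → Sp N → EReal) (x : Sp N) (t : ℝ) : EReal :=
  limsup (fun a : ℝ × Sp N × ℕ => W a.1 a.2.2 a.2.1) (approach P x t)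

/-- The supremum of a level set. -/
def levelSup (A : ℝ → ℕ → Sp N → ℝ → Prop) (ε : ℝ) (j : ℕ) (x : Sp N) : EReal :=
  ⨆ (z : ℝ) (_ : A ε j x z), (z : EReal)

theorem le_levelSup {A : ℝ → ℕ → Sp N → ℝ → Prop} {ε : ℝ} {j : ℕ} {x : Sp N} {z : ℝ}
    (h : A ε j x z) : (z : EReal) ≤ levelSup A ε j x :=
  le_iSup₂ (f := fun (z : ℝ) (_ : A ε j x z) => (z : EReal)) z h

theorem levelSup_le {A : ℝ → ℕ → Sp N → ℝ → Prop} {ε : ℝ} {j : ℕ} {x : Sp N} {y : ℝ}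
    (h : ∀ z, A ε j x z → z ≤ y) : levelSup A ε j x ≤ y :=
  iSup₂_le fun z hz => EReal.coe_le_coe_iff.2 (h z hz)

section

variable {P : FinalValueProblem N} {W : ℝ → ℕ → Sp N → EReal}

theorem eventually_of_upperLimit_lt {x : Sp N} {t : ℝ} {y : EReal} (h : upperLimit P W x t < y) :
    ∃ η > 0, ∀ ε, 0 < ε → ε < η → ∀ x' ∈ closure P.Ω, dist x' x < η →
      ∀ j : ℕ, |P.T - j * ε ^ 2 - t| < η → W ε j x' < y :=
  eventually_approach_iff.1 (eventually_lt_of_limsup_lt h)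

theorem upperLimit_le {x : Sp N} {t : ℝ} {y : EReal}
    (h : ∀ᶠ a in approach P x t, W a.1 a.2.2 a.2.1 ≤ y) : upperLimit P W x t ≤ y :=
  limsup_le_of_le (by isBoundedDefault) h

theorem upperSemicontinuous_upperLimit :
    UpperSemicontinuous fun a : Sp N × ℝ => upperLimit P W a.1 a.2 := by
  intro a y hy
  obtain ⟨y', h1, h2⟩ := exists_between hy
  obtain ⟨η, hη, h⟩ := eventually_of_upperLimit_lt h1
  filter_upwards [ball_mem_nhds a (half_pos hη)] with b hb
  rw [mem_ball, Prod.dist_eq, max_lt_iff, Real.dist_eq] at hb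
  refine lt_of_le_of_lt (upperLimit_le ?_) h2
  refine eventually_approach_iff.2 ⟨η / 2, half_pos hη, fun ε hε hεη x hx hxb j hj => ?_⟩
  refine (h ε hε (by linarith) x hx ?_ j ?_).le
  · have := dist_triangle x b.1 a.1
    linarith
  · have := abs_sub_le (P.T - j * ε ^ 2) b.2 a.2
    linarith

theorem upperSemicontinuousOn_toReal_upperLimit {S : Set (Sp N × ℝ)} {C : ℝ}
    (hC : ∀ a ∈ S, ((-C : ℝ) : EReal) ≤ upperLimit P W a.1 a.2 ∧
      upperLimit P W a.1 a.2 ≤ (C : EReal)) :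
    UpperSemicontinuousOn (fun a => (upperLimit P W a.1 a.2).toReal) S := by
  have hcoe : ∀ a ∈ S, (((upperLimit P W a.1 a.2).toReal : ℝ) : EReal) = upperLimit P W a.1 a.2 :=
    fun a ha => EReal.coe_toReal (ne_top_of_le_ne_top (EReal.coe_ne_top _) (hC a ha).2)
      (ne_bot_of_le_ne_bot (EReal.coe_ne_bot _) (hC a ha).1)
  intro a ha y hy
  have h1 : upperLimit P W a.1 a.2 < (y : EReal) := by
    rw [← hcoe a ha]
    exact EReal.coe_lt_coe_iff.2 hy
  have h2 := upperSemicontinuous_upperLimit a _ h1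
  filter_upwards [nhdsWithin_le_nhds h2, self_mem_nhdsWithin] with b hb hbS
  rw [← hcoe b hbS] at hb
  exact EReal.coe_lt_coe_iff.1 hb

/-- The relaxed limit controls the approximations uniformly on compact sets. -/
theorem eventually_lt_of_isCompact {K D : Set (Sp N × ℝ)} (hK : IsCompact K) (hKD : K ⊆ D)
    {Φ : Sp N × ℝ → ℝ} (hΦ : LowerSemicontinuousOn Φ D)
    (h : ∀ a ∈ K, upperLimit P W a.1 a.2 < (Φ a : EReal)) :
    ∃ η > 0, ∀ ε, 0 < ε → ε < η → ∀ a ∈ K, ∀ x ∈ closure P.Ω, dist x a.1 < η → ∀ j : ℕ,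
      |P.T - j * ε ^ 2 - a.2| < η → (x, P.T - j * ε ^ 2) ∈ D →
      W ε j x < (Φ (x, P.T - j * ε ^ 2) : EReal) := by
  refine hK.induction_on (p := fun S => ∃ η > 0, ∀ ε, 0 < ε → ε < η → ∀ a ∈ S,
    ∀ x ∈ closure P.Ω, dist x a.1 < η → ∀ j : ℕ, |P.T - j * ε ^ 2 - a.2| < η →
      (x, P.T - j * ε ^ 2) ∈ D → W ε j x < (Φ (x, P.T - j * ε ^ 2) : EReal)) ?_ ?_ ?_ ?_
  · exact ⟨1, one_pos, fun _ _ _ _ ha => absurd ha (notMem_empty _)⟩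
  · rintro S S' hSS' ⟨η, hη, h'⟩
    exact ⟨η, hη, fun ε h1 h2 a ha => h' ε h1 h2 a (hSS' ha)⟩
  · rintro S S' ⟨η, hη, h1⟩ ⟨η', hη', h2⟩
    refine ⟨min η η', lt_min hη hη', fun ε hε hεη a ha x hx hxa j hj hD => ?_⟩
    rw [lt_min_iff] at hεη hxa hj
    rcases ha with ha | ha
    · exact h1 ε hε hεη.1 a ha x hx hxa.1 j hj.1 hD
    · exact h2 ε hε hεη.2 a ha x hx hxa.2 j hj.2 hD
  · intro a ha
    obtain ⟨y, hy1, hy2⟩ := EReal.exists_between_coe_real (h a ha)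
    obtain ⟨η, hη, hW⟩ := eventually_of_upperLimit_lt hy1
    have hΦa := hΦ a (hKD ha) y (EReal.coe_lt_coe_iff.1 hy2)
    obtain ⟨η', hη', hb⟩ := Metric.mem_nhdsWithin_iff.1 hΦa
    have hmin : 0 < min η η' := lt_min hη hη'
    refine ⟨ball a (min η η' / 2), mem_nhdsWithin_of_mem_nhds (ball_mem_nhds a (half_pos hmin)),
      min η η' / 2, half_pos hmin, fun ε hε hεη b hb' x hx hxb j hj hD => ?_⟩
    rw [mem_ball, Prod.dist_eq, max_lt_iff, Real.dist_eq] at hb'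
    have h1 : dist x a.1 < min η η' := by
      have := dist_triangle x b.1 a.1
      linarith
    have h2 : |P.T - j * ε ^ 2 - a.2| < min η η' := by
      have := abs_sub_le (P.T - j * ε ^ 2) b.2 a.2
      linarith
    have h3 : ε < min η η' := by linarith
    rw [lt_min_iff] at h1 h2 h3
    refine (hW ε hε h3.1 x hx h1.1 j h2.1).trans (EReal.coe_lt_coe_iff.2 ?_)
    refine hb ⟨?_, hD⟩
    rw [mem_ball, Prod.dist_eq, Real.dist_eq]
    exact max_lt h1.2 h2.2

end

/-! ### Consequences of consistency -/

theorem norm_smul_one_le {c : ℝ} (hc : 0 ≤ c) : ‖c • (1 : Mat N)‖ ≤ c := by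
  simpa using norm_add_smul_one_le (N := N) (X := 0) (R := 0) (by simp) hc

theorem isSelfAdjoint_smul_one (c : ℝ) : IsSelfAdjoint (c • (1 : Mat N)) := by
  simpa using isSelfAdjoint_add_smul_one (N := N) isSelfAdjoint_zero c

theorem inner_smul_one_apply (c : ℝ) (v : Sp N) : ⟪(c • (1 : Mat N)) v, v⟫_ℝ = c * ‖v‖ ^ 2 := by
  rw [smul_apply, one_apply_eq_self, inner_smul_left, real_inner_self_eq_norm_sq]
  simp

namespace Consistent

variable {P : FinalValueProblem N} {α ϱ : ℝ} {A : ℝ → ℕ → Sp N → ℝ → Prop}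

/-- The scheme is bounded above, uniformly on bounded time intervals. -/
theorem exists_upper_bound (hA : Consistent P α A) (hα : α < 1) (hΩ : BallDomain P.Ω ϱ)
    (hg : BoundedOn P.g (closure P.Ω)) (hh : BoundedOn P.h (frontier P.Ω)) (τ : ℝ) :
    ∃ C : ℝ, ∀ᶠ ε in 𝓝[>] (0 : ℝ), ∀ (j : ℕ), ∀ x ∈ closure P.Ω, ∀ z,
      τ ≤ P.T - j * ε ^ 2 → A ε j x z → z ≤ C := by
  obtain ⟨G, hG⟩ := hg
  obtain ⟨H, hH⟩ := hh
  -- The slope exceeds `h` by 1, the strictness at which `growth` is applied next.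
  obtain ⟨B, η, hB, hη, ψ, hψ, hq⟩ := hΩ.exists_boundary_barrier (|H| + 1) (by positivity)
  obtain ⟨C, hC, hgrow⟩ := hA.growth B 1 hB one_pos
  -- The induction bound is `D * exp (2 * j * s) - (1 + B) + ψ`. The shift `1 + B` absorbs the error
  -- `s * (1 + ψ)` left by the factor `1 + |z|`, because `ψ ≤ B`.
  set D := |G| + (1 + B) with hD
  have hD0 : 0 < D := by positivity
  refine ⟨D * Real.exp (2 * C * (P.T - τ)) - (1 + B) + B, ?_⟩
  have hsq : ∀ᶠ ε in 𝓝[>] (0 : ℝ), C * ε ^ 2 ≤ 1 / 2 := by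
    filter_upwards [eventually_mul_rpow_le C (show (0 : ℝ) < 2 by norm_num) one_half_pos] with ε h
    simpa using h
  filter_upwards [hgrow, hsq, eventually_mul_step_le hα 2 hη, self_mem_nhdsWithin]
    with ε hgrow hsmall hstep hε
  have hε0 : 0 < ε ^ 2 := by
    have : 0 < ε := hε
    positivity
  set s := C * ε ^ 2 with hs
  have hs0 : 0 ≤ s := by positivity
  have key : ∀ (j : ℕ), ∀ x ∈ closure P.Ω, ∀ z, A ε j x z →
      z ≤ D * Real.exp (2 * (j * s)) - (1 + B) + ψ x := by
    intro j
    induction j with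
    | zero =>
      intro x hx z hz
      have h1 := hA.terminal ε x hx z hz
      have h2 := (le_abs_self _).trans (hG x hx)
      have h3 := le_abs_self G
      have h4 := (hψ x).1
      simp only [Nat.cast_zero, zero_mul, mul_zero, Real.exp_zero, mul_one]
      linarith
    | succ j ih =>
      intro x hx z hz
      by_contra hlt
      push Not at hlt
      obtain ⟨q, hqn, hqψ, hqb⟩ := hq x hx
      set E := D * Real.exp (2 * (j * s)) with hE
      have hED : D ≤ E := le_mul_of_one_le_right hD0.le (Real.one_le_exp (by positivity))
      -- Discrete Gronwall: `(1 + 2 * s) * (1 - s) ≥ 1` for `0 ≤ s ≤ 1 / 2`, hence the rate 2 in the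
      -- exponential.
      have hE' : E ≤ D * Real.exp (2 * (((j + 1 : ℕ) : ℝ) * s)) * (1 - s) := by
        have h1 : Real.exp (2 * (((j + 1 : ℕ) : ℝ) * s)) =
            Real.exp (2 * (j * s)) * Real.exp (2 * s) := by
          rw [← Real.exp_add]
          push_cast
          ring_nf
        have h2 := Real.add_one_le_exp (2 * s)
        have h3 : 1 ≤ Real.exp (2 * s) * (1 - s) := by
          have h4 : (2 * s + 1) * (1 - s) ≤ Real.exp (2 * s) * (1 - s) := by
            gcongr
            linarith
          nlinarith
        calc E ≤ E * (Real.exp (2 * s) * (1 - s)) :=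
              le_mul_of_one_le_right (hD0.le.trans hED) h3
          _ = _ := by rw [h1, hE]; ring
      set E' := D * Real.exp (2 * (((j + 1 : ℕ) : ℝ) * s))
      have hψx := hψ x
      have hEE' : E ≤ E' := by
        have : 0 ≤ E' := by positivity
        nlinarith
      have hG0 := abs_nonneg G
      have hz0 : 0 ≤ z := by linarith
      have h := hgrow j x hx q (B • 1) z ((E - (1 + B) + ψ x - z) / ε ^ 2)
        (isSelfAdjoint_smul_one B) hqn (norm_smul_one_le hB) hz
        (fun y hy hyx => ?_) (fun w hw hwx z' hz' => ?_)
      · rw [abs_of_nonneg hz0, le_div_iff₀ hε0] at h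
        have h1 : -(s * (1 + z)) ≤ E - (1 + B) + ψ x - z := by
          rw [hs]
          linarith
        have h2 : (E' - (1 + B) + ψ x) * (1 - s) < z * (1 - s) := by
          gcongr
          linarith
        nlinarith
      · have h1 := hqb y hy (hyx.trans hstep)
        have h2 := (le_abs_self _).trans ((hH y hy).trans (le_abs_self H))
        linarith
      · have h1 := ih w hw z' hz'
        have h2 := hqψ w
        rw [inner_smul_one_apply, div_mul_cancel₀ _ hε0.ne']
        linarith
  intro j x hx z hτ hz
  have h1 := key j x hx z hz
  have h2 : Real.exp (2 * (j * s)) ≤ Real.exp (2 * C * (P.T - τ)) := by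
    apply Real.exp_le_exp.2
    have : C * (j * ε ^ 2) ≤ C * (P.T - τ) := by
      gcongr
      linarith
    rw [hs]
    linarith
  have h3 : D * Real.exp (2 * (j * s)) ≤ D * Real.exp (2 * C * (P.T - τ)) := by gcongr
  linarith [(hψ x).2]

theorem paraboloid_shift {X : Mat N} (hX : IsSelfAdjoint X) (p v u : Sp N) :
    ⟪p, v + u⟫_ℝ + 1 / 2 * ⟪X (v + u), v + u⟫_ℝ =
      ⟪p, v⟫_ℝ + 1 / 2 * ⟪X v, v⟫_ℝ + ⟪p + X v, u⟫_ℝ + 1 / 2 * ⟪X u, u⟫_ℝ := by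
  rw [ContinuousLinearMap.isSelfAdjoint_iff_isSymmetric] at hX
  have h1 : ⟪X u, v⟫_ℝ = ⟪X v, u⟫_ℝ := by
    rw [real_inner_comm]
    exact (hX v u).symm
  simp only [map_add, inner_add_left, inner_add_right, h1]
  ring

/-- The scheme attains the final value. -/
theorem upperLimit_final_le (hA : Consistent P α A) (hα : α < 1) (hΩ : BallDomain P.Ω ϱ)
    (hg : ContinuousOn P.g (closure P.Ω)) (hgb : BoundedOn P.g (closure P.Ω))
    (hh : BoundedOn P.h (frontier P.Ω)) {x₀ : Sp N} (hx₀ : x₀ ∈ closure P.Ω) :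
    upperLimit P (levelSup A) x₀ P.T ≤ (P.g x₀ : EReal) := by
  refine EReal.le_of_forall_lt_iff_le.1 fun y hy => ?_
  rw [EReal.coe_lt_coe_iff] at hy
  obtain ⟨η, hη, rfl⟩ : ∃ η > 0, y = P.g x₀ + η := ⟨y - P.g x₀, by linarith, by ring⟩
  obtain ⟨Z₀, hZ₀⟩ := hA.exists_upper_bound hα hΩ hgb hh (P.T - 1)
  obtain ⟨H, hH⟩ := hh
  obtain ⟨n, hn, η₁, hη₁, hnb⟩ := hΩ.exists_outward_direction x₀
  have hϱ := hΩ.pos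
  obtain ⟨Z, hZ0, hZ1, hZ2⟩ : ∃ Z : ℝ, 0 < Z ∧ Z₀ ≤ Z + P.g x₀ ∧ |P.g x₀| ≤ Z ∧ Z₀ ≤ Z := by
    refine ⟨|Z₀| + |P.g x₀| + 1, by positivity, ?_, ?_, ?_⟩ <;>
      linarith [abs_nonneg Z₀, abs_nonneg (P.g x₀), le_abs_self Z₀, neg_abs_le (P.g x₀)]
  -- The tilt `c • n` must beat `h` along the boundary. Although `K = 8 * Z / ρ ^ 2` blows up as `ρ`
  -- shrinks, `inner_le` gives `K * ⟪x₀ - y, n(y)⟫ ≤ K * (2 * ρ) ^ 2 / (2 * ϱ) = 16 * Z / ϱ`; so `c`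
  -- can be fixed before `ρ`.
  obtain ⟨c, hc, hc'⟩ : ∃ c : ℝ, 0 ≤ c ∧ |H| + 2 + 16 * Z / ϱ ≤ c / 2 :=
    ⟨2 * (|H| + 2 + 16 * Z / ϱ), by positivity, by linarith⟩
  obtain ⟨ρ, hρ, hρ1, hρ2, hρ3⟩ : ∃ ρ > 0, c * ρ ≤ η / 4 ∧ 2 * ρ ≤ η₁ ∧
      ∀ x ∈ closure P.Ω, dist x x₀ ≤ ρ → P.g x ≤ P.g x₀ + η / 4 := by
    obtain ⟨ρ', hρ', h⟩ := Metric.continuousWithinAt_iff.1 (hg x₀ hx₀) (η / 4) (by positivity)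
    refine ⟨min (ρ' / 2) (min (η₁ / 2) (η / 4 / (c + 1))), by positivity, ?_, ?_, ?_⟩
    · calc c * min (ρ' / 2) (min (η₁ / 2) (η / 4 / (c + 1))) ≤ (c + 1) * (η / 4 / (c + 1)) := by
            gcongr
            · linarith
            · exact (min_le_right _ _).trans (min_le_right _ _)
        _ = η / 4 := by field_simp
    · have : min (ρ' / 2) (min (η₁ / 2) (η / 4 / (c + 1))) ≤ η₁ / 2 :=
        (min_le_right _ _).trans (min_le_left _ _)
      linarith
    · intro x hx hxd
      have h1 : dist x x₀ < ρ' := hxd.trans_lt ((min_le_left _ _).trans_lt (by linarith))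
      have h2 := h hx h1
      rw [Real.dist_eq] at h2
      linarith [(abs_lt.1 h2).2]
  -- At distance `ρ / 2` the quadratic term equals `Z`, so beyond it the a priori bound already
  -- suffices. Closer in, one step stays within `ρ` and the induction applies.
  set K := 8 * Z / ρ ^ 2 with hK
  have hK0 : 0 ≤ K := by positivity
  have hKρ : K * ρ ^ 2 = 8 * Z := by rw [hK]; field_simp
  obtain ⟨C, hC, hgrow⟩ := hA.growth (c + K * (ρ + 1)) 1 (by positivity) one_pos
  set L := C * (1 + Z) with hL
  have hL0 : 0 ≤ L := by positivity
  have hXs := isSelfAdjoint_smul_one (N := N) K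
  have hmain : ∀ᶠ ε in 𝓝[>] (0 : ℝ), ∀ (j : ℕ), (j : ℝ) * ε ^ 2 ≤ 1 → ∀ x ∈ closure P.Ω,
      dist x x₀ ≤ ρ → ∀ z, A ε j x z → z ≤ P.g x₀ + η / 2
        + (⟪c • n, x - x₀⟫_ℝ + 1 / 2 * ⟪(K • (1 : Mat N)) (x - x₀), x - x₀⟫_ℝ)
        + L * (j * ε ^ 2) := by
    filter_upwards [hgrow, hZ₀, eventually_mul_step_le hα 2 (half_pos hρ),
      eventually_mul_step_le hα (2 * K) one_pos, self_mem_nhdsWithin]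
      with ε hgrow hZ₀ hstep hstep' hε j
    have hε' : 0 < ε := hε
    have hε0 : 0 < ε ^ 2 := by positivity
    have hcn : ∀ x, dist x x₀ ≤ ρ → -(η / 4) ≤ ⟪c • n, x - x₀⟫_ℝ := fun x hx => by
      rw [inner_smul_left]
      simp only [conj_trivial]
      have h1 := (abs_le.1 (abs_real_inner_le_norm n (x - x₀))).1
      rw [dist_eq_norm] at hx
      have h2 : ‖n‖ * ‖x - x₀‖ ≤ 1 * ρ := by gcongr
      have h3 : c * -ρ ≤ c * ⟪n, x - x₀⟫_ℝ := by
        gcongr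
        linarith
      linarith
    induction j with
    | zero =>
      intro _ x hx hxd z hz
      have h1 := hA.terminal ε x hx z hz
      have h2 := hρ3 x hx hxd
      have h3 := hcn x hxd
      rw [inner_smul_one_apply]
      have h4 : 0 ≤ 1 / 2 * (K * ‖x - x₀‖ ^ 2) := by positivity
      simp only [Nat.cast_zero, zero_mul, mul_zero]
      linarith
    | succ j ih =>
      intro hj x hx hxd z hz
      have hcx := hcn x hxd
      have hLj : 0 ≤ L * (((j + 1 : ℕ) : ℝ) * ε ^ 2) := by positivity
      have hZx : z ≤ Z₀ := hZ₀ (j + 1) x hx z (by linarith) hz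
      by_contra hlt
      push Not at hlt
      rw [inner_smul_one_apply] at hlt
      rcases le_or_gt (ρ / 2) (dist x x₀) with hfar | hnear
      · rw [dist_eq_norm] at hfar
        have h1 : K * (ρ / 2) ^ 2 ≤ K * ‖x - x₀‖ ^ 2 := by gcongr
        linarith
      · have hquad : 0 ≤ 1 / 2 * (K * ‖x - x₀‖ ^ 2) := by positivity
        have hzabs : |z| ≤ Z := by
          rw [abs_le]
          constructor
          · linarith [neg_abs_le (P.g x₀)]
          · linarith
        have hxd' := hxd
        rw [dist_eq_norm] at hxd'
        have hnorm : ‖c • n + (K • (1 : Mat N)) (x - x₀)‖ ≤ c + K * (ρ + 1) := by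
          refine (norm_add_le _ _).trans ?_
          rw [norm_smul, Real.norm_of_nonneg hc, smul_apply, one_apply_eq_self, norm_smul,
            Real.norm_of_nonneg hK0]
          have h1 : c * ‖n‖ ≤ c * 1 := by gcongr
          have h2 : K * ‖x - x₀‖ ≤ K * (ρ + 1) := by
            gcongr
            linarith
          linarith
        have hKK : K ≤ c + K * (ρ + 1) := by nlinarith
        have h := hgrow j x hx (c • n + (K • (1 : Mat N)) (x - x₀)) (K • 1) z
          ((P.g x₀ + η / 2 + (⟪c • n, x - x₀⟫_ℝ
            + 1 / 2 * ⟪(K • (1 : Mat N)) (x - x₀), x - x₀⟫_ℝ) + L * (j * ε ^ 2) - z) / ε ^ 2)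
          hXs hnorm ((norm_smul_one_le hK0).trans hKK) hz
          (fun y hy hyx => ?_) (fun w hw hwx z' hz' => ?_)
        · rw [le_div_iff₀ hε0, inner_smul_one_apply] at h
          have h1 : C * (1 + |z|) * ε ^ 2 ≤ L * ε ^ 2 := by
            rw [hL]
            gcongr
          push_cast at hlt
          linarith
        · have hyx' : dist y x ≤ 2 * ε ^ (1 - α) := hyx
          have hyx₀ : dist y x₀ ≤ 2 * ρ := by
            have := dist_triangle y x x₀
            linarith
          have h1 := hnb y hy (hyx₀.trans hρ2)
          have h2 := (le_abs_self _).trans ((hH y hy).trans (le_abs_self H))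
          have h3 := hΩ.inner_le hx₀ hy
          have h4 := (abs_le.1 (abs_real_inner_le_norm (x - y) (outwardNormal P.Ω y))).1
          rw [hΩ.norm_normal y hy, mul_one, norm_sub_rev, ← dist_eq_norm] at h4
          rw [norm_sub_rev, ← dist_eq_norm] at h3
          have h5 : dist y x₀ ^ 2 ≤ (2 * ρ) ^ 2 := by gcongr
          have h6 : ⟪x - x₀, outwardNormal P.Ω y⟫_ℝ =
              ⟪x - y, outwardNormal P.Ω y⟫_ℝ - ⟪x₀ - y, outwardNormal P.Ω y⟫_ℝ := by
            rw [← inner_sub_left, sub_sub_sub_cancel_right]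
          have h7 : K * ⟪x₀ - y, outwardNormal P.Ω y⟫_ℝ ≤ 16 * Z / ϱ := by
            rw [le_div_iff₀ hϱ]
            have : K * (2 * ϱ * ⟪x₀ - y, outwardNormal P.Ω y⟫_ℝ) ≤ K * (2 * ρ) ^ 2 := by
              gcongr
              linarith
            linarith
          have h8 : K * -(2 * ε ^ (1 - α)) ≤ K * ⟪x - y, outwardNormal P.Ω y⟫_ℝ := by
            gcongr
            linarith
          have h9 : c * (1 / 2) ≤ c * ⟪n, outwardNormal P.Ω y⟫_ℝ := by gcongr
          rw [inner_add_left, inner_smul_left, smul_apply, one_apply_eq_self, inner_smul_left, h6]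
          simp only [conj_trivial]
          linarith
        · have hwx₀ : dist w x₀ ≤ ρ := by
            have := dist_triangle w x x₀
            linarith
          have hj' : (j : ℝ) * ε ^ 2 ≤ 1 := by
            push_cast at hj
            linarith
          have h1 := ih hj' w hw hwx₀ z' hz'
          have h2 := paraboloid_shift hXs (c • n) (x - x₀) (w - x)
          rw [show x - x₀ + (w - x) = w - x₀ by abel] at h2
          rw [div_mul_cancel₀ _ hε0.ne']
          linarith
  have hcont : Continuous fun b : Sp N × ℝ =>
      P.g x₀ + η / 2 + (⟪c • n, b.1 - x₀⟫_ℝ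
        + 1 / 2 * ⟪(K • (1 : Mat N)) (b.1 - x₀), b.1 - x₀⟫_ℝ) + L * (P.T - b.2) := by
    fun_prop
  have hnhds : ∀ᶠ b : Sp N × ℝ in 𝓝 (x₀, P.T), P.g x₀ + η / 2 + (⟪c • n, b.1 - x₀⟫_ℝ
      + 1 / 2 * ⟪(K • (1 : Mat N)) (b.1 - x₀), b.1 - x₀⟫_ℝ) + L * (P.T - b.2) < P.g x₀ + η := by
    refine (hcont.tendsto (x₀, P.T)).eventually (gt_mem_nhds ?_)
    simp only [sub_self, inner_zero_right, mul_zero, add_zero]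
    linarith
  have hball : ∀ᶠ b in 𝓝 (x₀, P.T), dist b.1 x₀ ≤ ρ ∧ P.T - 1 ≤ b.2 := by
    refine Filter.Eventually.and ?_ ?_
    · exact (continuous_fst.tendsto (x₀, P.T)).eventually (closedBall_mem_nhds x₀ hρ)
    · exact (continuous_snd.tendsto (x₀, P.T)).eventually (Ici_mem_nhds (by linarith))
  refine upperLimit_le ?_
  filter_upwards [eventually_approach_fst hmain, eventually_approach_snd (hnhds.and hball)]
    with a ha ⟨hax, ha1, ha2, ha3⟩
  refine levelSup_le fun z hz => ?_
  have h1 := ha a.2.2 (by linarith) a.2.1 hax ha2 z hz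
  linarith

end Consistent

/-! ### The relaxed limit at a point of contact -/

namespace Consistent

variable {P : FinalValueProblem N} {α ϱ : ℝ} {A : ℝ → ℕ → Sp N → ℝ → Prop}

/-- A paraboloid with gradient `p` and Hessian `X` at `x₀`, and with time derivative `a`. -/
def paraboloid (x₀ : Sp N) (t₀ c a : ℝ) (p : Sp N) (X : Mat N) (b : Sp N × ℝ) : ℝ :=
  c + a * (b.2 - t₀) + (⟪p, b.1 - x₀⟫_ℝ + 1 / 2 * ⟪X (b.1 - x₀), b.1 - x₀⟫_ℝ)

theorem continuous_paraboloid (x₀ : Sp N) (t₀ c a : ℝ) (p : Sp N) (X : Mat N) :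
    Continuous (paraboloid x₀ t₀ c a p X) := by
  unfold paraboloid
  fun_prop

theorem paraboloid_self (x₀ : Sp N) (t₀ c a : ℝ) (p : Sp N) (X : Mat N) :
    paraboloid x₀ t₀ c a p X (x₀, t₀) = c := by
  simp [paraboloid]

theorem paraboloid_add (x₀ : Sp N) (t₀ c a κ : ℝ) (p : Sp N) (X : Mat N) (b : Sp N × ℝ) :
    paraboloid x₀ t₀ c (a + κ) p (X + (2 * κ) • 1) b =
      paraboloid x₀ t₀ c a p X b + κ * (b.2 - t₀) + κ * ‖b.1 - x₀‖ ^ 2 := by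
  have h := inner_smul_one_apply (2 * κ) (b.1 - x₀)
  rw [paraboloid, paraboloid, add_apply, inner_add_left, h]
  ring

theorem exists_forall_lt_f (hf : ContinuousOn
      (fun a : ℝ × Sp N × ℝ × Sp N × Mat N => P.f a.1 a.2.1 a.2.2.1 a.2.2.2.1 a.2.2.2.2)
      {a | a.2.1 ∈ closure P.Ω ∧ IsSelfAdjoint a.2.2.2.2})
    {x₀ : Sp N} (hx₀ : x₀ ∈ closure P.Ω) {t₀ c a : ℝ} {p : Sp N} {X : Mat N}
    (hX : IsSelfAdjoint X) (hfa : a < P.f t₀ x₀ c p X) :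
    ∃ σ > 0, ∀ t, |t - t₀| < σ → ∀ x ∈ closure P.Ω, dist x x₀ < σ → ∀ z, |z - c| < σ →
      ∀ p', ‖p' - p‖ < σ → ∀ X', IsSelfAdjoint X' → ‖X' - X‖ < σ → a < P.f t x z p' X' := by
  obtain ⟨σ, hσ, h⟩ := Metric.continuousWithinAt_iff.1 (hf (t₀, x₀, c, p, X) ⟨hx₀, hX⟩)
    (P.f t₀ x₀ c p X - a) (by linarith)
  refine ⟨σ, hσ, fun t ht x hx hxd z hz p' hp' X' hX' hXX' => ?_⟩
  have h1 := h (x := (t, x, z, p', X')) ⟨hx, hX'⟩ (by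
    simp only [Prod.dist_eq, max_lt_iff]
    rw [Real.dist_eq, Real.dist_eq, dist_eq_norm p', dist_eq_norm X']
    exact ⟨ht, hxd, hz, hp', hXX'⟩)
  rw [Real.dist_eq] at h1
  have := (abs_lt.1 h1).1
  simp only at this
  linarith

theorem exists_forall_neumann_lt (hΩ : BallDomain P.Ω ϱ) (hh : ContinuousOn P.h (frontier P.Ω))
    {x₀ p : Sp N} (hbd : x₀ ∈ frontier P.Ω → P.h x₀ < ⟪p, outwardNormal P.Ω x₀⟫_ℝ) :
    ∃ σ > 0, ∀ y ∈ frontier P.Ω, dist y x₀ < σ → ∀ p', ‖p' - p‖ < σ →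
      P.h y + σ ≤ ⟪p', outwardNormal P.Ω y⟫_ℝ := by
  by_cases hx₀ : x₀ ∈ frontier P.Ω
  · have h1 := hbd hx₀
    have hc : ContinuousOn (fun b : Sp N × Sp N => ⟪b.2, outwardNormal P.Ω b.1⟫_ℝ - P.h b.1)
        (frontier P.Ω ×ˢ univ) := by
      have h2 : ContinuousOn (fun b : Sp N × Sp N => outwardNormal P.Ω b.1)
          (frontier P.Ω ×ˢ univ) :=
        hΩ.continuousOn_outwardNormal.comp continuousOn_fst fun b hb => hb.1
      have h3 : ContinuousOn (fun b : Sp N × Sp N => P.h b.1) (frontier P.Ω ×ˢ univ) :=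
        hh.comp continuousOn_fst fun b hb => hb.1
      exact (continuousOn_snd.inner h2).sub h3
    set m := ⟪p, outwardNormal P.Ω x₀⟫_ℝ - P.h x₀ with hm
    have hm0 : 0 < m := by linarith
    obtain ⟨σ, hσ, h⟩ := Metric.continuousWithinAt_iff.1 (hc (x₀, p) ⟨hx₀, mem_univ _⟩) (m / 2)
      (by linarith)
    refine ⟨min σ (m / 2), by positivity, fun y hy hyd p' hp' => ?_⟩
    have h4 := h (x := (y, p')) ⟨hy, mem_univ _⟩ (by
      rw [Prod.dist_eq, max_lt_iff, dist_eq_norm p']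
      exact ⟨hyd.trans_le (min_le_left _ _), hp'.trans_le (min_le_left _ _)⟩)
    rw [Real.dist_eq] at h4
    have h5 := (abs_lt.1 h4).1
    simp only [← hm] at h5
    linarith [min_le_right σ (m / 2)]
  · obtain ⟨η, hη, hb⟩ := Metric.isOpen_iff.1 isClosed_frontier.isOpen_compl x₀ hx₀
    exact ⟨η, hη, fun y hy hd => absurd hy (hb hd)⟩

/-- The relaxed limit cannot be touched from above, at later times, by a paraboloid that is a strict
supersolution at the point of contact. -/
theorem not_touched_above (hA : Consistent P α A) (hα : α < 1) (hΩ : BallDomain P.Ω ϱ)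
    (hf : ContinuousOn
      (fun a : ℝ × Sp N × ℝ × Sp N × Mat N => P.f a.1 a.2.1 a.2.2.1 a.2.2.2.1 a.2.2.2.2)
      {a | a.2.1 ∈ closure P.Ω ∧ IsSelfAdjoint a.2.2.2.2})
    (hh : ContinuousOn P.h (frontier P.Ω)) {x₀ : Sp N} (hx₀ : x₀ ∈ closure P.Ω) {t₀ : ℝ}
    (ht₀ : t₀ < P.T) {c a η₀ : ℝ} {p : Sp N} {X : Mat N} (hX : IsSelfAdjoint X) (hη₀ : 0 < η₀)
    (hlim : upperLimit P (levelSup A) x₀ t₀ = (c : EReal))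
    (hmax : ∀ x ∈ closure P.Ω, dist x x₀ ≤ η₀ → ∀ t ∈ Icc t₀ (t₀ + η₀),
      upperLimit P (levelSup A) x t ≤ (paraboloid x₀ t₀ c a p X (x, t) : EReal))
    (hfa : a < P.f t₀ x₀ c p X)
    (hbd : x₀ ∈ frontier P.Ω → P.h x₀ < ⟪p, outwardNormal P.Ω x₀⟫_ℝ) : False := by
  obtain ⟨δ, hδ, hδ'⟩ : ∃ δ > 0, a + 3 * δ < P.f t₀ x₀ c p X :=
    ⟨(P.f t₀ x₀ c p X - a) / 4, by linarith, by linarith⟩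
  obtain ⟨σ₁, hσ₁, hlt⟩ := exists_forall_lt_f hf hx₀ hX hδ'
  obtain ⟨σ₂, hσ₂, hbdy⟩ := exists_forall_neumann_lt hΩ hh hbd
  obtain ⟨σ, hσ, hσσ₁, hσσ₂, hσδ⟩ : ∃ σ > 0, σ ≤ σ₁ ∧ σ ≤ σ₂ ∧ σ ≤ δ :=
    ⟨min σ₁ (min σ₂ δ), by positivity, min_le_left _ _, (min_le_right _ _).trans (min_le_left _ _),
      (min_le_right _ _).trans (min_le_right _ _)⟩
  -- Adding `κ * (t - t₀) + κ * ‖x - x₀‖ ^ 2` makes the contact strict, while the data stay within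
  -- the tolerance `σ`.
  set κ := σ / 4 with hκ
  have hκ0 : 0 < κ := by positivity
  set X' := X + (2 * κ) • (1 : Mat N) with hX'
  have hX's : IsSelfAdjoint X' := isSelfAdjoint_add_smul_one hX _
  have hXX' : ‖X' - X‖ < σ := by
    rw [hX', add_sub_cancel_left]
    refine (norm_smul_one_le (by positivity)).trans_lt ?_
    linarith
  set φ := paraboloid x₀ t₀ c (a + κ) p X' with hφ
  have hφc : Continuous φ := continuous_paraboloid _ _ _ _ _ _
  have hφ0 : φ (x₀, t₀) = c := paraboloid_self _ _ _ _ _ _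
  -- localisation
  obtain ⟨η₁, hη₁, hφη⟩ : ∃ η₁ > 0, ∀ x t, dist x x₀ < η₁ → |t - t₀| < η₁ →
      |φ (x, t) - c| < σ / 2 := by
    obtain ⟨η₁, hη₁, h⟩ := Metric.continuousAt_iff.1 (hφc.continuousAt (x := (x₀, t₀))) (σ / 2)
      (by positivity)
    refine ⟨η₁, hη₁, fun x t hx ht => ?_⟩
    rw [← hφ0, ← Real.dist_eq]
    exact h (by rw [Prod.dist_eq, max_lt_iff]; exact ⟨hx, by rwa [Real.dist_eq]⟩)
  obtain ⟨η₂, hη₂, hWη⟩ := eventually_of_upperLimit_lt (y := ((c + σ / 2 : ℝ) : EReal)) (by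
    rw [hlim, EReal.coe_lt_coe_iff]
    linarith)
  obtain ⟨η₃, hη₃, hη₃X⟩ : ∃ η₃ > 0, ∀ v : Sp N, ‖v‖ < η₃ → ‖X' v‖ < σ := by
    refine ⟨σ / (‖X'‖ + 1), by positivity, fun v hv => ?_⟩
    rw [lt_div_iff₀ (by positivity)] at hv
    have h1 := X'.le_opNorm v
    nlinarith [norm_nonneg v]
  obtain ⟨η, hη, hηη₀, hηη₁, hηη₂, hηη₃, hησ, hηT⟩ : ∃ η > 0, η ≤ η₀ ∧ η < η₁ ∧ η < η₂ ∧ η < η₃ ∧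
      2 * η ≤ σ ∧ t₀ + η < P.T := by
    have hm : 0 < min η₀ (min η₁ (min η₂ (min η₃ (min σ (P.T - t₀))))) := by
      have : 0 < P.T - t₀ := by linarith
      positivity
    refine ⟨_, half_pos hm, ?_⟩
    have h1 := le_refl (min η₀ (min η₁ (min η₂ (min η₃ (min σ (P.T - t₀))))))
    simp only [le_min_iff] at h1
    obtain ⟨h1, h2, h3, h4, h5, h6⟩ := h1
    refine ⟨?_, ?_, ?_, ?_, ?_, ?_⟩ <;> linarith
  obtain ⟨μ, hμ, hμ1, hμ2, hμ3⟩ : ∃ μ > 0, μ < κ * η ∧ μ < κ * (η / 2) ^ 2 ∧ μ ≤ σ / 4 := by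
    refine ⟨min (κ * η / 2) (min (κ * (η / 2) ^ 2 / 2) (σ / 4)), by positivity, ?_, ?_, ?_⟩
    · refine (min_le_left _ _).trans_lt (half_lt_self (by positivity))
    · exact ((min_le_right _ _).trans (min_le_left _ _)).trans_lt (half_lt_self (by positivity))
    · exact (min_le_right _ _).trans (min_le_right _ _)
  -- the parabolic boundary
  set S : Set (Sp N × ℝ) := (closure P.Ω ∩ closedBall x₀ η) ×ˢ Icc t₀ (t₀ + η) ∩
    {b | η / 2 ≤ dist b.1 x₀ ∨ b.2 = t₀ + η} with hS
  have hScomp : IsCompact S := by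
    refine (((isCompact_closedBall x₀ η).inter_left isClosed_closure).prod
      isCompact_Icc).inter_right ?_
    exact (isClosed_le continuous_const (continuous_fst.dist continuous_const)).union
      (isClosed_eq continuous_snd continuous_const)
  have hφμ : Continuous fun b => φ b - μ := hφc.sub continuous_const
  obtain ⟨η₄, hη₄, hSW⟩ := eventually_lt_of_isCompact (W := levelSup A) hScomp (subset_univ S)
    (Φ := fun b => φ b - μ) (hφμ.lowerSemicontinuous.lowerSemicontinuousOn _)
    (by
      rintro ⟨x, t⟩ ⟨⟨⟨hx, hxd⟩, ht⟩, hor⟩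
      refine (hmax x hx ((mem_closedBall.1 hxd).trans hηη₀) t
        ⟨ht.1, ht.2.trans (by linarith)⟩).trans_lt (EReal.coe_lt_coe_iff.2 ?_)
      rw [hφ, hX', paraboloid_add]
      simp only
      have h1 : 0 ≤ κ * (t - t₀) := mul_nonneg hκ0.le (by linarith [ht.1])
      have h2 : 0 ≤ κ * ‖x - x₀‖ ^ 2 := by positivity
      rcases hor with h | h
      · have h3 : κ * (η / 2) ^ 2 ≤ κ * ‖x - x₀‖ ^ 2 := by
          rw [← dist_eq_norm]
          gcongr
        linarith
      · have h3 : κ * (t - t₀) = κ * η := by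
          rw [show t = t₀ + η from h, add_sub_cancel_left]
        linarith)
  -- comparison in the interior
  set R := |c| + σ + ‖p‖ + ‖X'‖ with hR
  have hR0 : 0 ≤ R := by positivity
  -- The window overlaps both ends: below, since the relaxed limit at `t₀` sees slightly earlier
  -- grid times; above, since one round from a time before `t₀ + η` may overshoot it by `ε ^ 2 <
  -- η₄`.
  have hmain : ∀ᶠ ε in 𝓝[>] (0 : ℝ), ∀ (j : ℕ), t₀ - min η η₄ < P.T - j * ε ^ 2 →
      P.T - j * ε ^ 2 < t₀ + η + η₄ → ∀ x ∈ closure P.Ω, dist x x₀ ≤ η → ∀ z, A ε j x z →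
        z ≤ φ (x, P.T - j * ε ^ 2) - μ := by
    have hsq : ∀ᶠ ε in 𝓝[>] (0 : ℝ), ε ^ 2 < η₄ := by
      have h1 : Tendsto (fun ε : ℝ => ε ^ 2) (𝓝[>] 0) (𝓝 0) := by
        have : Tendsto (fun ε : ℝ => ε ^ 2) (𝓝 0) (𝓝 (0 ^ 2)) := (continuous_pow 2).tendsto 0
        rw [zero_pow two_ne_zero] at this
        exact this.mono_left nhdsWithin_le_nhds
      exact h1.eventually (gt_mem_nhds hη₄)
    filter_upwards [hA.interior R σ hR0 hσ, hsq, self_mem_nhdsWithin,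
      mem_of_superset (Ioo_mem_nhdsGT hη₂) (fun ε h => h.2),
      mem_of_superset (Ioo_mem_nhdsGT hη₄) (fun ε h => h.2),
      eventually_mul_step_le hα 2 (half_pos hη)] with ε hint hsq hε hεη₂ hεη₄ hstep j
    have hε' : 0 < ε := hε
    have hε0 : 0 < ε ^ 2 := by positivity
    induction j with
    | zero =>
      intro _ hT x hx hxd z hz
      have h1 : P.T < t₀ + η + η₄ := by simpa using hT
      refine EReal.coe_le_coe_iff.1 ((le_levelSup hz).trans (hSW ε hε' hεη₄ (x, t₀ + η)
        ⟨⟨⟨hx, hxd⟩, ⟨by linarith, le_rfl⟩⟩, Or.inr rfl⟩ x hx (by simpa using hη₄) 0 ?_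
        (mem_univ _)).le)
      simp only [Nat.cast_zero, zero_mul, sub_zero]
      rw [abs_lt]
      constructor <;> linarith
    | succ i ih =>
      intro hlow hupp x hx hxd z hz
      set t := P.T - ((i + 1 : ℕ) : ℝ) * ε ^ 2 with ht
      have hti : P.T - (i : ℝ) * ε ^ 2 = t + ε ^ 2 := by
        rw [ht]
        push_cast
        ring
      have hti' : P.T - ((i : ℝ) + 1) * ε ^ 2 = t := by
        rw [ht]
        push_cast
        ring
      have hm1 := min_le_left η η₄
      have hm2 := min_le_right η η₄
      rcases le_or_gt (t₀ + η) t with hlate | hearly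
      · refine EReal.coe_le_coe_iff.1 ((le_levelSup hz).trans (hSW ε hε' hεη₄ (x, t₀ + η)
          ⟨⟨⟨hx, hxd⟩, ⟨by linarith, le_rfl⟩⟩, Or.inr rfl⟩ x hx (by simpa using hη₄) (i + 1) ?_
          (mem_univ _)).le)
        rw [← ht, abs_lt]
        constructor <;> simp only <;> linarith
      rcases le_or_gt (η / 2) (dist x x₀) with hfar | hnear
      -- If `t < t₀`, the point `(x, t)` is not in `S`, but `(x, t₀)` is, and it is `η₄`-close.
      · refine EReal.coe_le_coe_iff.1 ((le_levelSup hz).trans (hSW ε hε' hεη₄ (x, max t t₀)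
          ⟨⟨⟨hx, hxd⟩, ⟨le_max_right _ _, max_le hearly.le (by linarith)⟩⟩, Or.inl hfar⟩ x hx
          (by simpa using hη₄) (i + 1) ?_ (mem_univ _)).le)
        rw [← ht, abs_lt]
        simp only
        constructor
        · have : max t t₀ < t + η₄ := max_lt (by linarith) (by linarith)
          linarith
        · linarith [le_max_left t t₀]
      · by_contra hzlt
        push Not at hzlt
        have htσ : |t - t₀| < η₂ ∧ |t - t₀| < η₁ ∧ |t - t₀| < σ₁ := by
          have : |t - t₀| ≤ η := by
            rw [abs_le]
            constructor <;> linarith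
          refine ⟨?_, ?_, ?_⟩ <;> linarith
        have hzup : z < c + σ / 2 := EReal.coe_lt_coe_iff.1 <| (le_levelSup hz).trans_lt
          (hWη ε hε' hεη₂ x hx (hxd.trans_lt hηη₂) (i + 1) htσ.1)
        have hzlow := (abs_lt.1 (hφη x t (hxd.trans_lt hηη₁) htσ.2.1)).1
        have hzc : |z - c| < σ := by
          rw [abs_lt]
          constructor <;> linarith
        have hzR : |z| ≤ R := by
          have h1 := abs_sub_abs_le_abs_sub z c
          have := norm_nonneg p
          have := norm_nonneg X'
          linarith
        have hgrad : ‖X' (x - x₀)‖ < σ := hη₃X _ (by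
          rw [← dist_eq_norm]
          exact hxd.trans_lt hηη₃)
        have hpR : ‖p + X' (x - x₀)‖ ≤ R := by
          refine (norm_add_le _ _).trans ?_
          have := abs_nonneg c
          have := norm_nonneg X'
          linarith
        have hXR : ‖X'‖ ≤ R := by
          have := abs_nonneg c
          have := norm_nonneg p
          linarith
        -- The last argument makes the paraboloid recentred at `x` coincide with `φ (·, t + ε ^ 2) -
        -- μ`. Since `z` violates the bound at time `t`, it is at most `a + κ`, too small for the
        -- strict inequality on `f`.
        have h := hint i x hx (p + X' (x - x₀)) X' z
          ((φ (x, t + ε ^ 2) - μ - z) / ε ^ 2) hX's hpR hXR hzR hz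
          (fun y hy hyx => ?_) (fun w hw hwx z' hz' => ?_)
        · rw [hti'] at h
          have h1 := hlt t htσ.2.2 x hx (by linarith) z (by linarith) (p + X' (x - x₀)) (by
            rw [add_sub_cancel_left]
            linarith) X' hX's (by linarith)
          have h2 : φ (x, t + ε ^ 2) = φ (x, t) + (a + κ) * ε ^ 2 := by
            simp only [hφ, paraboloid]
            ring
          have h3 : (φ (x, t + ε ^ 2) - μ - z) / ε ^ 2 ≤ a + κ := by
            rw [div_le_iff₀ hε0]
            linarith
          linarith
        · have hyx' : dist y x ≤ 2 * ε ^ (1 - α) := hyx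
          have h1 := dist_triangle y x x₀
          have h2 := hbdy y hy (by linarith) (p + X' (x - x₀)) (by
            rw [add_sub_cancel_left]
            linarith)
          linarith
        · have hwx' : dist w x ≤ 2 * ε ^ (1 - α) := hwx
          have h1 := dist_triangle w x x₀
          have h2 := ih (by rw [hti]; linarith) (by rw [hti]; linarith) w hw (by linarith) z' hz'
          have h3 := paraboloid_shift hX's p (x - x₀) (w - x)
          rw [show x - x₀ + (w - x) = w - x₀ by abel] at h3
          rw [hti] at h2
          have h4 : φ (w, t + ε ^ 2) = φ (x, t + ε ^ 2)
              + ⟪p + X' (x - x₀), w - x⟫_ℝ + 1 / 2 * ⟪X' (w - x), w - x⟫_ℝ := by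
            simp only [hφ, paraboloid]
            linarith
          rw [div_mul_cancel₀ _ hε0.ne']
          linarith
  have hnear : ∀ᶠ b in 𝓝 (x₀, t₀), φ b < c + μ / 2 ∧ dist b.1 x₀ ≤ η ∧
      t₀ - min η η₄ < b.2 ∧ b.2 < t₀ + η + η₄ := by
    have hmin : 0 < min η η₄ := lt_min hη hη₄
    have hsnd := continuous_snd.tendsto (x₀, t₀)
    refine Filter.Eventually.and ?_ (Filter.Eventually.and ?_ (Filter.Eventually.and ?_ ?_))
    · refine (hφc.tendsto (x₀, t₀)).eventually (gt_mem_nhds ?_)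
      rw [hφ0]
      linarith
    · exact (continuous_fst.tendsto (x₀, t₀)).eventually (closedBall_mem_nhds x₀ hη)
    · exact hsnd.eventually (lt_mem_nhds (by simp only; linarith))
    · exact hsnd.eventually (gt_mem_nhds (by simp only; linarith))
  have hcontra : upperLimit P (levelSup A) x₀ t₀ ≤ ((c - μ / 2 : ℝ) : EReal) := by
    refine upperLimit_le ?_
    filter_upwards [eventually_approach_fst hmain, eventually_approach_snd hnear]
      with b hb ⟨hbx, hb1, hb2, hb3, hb4⟩
    refine levelSup_le fun z hz => ?_
    have h1 := hb b.2.2 hb3 hb4 b.2.1 hbx hb2 z hz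
    linarith
  rw [hlim, EReal.coe_le_coe_iff] at hcontra
  linarith

end Consistent

/-! ### Smooth test functions -/

theorem inner_gradient {h : Sp N → ℝ} (y v : Sp N) : ⟪gradient h y, v⟫_ℝ = fderiv ℝ h y v := by
  rw [gradient, InnerProductSpace.toDual_symm_apply]

theorem differentiable_gradient {h : Sp N → ℝ} (hh : ContDiff ℝ 2 h) :
    Differentiable ℝ (gradient h) := by
  have h1 : Differentiable ℝ (fderiv ℝ h) :=
    (hh.fderiv_right (m := 1) (by norm_num)).differentiable (by norm_num)
  rw [differentiable_euclidean]
  intro i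
  have h2 : (fun y => gradient h y i) = fun y => fderiv ℝ h y (EuclideanSpace.single i 1) := by
    funext y
    rw [← inner_gradient, EuclideanSpace.inner_single_right]
    simp
  rw [h2]
  fun_prop

theorem isSelfAdjoint_fderiv_gradient {h : Sp N → ℝ} (hh : ContDiff ℝ 2 h) (x : Sp N) :
    IsSelfAdjoint (fderiv ℝ (gradient h) x) := by
  have h1 : Differentiable ℝ (fderiv ℝ h) :=
    (hh.fderiv_right (m := 1) (by norm_num)).differentiable (by norm_num)
  have key : ∀ v w : Sp N, ⟪fderiv ℝ (gradient h) x v, w⟫_ℝ = fderiv ℝ (fderiv ℝ h) x v w := by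
    intro v w
    have h2 := ((differentiable_gradient hh) x).hasFDerivAt.inner ℝ (hasFDerivAt_const w x)
    have h3 := (h1 x).hasFDerivAt.clm_apply (hasFDerivAt_const w x)
    have h4 : (fun y => ⟪gradient h y, w⟫_ℝ) = fun y => fderiv ℝ h y w :=
      funext fun y => inner_gradient y w
    rw [h4] at h2
    have h5 := congrArg (fun l => l v) (h2.unique h3)
    simpa using h5
  rw [ContinuousLinearMap.isSelfAdjoint_iff_isSymmetric]
  intro v w
  have hs := (hh.contDiffAt (x := x)).isSymmSndFDerivAt (by simp)
  rw [ContinuousLinearMap.coe_coe, key, hs v w, ← key, real_inner_comm]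

/-- Mean value inequality on the segment for `h` minus its quadratic Taylor polynomial;
differentiability of the gradient at `x₀` makes the derivative small. -/
theorem le_taylor_two {h : Sp N → ℝ} (hh : ContDiff ℝ 2 h) (x₀ : Sp N) {κ : ℝ} (hκ : 0 < κ) :
    ∃ η > 0, ∀ x, dist x x₀ ≤ η → h x ≤ h x₀ + (⟪gradient h x₀, x - x₀⟫_ℝ
      + 1 / 2 * ⟪fderiv ℝ (gradient h) x₀ (x - x₀), x - x₀⟫_ℝ) + κ * ‖x - x₀‖ ^ 2 := by
  have hd := ((differentiable_gradient hh) x₀).hasFDerivAt.isLittleO.def hκ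
  obtain ⟨η, hη, hb⟩ := Metric.eventually_nhds_iff.1 hd
  refine ⟨η / 2, by positivity, fun x hx => ?_⟩
  obtain ⟨v, hv⟩ : ∃ v, v = x - x₀ := ⟨_, rfl⟩
  rw [dist_eq_norm, ← hv] at hx
  set k : ℝ → ℝ := fun s => h (x₀ + s • v) - (s * ⟪gradient h x₀, v⟫_ℝ
    + s ^ 2 / 2 * ⟪fderiv ℝ (gradient h) x₀ v, v⟫_ℝ) with hk
  have hderiv : ∀ s, HasDerivAt k (⟪gradient h (x₀ + s • v) - gradient h x₀
      - fderiv ℝ (gradient h) x₀ (s • v), v⟫_ℝ) s := by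
    intro s
    have h1 : HasDerivAt (fun s : ℝ => x₀ + s • v) v s := by
      simpa using ((hasDerivAt_id s).smul_const v).const_add x₀
    have h2 : HasDerivAt (fun s : ℝ => h (x₀ + s • v)) (fderiv ℝ h (x₀ + s • v) v) s :=
      ((hh.differentiable (by norm_num)) _).hasFDerivAt.comp_hasDerivAt s h1
    have h3 : HasDerivAt (fun s : ℝ => s * ⟪gradient h x₀, v⟫_ℝ
        + s ^ 2 / 2 * ⟪fderiv ℝ (gradient h) x₀ v, v⟫_ℝ)
        (1 * ⟪gradient h x₀, v⟫_ℝ + (2 * s ^ 1 * 1) / 2 * ⟪fderiv ℝ (gradient h) x₀ v, v⟫_ℝ) s :=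
      ((hasDerivAt_id s).mul_const _).add ((((hasDerivAt_id s).pow 2).div_const 2).mul_const _)
    have h4 := h2.sub h3
    refine h4.congr_deriv ?_
    rw [inner_sub_left, inner_sub_left, map_smul, inner_smul_left, ← inner_gradient]
    simp only [conj_trivial]
    ring
  have hbound : ∀ s ∈ Icc (0 : ℝ) 1, ‖⟪gradient h (x₀ + s • v) - gradient h x₀
      - fderiv ℝ (gradient h) x₀ (s • v), v⟫_ℝ‖ ≤ κ * ‖v‖ ^ 2 := by
    intro s hs
    have hsv : ‖s • v‖ ≤ ‖v‖ := by
      rw [norm_smul, Real.norm_of_nonneg hs.1]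
      exact mul_le_of_le_one_left (norm_nonneg v) hs.2
    have h1 := hb (y := x₀ + s • v) (by
      rw [dist_eq_norm, add_sub_cancel_left]
      linarith)
    rw [add_sub_cancel_left] at h1
    refine (norm_inner_le_norm _ _).trans ?_
    calc _ ≤ κ * ‖s • v‖ * ‖v‖ := by gcongr
      _ ≤ κ * ‖v‖ * ‖v‖ := by gcongr
      _ = _ := by ring
  have hmv := (convex_Icc (0 : ℝ) 1).norm_image_sub_le_of_norm_hasDerivWithin_le
    (fun s _ => (hderiv s).hasDerivWithinAt) hbound (left_mem_Icc.2 zero_le_one)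
    (right_mem_Icc.2 zero_le_one)
  rw [Real.norm_eq_abs] at hmv
  have h1 := (abs_le.1 hmv).2
  simp only [hk, one_smul, zero_smul, add_zero, sub_zero, norm_one, mul_one, one_mul,
    zero_mul, one_pow, ne_eq, OfNat.ofNat_ne_zero, not_false_eq_true, zero_pow, zero_div] at h1
  rw [hv, add_sub_cancel] at h1
  linarith

theorem le_taylor_one {φ : Sp N × ℝ → ℝ} (hφ : ContDiff ℝ 1 φ) (x₀ : Sp N) (t₀ : ℝ) {κ : ℝ}
    (hκ : 0 < κ) : ∃ η > 0, ∀ x, dist x x₀ ≤ η → ∀ t ∈ Icc t₀ (t₀ + η),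
      φ (x, t) ≤ φ (x, t₀) + (deriv (fun s => φ (x₀, s)) t₀ + κ) * (t - t₀) := by
  have hd : ∀ x t, HasDerivAt (fun s => φ (x, s)) (fderiv ℝ φ (x, t) (0, 1)) t := fun x t => by
    have h1 : HasDerivAt (fun s : ℝ => (x, s)) ((0 : Sp N), (1 : ℝ)) t :=
      (hasDerivAt_const t x).prodMk (hasDerivAt_id t)
    exact ((hφ.differentiable (by norm_num)) _).hasFDerivAt.comp_hasDerivAt t h1
  have hc : Continuous fun b : Sp N × ℝ => fderiv ℝ φ b (0, 1) :=
    (hφ.continuous_fderiv (by norm_num)).clm_apply continuous_const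
  have hev := (hc.tendsto (x₀, t₀)).eventually
    (gt_mem_nhds (show fderiv ℝ φ (x₀, t₀) (0, 1) < fderiv ℝ φ (x₀, t₀) (0, 1) + κ by linarith))
  obtain ⟨η, hη, hb⟩ := Metric.eventually_nhds_iff.1 hev
  refine ⟨η / 2, by positivity, fun x hx t ht => ?_⟩
  rw [(hd x₀ t₀).deriv]
  have h1 := (convex_Icc t₀ (t₀ + η / 2)).image_sub_le_mul_sub_of_deriv_le
    (f := fun s => φ (x, s)) (C := fderiv ℝ φ (x₀, t₀) (0, 1) + κ)
    (fun s _ => (hd x s).continuousAt.continuousWithinAt)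
    (fun s _ => (hd x s).differentiableAt.differentiableWithinAt)
    (fun s hs => by
      rw [(hd x s).deriv]
      refine (hb ?_).le
      have hs' := interior_subset hs
      rw [Prod.dist_eq, Real.dist_eq, max_lt_iff, abs_lt]
      refine ⟨by linarith, ?_, ?_⟩ <;> simp only <;> linarith [hs'.1, hs'.2])
    t₀ (left_mem_Icc.2 (by linarith)) t ht ht.1
  linarith

/-- First order in time at fixed `x`, then second order in space at time `t₀`. The time slope is
uniform for `x` near `x₀`, so no mixed terms appear; only later times are needed. -/
theorem le_paraboloid {φ : Sp N × ℝ → ℝ} (hφ : ContDiff ℝ ∞ φ) (x₀ : Sp N) (t₀ c : ℝ) {κ : ℝ}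
    (hκ : 0 < κ) : ∃ η > 0, ∀ x, dist x x₀ ≤ η → ∀ t ∈ Icc t₀ (t₀ + η),
      c + (φ (x, t) - φ (x₀, t₀)) ≤ Consistent.paraboloid x₀ t₀ c
        (deriv (fun s => φ (x₀, s)) t₀ + κ) (spaceGrad φ x₀ t₀)
        (spaceHess φ x₀ t₀ + (2 * κ) • 1) (x, t) := by
  have hφ2 : ContDiff ℝ 2 φ := contDiff_infty.1 hφ 2
  have h2 : ContDiff ℝ 2 fun y => φ (y, t₀) := hφ2.comp (contDiff_id.prodMk contDiff_const)
  obtain ⟨η₁, hη₁, h1⟩ := le_taylor_one (hφ2.of_le (by norm_num)) x₀ t₀ hκ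
  obtain ⟨η₂, hη₂, h2⟩ := le_taylor_two h2 x₀ hκ
  refine ⟨min η₁ η₂, lt_min hη₁ hη₂, fun x hx t ht => ?_⟩
  have h3 := h1 x (hx.trans (min_le_left _ _)) t
    ⟨ht.1, ht.2.trans (by linarith [min_le_left η₁ η₂])⟩
  have h4 := h2 x (hx.trans (min_le_right _ _))
  have h5 := Consistent.paraboloid_add x₀ t₀ c (deriv (fun s => φ (x₀, s)) t₀) κ
    (spaceGrad φ x₀ t₀) (spaceHess φ x₀ t₀) (x, t)
  rw [h5, Consistent.paraboloid]
  have h6 : Consistent.paraboloid x₀ t₀ c (deriv (fun s => φ (x₀, s)) t₀) (spaceGrad φ x₀ t₀)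
    (spaceHess φ x₀ t₀) (x, t) = c + deriv (fun s => φ (x₀, s)) t₀ * (t - t₀)
      + (⟪gradient (fun y => φ (y, t₀)) x₀, x - x₀⟫_ℝ
      + 1 / 2 * ⟪fderiv ℝ (gradient fun y => φ (y, t₀)) x₀ (x - x₀), x - x₀⟫_ℝ) := rfl
  rw [Consistent.paraboloid] at h6
  rw [h6]
  simp only at h3 h4 ⊢
  linarith

/-! ### The subsolution property -/

namespace Consistent

variable {P : FinalValueProblem N} {α ϱ : ℝ} {A : ℝ → ℕ → Sp N → ℝ → Prop}

/-- The strict PDE inequality leaves room to replace `φ` by the slightly steeper paraboloid of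
`le_paraboloid`, which `not_touched_above` forbids. -/
theorem not_isLocalMaxOn (hA : Consistent P α A) (hα : α < 1) (hΩ : BallDomain P.Ω ϱ)
    (hf : ContinuousOn
      (fun a : ℝ × Sp N × ℝ × Sp N × Mat N => P.f a.1 a.2.1 a.2.2.1 a.2.2.2.1 a.2.2.2.2)
      {a | a.2.1 ∈ closure P.Ω ∧ IsSelfAdjoint a.2.2.2.2})
    (hh : ContinuousOn P.h (frontier P.Ω)) {tₛ : ℝ} {u : Sp N × ℝ → ℝ}
    (hu : ∀ a ∈ cylinder P tₛ, (u a : EReal) = upperLimit P (levelSup A) a.1 a.2)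
    {x₀ : Sp N} (hx₀ : x₀ ∈ closure P.Ω) {t₀ : ℝ} (ht₀ : t₀ ∈ Ico tₛ P.T)
    {φ : Sp N × ℝ → ℝ} (hφ : ContDiff ℝ ∞ φ)
    (hmax : IsLocalMaxOn (fun a => u a - φ a) (cylinder P tₛ) (x₀, t₀))
    (hpde : pdeExpr P φ x₀ t₀ (u (x₀, t₀)) < 0)
    (hbd : x₀ ∈ frontier P.Ω → 0 < neumannExpr P φ x₀ t₀) : False := by
  have hφ2 : ContDiff ℝ 2 φ := contDiff_infty.1 hφ 2
  have h2 : ContDiff ℝ 2 fun y => φ (y, t₀) := hφ2.comp (contDiff_id.prodMk contDiff_const)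
  have hX : IsSelfAdjoint (spaceHess φ x₀ t₀) := isSelfAdjoint_fderiv_gradient h2 x₀
  rw [pdeExpr, sub_neg] at hpde
  obtain ⟨a, ha, haf⟩ := exists_between hpde
  obtain ⟨σ, hσ, hlt⟩ := exists_forall_lt_f hf hx₀ hX haf
  obtain ⟨κ, hκ, hκσ, hκa⟩ : ∃ κ > 0, 2 * κ < σ ∧ deriv (fun s => φ (x₀, s)) t₀ + κ < a := by
    refine ⟨min (σ / 4) ((a - deriv (fun s => φ (x₀, s)) t₀) / 2), ?_, ?_, ?_⟩
    · have : 0 < a - deriv (fun s => φ (x₀, s)) t₀ := by linarith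
      positivity
    · linarith [min_le_left (σ / 4) ((a - deriv (fun s => φ (x₀, s)) t₀) / 2)]
    · linarith [min_le_right (σ / 4) ((a - deriv (fun s => φ (x₀, s)) t₀) / 2)]
  obtain ⟨η₁, hη₁, hpar⟩ := le_paraboloid hφ x₀ t₀ (u (x₀, t₀)) hκ
  obtain ⟨η₂, hη₂, hball⟩ := Metric.mem_nhdsWithin_iff.1 hmax
  have hT : 0 < P.T - t₀ := by linarith [ht₀.2]
  set η := min η₁ (min (η₂ / 2) (P.T - t₀)) with hη
  have hη1 : η ≤ η₁ := min_le_left _ _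
  have hη2 : η ≤ η₂ / 2 := (min_le_right _ _).trans (min_le_left _ _)
  have hη3 : η ≤ P.T - t₀ := (min_le_right _ _).trans (min_le_right _ _)
  refine hA.not_touched_above hα hΩ hf hh hx₀ ht₀.2 (c := u (x₀, t₀))
    (a := deriv (fun s => φ (x₀, s)) t₀ + κ) (η₀ := η) (p := spaceGrad φ x₀ t₀)
    (X := spaceHess φ x₀ t₀ + (2 * κ) • 1) (isSelfAdjoint_add_smul_one hX _) (by positivity)
    (hu (x₀, t₀) ⟨hx₀, ht₀.1, ht₀.2.le⟩).symm ?_ ?_ ?_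
  · intro x hx hxd t ht
    have hmem : (x, t) ∈ cylinder P tₛ :=
      ⟨hx, ht₀.1.trans ht.1, by linarith [ht.2]⟩
    rw [← hu (x, t) hmem, EReal.coe_le_coe_iff]
    refine le_trans ?_ (hpar x (hxd.trans hη1) t ⟨ht.1, ht.2.trans (by linarith)⟩)
    have h3 : u (x, t) - φ (x, t) ≤ u (x₀, t₀) - φ (x₀, t₀) := by
      refine hball ⟨?_, hmem⟩
      rw [mem_ball, Prod.dist_eq, Real.dist_eq, max_lt_iff, abs_lt]
      refine ⟨by simp only; linarith, ?_, ?_⟩ <;> simp only <;> linarith [ht.1, ht.2]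
    linarith
  · refine hκa.trans (hlt t₀ (by simpa using hσ) x₀ hx₀ (by simpa using hσ) _ (by simpa using hσ)
      _ (by simpa using hσ) _ (isSelfAdjoint_add_smul_one hX _) ?_)
    rw [add_sub_cancel_left]
    exact (norm_smul_one_le (by positivity)).trans_lt hκσ
  · intro hx
    have := hbd hx
    rw [neumannExpr] at this
    linarith

theorem isViscositySubsolution (hA : Consistent P α A) (hα : α < 1) (hΩ : BallDomain P.Ω ϱ)
    (hf : ContinuousOn
      (fun a : ℝ × Sp N × ℝ × Sp N × Mat N => P.f a.1 a.2.1 a.2.2.1 a.2.2.2.1 a.2.2.2.2)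
      {a | a.2.1 ∈ closure P.Ω ∧ IsSelfAdjoint a.2.2.2.2})
    (hg : ContinuousOn P.g (closure P.Ω)) (hgb : BoundedOn P.g (closure P.Ω))
    (hh : ContinuousOn P.h (frontier P.Ω)) (hhb : BoundedOn P.h (frontier P.Ω)) {tₛ C : ℝ}
    (ht : tₛ ≤ P.T)
    (hC : ∀ a ∈ cylinder P tₛ, ((-C : ℝ) : EReal) ≤ upperLimit P (levelSup A) a.1 a.2 ∧
      upperLimit P (levelSup A) a.1 a.2 ≤ (C : EReal)) :
    IsViscositySubsolution P tₛ fun a => (upperLimit P (levelSup A) a.1 a.2).toReal := by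
  have hu : ∀ a ∈ cylinder P tₛ, (((upperLimit P (levelSup A) a.1 a.2).toReal : ℝ) : EReal) =
      upperLimit P (levelSup A) a.1 a.2 :=
    fun a ha => EReal.coe_toReal (ne_top_of_le_ne_top (EReal.coe_ne_top _) (hC a ha).2)
      (ne_bot_of_le_ne_bot (EReal.coe_ne_bot _) (hC a ha).1)
  refine ⟨upperSemicontinuousOn_toReal_upperLimit hC, ?_, ?_, ?_⟩
  · intro x₀ hx₀ t₀ ht₀ φ hφ hmax
    by_contra hlt
    refine hA.not_isLocalMaxOn hα hΩ hf hh hu (subset_closure hx₀) ht₀ hφ hmax (not_le.1 hlt)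
      fun hfr => ?_
    rw [hΩ.isOpen.frontier_eq] at hfr
    exact absurd hx₀ hfr.2
  · intro x₀ hx₀ t₀ ht₀ φ hφ hmax
    by_contra hlt
    rw [not_le, lt_min_iff] at hlt
    exact hA.not_isLocalMaxOn hα hΩ hf hh hu (frontier_subset_closure hx₀) ht₀ hφ hmax
      (by linarith [hlt.1]) fun _ => hlt.2
  · intro x hx
    have h1 := hA.upperLimit_final_le hα hΩ hg hgb hhb hx
    rw [← hu (x, P.T) ⟨hx, ht, le_rfl⟩, EReal.coe_le_coe_iff] at h1
    exact h1

end Consistent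

/-! ### Supersolutions by reflection -/

theorem spaceGrad_neg (φ : Sp N × ℝ → ℝ) (x : Sp N) (t : ℝ) :
    spaceGrad (fun b => -φ b) x t = -spaceGrad φ x t := by
  simp only [spaceGrad, gradient, fderiv_fun_neg, map_neg]

theorem spaceHess_neg (φ : Sp N × ℝ → ℝ) (x : Sp N) (t : ℝ) :
    spaceHess (fun b => -φ b) x t = -spaceHess φ x t := by
  simp only [spaceHess, spaceGrad_neg, fderiv_fun_neg]

theorem pdeExpr_neg (P : FinalValueProblem N) (φ : Sp N × ℝ → ℝ) (x : Sp N) (t z : ℝ) :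
    pdeExpr P.neg (fun b => -φ b) x t (-z) = -pdeExpr P φ x t z := by
  have h : deriv (fun s => -φ (x, s)) t = -deriv (fun s => φ (x, s)) t := deriv.fun_neg
  simp only [pdeExpr, FinalValueProblem.neg, spaceGrad_neg, spaceHess_neg, neg_neg, h]
  ring

theorem neumannExpr_neg (P : FinalValueProblem N) (φ : Sp N × ℝ → ℝ) (x : Sp N) (t : ℝ) :
    neumannExpr P.neg (fun b => -φ b) x t = -neumannExpr P φ x t := by
  simp only [neumannExpr, FinalValueProblem.neg, spaceGrad_neg, inner_neg_left]
  ring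

theorem IsViscositySubsolution.neg {P : FinalValueProblem N} {tₛ : ℝ} {u : Sp N × ℝ → ℝ}
    (hu : IsViscositySubsolution P.neg tₛ fun a => -u a) : IsViscositySupersolution P tₛ u := by
  have hmax : ∀ {φ : Sp N × ℝ → ℝ} {b : Sp N × ℝ},
      IsLocalMinOn (fun a => u a - φ a) (cylinder P tₛ) b →
      IsLocalMaxOn (fun a => -u a - -φ a) (cylinder P.neg tₛ) b := fun {φ b} h => by
    have h' := IsLocalMinOn.neg h
    have e : (fun a => -u a - -φ a) = fun a => -(u a - φ a) := by
      funext a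
      ring
    rw [e]
    exact h'
  refine ⟨?_, fun x₀ hx₀ t₀ ht₀ φ hφ hmin => ?_, fun x₀ hx₀ t₀ ht₀ φ hφ hmin => ?_,
    fun x hx => ?_⟩
  · intro a ha y hy
    have h := hu.usc a ha (-y) (neg_lt_neg hy)
    filter_upwards [h] with b hb
    exact neg_lt_neg_iff.1 hb
  · have h := hu.interior x₀ hx₀ t₀ ht₀ (fun b => -φ b) hφ.neg (hmax hmin)
    rw [pdeExpr_neg] at h
    linarith
  · have h := hu.boundary x₀ hx₀ t₀ ht₀ (fun b => -φ b) hφ.neg (hmax hmin)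
    rw [pdeExpr_neg, neumannExpr_neg, min_neg_neg] at h
    linarith
  · have h : -u (x, P.T) ≤ -P.g x := hu.final x hx
    linarith

/-- Needed because comparison identifies `uBar` and `vBar` only on the cylinder. -/
theorem IsViscositySupersolution.congr {P : FinalValueProblem N} {tₛ : ℝ} (ht : tₛ ≤ P.T)
    {u v : Sp N × ℝ → ℝ} (hu : IsViscositySupersolution P tₛ u)
    (h : EqOn v u (cylinder P tₛ)) : IsViscositySupersolution P tₛ v := by
  have hmin : ∀ {φ : Sp N × ℝ → ℝ} {b : Sp N × ℝ}, b ∈ cylinder P tₛ →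
      IsLocalMinOn (fun a => v a - φ a) (cylinder P tₛ) b →
      IsLocalMinOn (fun a => u a - φ a) (cylinder P tₛ) b := fun {φ b} hb hv => by
    filter_upwards [hv, self_mem_nhdsWithin] with a ha hac
    rwa [h hb, h hac] at ha
  refine ⟨?_, fun x₀ hx₀ t₀ ht₀ φ hφ hv => ?_, fun x₀ hx₀ t₀ ht₀ φ hφ hv => ?_, fun x hx => ?_⟩
  · intro a ha y hy
    rw [h ha] at hy
    filter_upwards [hu.lsc a ha y hy, self_mem_nhdsWithin] with b hb hbc
    rwa [h hbc]
  · have hmem : (x₀, t₀) ∈ cylinder P tₛ := ⟨subset_closure hx₀, ht₀.1, ht₀.2.le⟩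
    rw [h hmem]
    exact hu.interior x₀ hx₀ t₀ ht₀ φ hφ (hmin hmem hv)
  · have hmem : (x₀, t₀) ∈ cylinder P tₛ := ⟨frontier_subset_closure hx₀, ht₀.1, ht₀.2.le⟩
    rw [h hmem]
    exact hu.boundary x₀ hx₀ t₀ ht₀ φ hφ (hmin hmem hv)
  · rw [h (⟨hx, ht, le_rfl⟩ : (x, P.T) ∈ cylinder P tₛ)]
    exact hu.final x hx

/-! ### The relaxed limits of the game -/

/-- At a real `z` strictly between them the value would be neither nonnegative nor nonpositive.
Totality of the order suffices, without monotonicity in `z`. -/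
theorem vEps_le_uEps (P : FinalValueProblem N) (α β γ ε : ℝ) (j : ℕ) (x : Sp N) :
    vEps P α β γ ε j x ≤ uEps P α β γ ε j x := by
  by_contra h
  obtain ⟨z, hz1, hz2⟩ := EReal.exists_between_coe_real (not_le.1 h)
  rcases le_total 0 (valueU P α β γ ε j x z) with h0 | h0
  · exact absurd (le_iSup₂ (f := fun (z : ℝ) (_ : 0 ≤ valueU P α β γ ε j x z) => (z : EReal)) z h0)
      (not_le.2 hz1)
  · exact absurd (iInf₂_le (f := fun (z : ℝ) (_ : valueU P α β γ ε j x z ≤ 0) => (z : EReal)) z h0)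
      (not_le.2 hz2)

theorem levelSup_eq_neg_vEps (P : FinalValueProblem N) (α β γ ε : ℝ) (j : ℕ) (x : Sp N) :
    levelSup (fun ε j x z => valueU P α β γ ε j x (-z) ≤ 0) ε j x = -vEps P α β γ ε j x := by
  refine le_antisymm (iSup₂_le fun z hz => ?_) ?_
  · rw [EReal.le_neg]
    have := iInf₂_le (f := fun (z : ℝ) (_ : valueU P α β γ ε j x z ≤ 0) => (z : EReal)) (-z) hz
    rwa [EReal.coe_neg] at this
  · rw [EReal.neg_le]
    refine le_iInf₂ fun z hz => ?_
    rw [EReal.neg_le, ← EReal.coe_neg]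
    exact le_levelSup (A := fun ε j x z => valueU P α β γ ε j x (-z) ≤ 0) (by rwa [neg_neg])

theorem neg_vBar (P : FinalValueProblem N) (α β γ : ℝ) (x : Sp N) (t : ℝ) :
    upperLimit P.neg (levelSup fun ε j x z => valueU P α β γ ε j x (-z) ≤ 0) x t =
      -vBar P α β γ x t := by
  have h : (fun a : ℝ × Sp N × ℕ =>
      levelSup (fun ε j x z => valueU P α β γ ε j x (-z) ≤ 0) a.1 a.2.2 a.2.1) =
      -fun a => vEps P α β γ a.1 a.2.2 a.2.1 :=
    funext fun a => levelSup_eq_neg_vEps P α β γ a.1 a.2.2 a.2.1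
  rw [upperLimit, h, EReal.limsup_neg]
  rfl

theorem vBar_le_uBar {P : FinalValueProblem N} (α β γ : ℝ) {x : Sp N} {t : ℝ}
    (hx : x ∈ closure P.Ω) (ht : t ≤ P.T) : vBar P α β γ x t ≤ uBar P α β γ x t := by
  have := approach_neBot hx ht
  exact (liminf_le_limsup).trans
    (limsup_le_limsup (Eventually.of_forall fun a => vEps_le_uEps P α β γ a.1 a.2.2 a.2.1))

theorem Consistent.exists_upperLimit_le {P : FinalValueProblem N} {α ϱ : ℝ}
    {A : ℝ → ℕ → Sp N → ℝ → Prop} (hA : Consistent P α A) (hα : α < 1) (hΩ : BallDomain P.Ω ϱ)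
    (hg : BoundedOn P.g (closure P.Ω)) (hh : BoundedOn P.h (frontier P.Ω)) (tₛ : ℝ) :
    ∃ C : ℝ, ∀ x t, tₛ ≤ t → upperLimit P (levelSup A) x t ≤ (C : EReal) := by
  -- The margin 1 covers grid times slightly before `tₛ`.
  obtain ⟨C, hC⟩ := hA.exists_upper_bound hα hΩ hg hh (tₛ - 1)
  refine ⟨C, fun x t ht => upperLimit_le ?_⟩
  have hev : ∀ᶠ b : Sp N × ℝ in 𝓝 (x, t), tₛ - 1 ≤ b.2 :=
    (continuous_snd.tendsto (x, t)).eventually (Ici_mem_nhds (by simp only; linarith))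
  filter_upwards [eventually_approach_fst hC, eventually_approach_snd hev] with a ha ⟨hx, hb⟩
  exact levelSup_le fun z hz => ha a.2.2 a.2.1 hx z hb hz

end NeumannGame

end

/-! ### Assembly of the theorem -/

theorem theorem2p1 {N : ℕ} (hN : 1 ≤ N) (P : NeumannGame.FinalValueProblem N)
    (α β γ q r : ℝ)
    (hΩ : NeumannGame.IsC2Domain P.Ω)
    (hint : NeumannGame.UniformInteriorBall P.Ω)
    (hext : NeumannGame.UniformExteriorBall P.Ω)
    (hf : NeumannGame.FHypotheses P q r)
    (hg : ContinuousOn P.g (closure P.Ω)) (hg_bdd : NeumannGame.BoundedOn P.g (closure P.Ω))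
    (hh : ContinuousOn P.h (frontier P.Ω)) (hh_bdd : NeumannGame.BoundedOn P.h (frontier P.Ω))
    (hpar : NeumannGame.ExponentHypotheses α β γ q r)
    (tₛ : ℝ) (htₛ : tₛ < P.T) :
    (∃ C : ℝ, ∀ x ∈ closure P.Ω, ∀ t ∈ Set.Icc tₛ P.T,
      (-C : EReal) ≤ NeumannGame.uBar P α β γ x t ∧ NeumannGame.uBar P α β γ x t ≤ (C : EReal) ∧
      (-C : EReal) ≤ NeumannGame.vBar P α β γ x t ∧ NeumannGame.vBar P α β γ x t ≤ (C : EReal)) ∧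
    NeumannGame.IsViscositySubsolution P tₛ
      (fun a => (NeumannGame.uBar P α β γ a.1 a.2).toReal) ∧
    NeumannGame.IsViscositySupersolution P tₛ
      (fun a => (NeumannGame.vBar P α β γ a.1 a.2).toReal) ∧
    (NeumannGame.ComparisonPrinciple P tₛ →
      ∃ w : NeumannGame.Sp N × ℝ → ℝ,
        NeumannGame.IsViscositySolution P tₛ w ∧
        NeumannGame.BoundedOn w (NeumannGame.cylinder P tₛ) ∧
        (∀ w' : NeumannGame.Sp N × ℝ → ℝ, NeumannGame.IsViscositySolution P tₛ w' →
          NeumannGame.BoundedOn w' (NeumannGame.cylinder P tₛ) →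
          Set.EqOn w' w (NeumannGame.cylinder P tₛ)) ∧
        NeumannGame.ConvergesLocallyUniformly P tₛ (NeumannGame.uEps P α β γ) w ∧
        NeumannGame.ConvergesLocallyUniformly P tₛ (NeumannGame.vEps P α β γ) w) := by

  obtain ⟨ϱ, hB⟩ := NeumannGame.exists_ballDomain hΩ hint hext
  have hα : α < 1 := by linarith [hpar.α_lt]
  have hA := NeumannGame.consistent_nonneg_valueU hB hf hpar
  have hA' := NeumannGame.consistent_valueU_nonpos hB hf hg hh hh_bdd hpar
  have hgb' : NeumannGame.BoundedOn P.neg.g (closure P.neg.Ω) := by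
    obtain ⟨C, hC⟩ := hg_bdd
    exact ⟨C, fun a ha => (abs_neg (P.g a)).trans_le (hC a ha)⟩
  have hhb' : NeumannGame.BoundedOn P.neg.h (frontier P.neg.Ω) := by
    obtain ⟨C, hC⟩ := hh_bdd
    exact ⟨C, fun a ha => (abs_neg (P.h a)).trans_le (hC a ha)⟩
  have hf' : ContinuousOn (fun a : ℝ × NeumannGame.Sp N × ℝ × NeumannGame.Sp N × NeumannGame.Mat N =>
      P.neg.f a.1 a.2.1 a.2.2.1 a.2.2.2.1 a.2.2.2.2)
      {a | a.2.1 ∈ closure P.neg.Ω ∧ IsSelfAdjoint a.2.2.2.2} :=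
    (hf.continuous.comp (f := fun a : ℝ × NeumannGame.Sp N × ℝ × NeumannGame.Sp N ×
      NeumannGame.Mat N => (a.1, a.2.1, -a.2.2.1, -a.2.2.2.1, -a.2.2.2.2)) (by fun_prop)
      fun a ha => ⟨ha.1, NeumannGame.isSelfAdjoint_neg ha.2⟩).neg
  obtain ⟨C₁, hC₁⟩ := hA.exists_upperLimit_le hα hB hg_bdd hh_bdd tₛ
  obtain ⟨C₂, hC₂⟩ := hA'.exists_upperLimit_le hα hB hgb' hhb' tₛ
  obtain ⟨C, hC⟩ : ∃ C : ℝ, ∀ x ∈ closure P.Ω, ∀ t ∈ Set.Icc tₛ P.T,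
      (-C : EReal) ≤ NeumannGame.uBar P α β γ x t ∧ NeumannGame.uBar P α β γ x t ≤ (C : EReal) ∧
      (-C : EReal) ≤ NeumannGame.vBar P α β γ x t ∧
      NeumannGame.vBar P α β γ x t ≤ (C : EReal) := by
    -- Consistency bounds `uBar` only from above and `vBar` only from below; the other two bounds
    -- follow from `vBar ≤ uBar`.
    refine ⟨max C₁ C₂, fun x hx t ht => ?_⟩
    have h1 : NeumannGame.uBar P α β γ x t ≤ ((max C₁ C₂ : ℝ) : EReal) :=
      (hC₁ x t ht.1).trans (EReal.coe_le_coe_iff.2 (le_max_left _ _))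
    have h2 : -((max C₁ C₂ : ℝ) : EReal) ≤ NeumannGame.vBar P α β γ x t := by
      have h3 := hC₂ x t ht.1
      rw [NeumannGame.neg_vBar, EReal.neg_le] at h3
      exact (EReal.neg_le_neg_iff.2 (EReal.coe_le_coe_iff.2 (le_max_right _ _))).trans h3
    have h4 := NeumannGame.vBar_le_uBar α β γ hx ht.2
    exact ⟨h2.trans h4, h1, h2, h4.trans h1⟩
  have hsub : NeumannGame.IsViscositySubsolution P tₛ
      (fun a => (NeumannGame.uBar P α β γ a.1 a.2).toReal) :=
    hA.isViscositySubsolution hα hB hf.continuous hg hg_bdd hh hh_bdd htₛ.le (C := C)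
      fun a ha => ⟨by rw [EReal.coe_neg]; exact (hC a.1 ha.1 a.2 ha.2).1, (hC a.1 ha.1 a.2 ha.2).2.1⟩
  have hsuper : NeumannGame.IsViscositySupersolution P tₛ
      (fun a => (NeumannGame.vBar P α β γ a.1 a.2).toReal) := by
    have h1 := hA'.isViscositySubsolution hα hB hf' hg.neg hgb' hh.neg hhb' htₛ.le (C := C)
      fun a ha => by
        rw [NeumannGame.neg_vBar]
        have h := hC a.1 ha.1 a.2 ha.2
        exact ⟨by rw [EReal.coe_neg]; exact EReal.neg_le_neg_iff.2 h.2.2.2,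
          EReal.neg_le.2 h.2.2.1⟩
    refine NeumannGame.IsViscositySubsolution.neg ?_
    simpa only [NeumannGame.neg_vBar, EReal.toReal_neg_eq] using h1
  refine ⟨⟨C, hC⟩, hsub, hsuper, fun hcomp => ?_⟩
  have hcoeu : ∀ a ∈ NeumannGame.cylinder P tₛ,
      (((NeumannGame.uBar P α β γ a.1 a.2).toReal : ℝ) : EReal) =
        NeumannGame.uBar P α β γ a.1 a.2 := fun a ha => by
    have h := hC a.1 ha.1 a.2 ha.2
    refine EReal.coe_toReal (ne_top_of_le_ne_top (EReal.coe_ne_top C) h.2.1)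
      (ne_bot_of_le_ne_bot (EReal.coe_ne_bot (-C)) ?_)
    rw [EReal.coe_neg]
    exact h.1
  have hcoev : ∀ a ∈ NeumannGame.cylinder P tₛ,
      (((NeumannGame.vBar P α β γ a.1 a.2).toReal : ℝ) : EReal) =
        NeumannGame.vBar P α β γ a.1 a.2 := fun a ha => by
    have h := hC a.1 ha.1 a.2 ha.2
    refine EReal.coe_toReal (ne_top_of_le_ne_top (EReal.coe_ne_top C) h.2.2.2)
      (ne_bot_of_le_ne_bot (EReal.coe_ne_bot (-C)) ?_)
    rw [EReal.coe_neg]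
    exact h.2.2.1
  have hbu : NeumannGame.BoundedOn (fun a => (NeumannGame.uBar P α β γ a.1 a.2).toReal)
      (NeumannGame.cylinder P tₛ) := ⟨C, fun a ha => by
    have h := hC a.1 ha.1 a.2 ha.2
    rw [← hcoeu a ha, ← EReal.coe_neg, EReal.coe_le_coe_iff, EReal.coe_le_coe_iff] at h
    exact abs_le.2 ⟨h.1, h.2.1⟩⟩
  have hbv : NeumannGame.BoundedOn (fun a => (NeumannGame.vBar P α β γ a.1 a.2).toReal)
      (NeumannGame.cylinder P tₛ) := ⟨C, fun a ha => by
    have h := (hC a.1 ha.1 a.2 ha.2).2.2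
    rw [← hcoev a ha, ← EReal.coe_neg, EReal.coe_le_coe_iff, EReal.coe_le_coe_iff] at h
    exact abs_le.2 ⟨h.1, h.2⟩⟩
  have heq : Set.EqOn (fun a => (NeumannGame.uBar P α β γ a.1 a.2).toReal)
      (fun a => (NeumannGame.vBar P α β γ a.1 a.2).toReal) (NeumannGame.cylinder P tₛ) := by
    intro a ha
    refine le_antisymm (hcomp _ _ hsub hsuper hbu hbv a ha) ?_
    have h := NeumannGame.vBar_le_uBar α β γ ha.1 ha.2.2
    rwa [← hcoeu a ha, ← hcoev a ha, EReal.coe_le_coe_iff] at h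
  have hsuper' := hsuper.congr htₛ.le heq
  have hcont : ContinuousOn (fun a => (NeumannGame.uBar P α β γ a.1 a.2).toReal)
      (NeumannGame.cylinder P tₛ) :=
    continuousOn_iff_lower_upperSemicontinuousOn.2 ⟨hsuper'.lsc, hsub.usc⟩
  have hupper : ∀ K : Set (NeumannGame.Sp N × ℝ), IsCompact K → K ⊆ NeumannGame.cylinder P tₛ →
      ∀ δ : ℝ, 0 < δ → ∀ᶠ ε in nhdsWithin (0 : ℝ) (Set.Ioi 0), ∀ (j : ℕ) (x : NeumannGame.Sp N),
        (x, P.T - j * ε ^ 2) ∈ K → NeumannGame.uEps P α β γ ε j x <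
          (((NeumannGame.uBar P α β γ x (P.T - j * ε ^ 2)).toReal + δ : ℝ) : EReal) := by
    -- The bound `Φ` is evaluated at the grid point itself and must be lower semicontinuous; this is
    -- where continuity of the limit turns the relaxed limit into a uniform estimate.
    intro K hK hKc δ hδ
    obtain ⟨η, hη, h⟩ := NeumannGame.eventually_lt_of_isCompact (P := P)
      (W := NeumannGame.uEps P α β γ) hK hKc
      (Φ := fun a => (NeumannGame.uBar P α β γ a.1 a.2).toReal + δ)
      (hcont.add continuousOn_const).lowerSemicontinuousOn (fun a ha => by
        change NeumannGame.uBar P α β γ a.1 a.2 < _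
        rw [← hcoeu a (hKc ha), EReal.coe_lt_coe_iff, EReal.toReal_coe]
        linarith)
    filter_upwards [Ioo_mem_nhdsGT hη] with ε hε j x hx
    exact h ε hε.1 hε.2 _ hx x (hKc hx).1 (by simpa using hη) j (by simpa using hη) (hKc hx)
  have hlower : ∀ K : Set (NeumannGame.Sp N × ℝ), IsCompact K → K ⊆ NeumannGame.cylinder P tₛ →
      ∀ δ : ℝ, 0 < δ → ∀ᶠ ε in nhdsWithin (0 : ℝ) (Set.Ioi 0), ∀ (j : ℕ) (x : NeumannGame.Sp N),
        (x, P.T - j * ε ^ 2) ∈ K →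
          (((NeumannGame.uBar P α β γ x (P.T - j * ε ^ 2)).toReal - δ : ℝ) : EReal) <
            NeumannGame.vEps P α β γ ε j x := by
    intro K hK hKc δ hδ
    obtain ⟨η, hη, h⟩ := NeumannGame.eventually_lt_of_isCompact (P := P.neg)
      (W := NeumannGame.levelSup fun ε j x z => NeumannGame.valueU P α β γ ε j x (-z) ≤ 0) hK hKc
      (Φ := fun a => -(NeumannGame.uBar P α β γ a.1 a.2).toReal + δ)
      (hcont.neg.add continuousOn_const).lowerSemicontinuousOn (fun a ha => by
        rw [NeumannGame.neg_vBar, ← hcoev a (hKc ha), ← EReal.coe_neg, EReal.coe_lt_coe_iff]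
        have := heq (hKc ha)
        simp only at this
        rw [this]
        linarith)
    filter_upwards [Ioo_mem_nhdsGT hη] with ε hε j x hx
    have h1 := h ε hε.1 hε.2 _ hx x (hKc hx).1 (by simpa using hη) j
      (by simpa [NeumannGame.FinalValueProblem.neg] using hη) (hKc hx)
    rw [NeumannGame.levelSup_eq_neg_vEps, EReal.neg_lt_comm, ← EReal.coe_neg] at h1
    refine lt_of_eq_of_lt ?_ h1
    congr 1
    change _ = -(-(NeumannGame.uBar P α β γ x (P.T - j * ε ^ 2)).toReal + δ)
    ring
  refine ⟨fun a => (NeumannGame.uBar P α β γ a.1 a.2).toReal, ⟨hcont, hsub, hsuper'⟩, hbu, ?_, ?_, ?_⟩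
  · intro w' hw' hb' a ha
    exact le_antisymm (hcomp _ _ hw'.sub hsuper' hb' hbu a ha)
      (hcomp _ _ hsub hw'.super hbu hb' a ha)
  -- Only an upper bound on `uEps` and a lower bound on `vEps` are available; `vEps ≤ uEps` supplies
  -- the other two.
  · intro K hK hKc δ hδ
    filter_upwards [hupper K hK hKc δ hδ, hlower K hK hKc δ hδ] with ε h1 h2 j x hx
    exact ⟨(h2 j x hx).trans_le (NeumannGame.vEps_le_uEps _ _ _ _ _ _ _), h1 j x hx⟩
  · intro K hK hKc δ hδ
    filter_upwards [hupper K hK hKc δ hδ, hlower K hK hKc δ hδ] with ε h1 h2 j x hx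
    exact ⟨h2 j x hx, (NeumannGame.vEps_le_uEps _ _ _ _ _ _ _).trans_lt (h1 j x hx)⟩
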